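/- Let $k$ be a field of characteristic zero and let $m,n\ge 2$ be integers. For an integer $r\ge 1$ let $U_r(k)=\{\omega\in k:\omega^r=1\}$ and let $P_r(k)$ be the set of primitive $r$-th roots of unity in $k$. In a Hopf algebra, an element $g$ is called group-like if $\Delta(g)=g\otimes g$ and $\varepsilon(g)=1$; for a group-like $g$, an element $y$ is called $(g,1)$-primitive if $\Delta(y)=y\otimes g+1\otimes y$ (so $\varepsilon(y)=0$). For $q\in P_n(k)$ the Taft Hopf algebra $T_{n^2}(q)$ is the algebra generated by $h,x$ with relations $h^n=1$, $x^n=0$, $xh=q\,hx$, in which $h$ is group-like and $x$ is $(h,1)$-primitive (with antipode $S(h)=h^{-1}$, $S(x)=-xh^{-1}$). For $q\in P_m(k)$, $\overline q\in P_n(k)$ and $\sigma\in U_{\gcd(m,n)}(k)$, let $\mathrm T^{\sigma}_{n,m}(\overline q,q)$ be the Hopf algebra generated as an algebra by $h,x,H,X$ with relations $$h^m=H^n=1,\quad x^m=X^n=0,\quad xh=q\,hx,\quad XH=\overline q\,HX,$$ $$xH=\sigma Hx,\quad hX=\sigma Xh,\quad xX=\sigma Xx,\quad hH=Hh,$$ in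 which $h,H$ are group-like, $x$ is $(h,1)$-primitive and $X$ is $(H,1)$-primitive. For $q\in P_n(k)$ and $\alpha\in k^*$, let $\mathrm Q^{\alpha}_n(q)$ be the Hopf algebra generated as an algebra by $h,x,H,X$ with relations $$h^n=H^n=1,\quad x^n=X^n=0,\quad xh=q\,hx,\quad XH=q^{n-1}HX,$$ $$xH=q\,Hx,\quad hX=q\,Xh,\quad xX-q\,Xx=\alpha(1-Hh),\quad hH=Hh,$$ in which $h,H$ are group-like, $x$ is $(h,1)$-primitive and $X$ is $(H,1)$-primitive. For a finite dimensional Hopf algebra $A$ with (bijective) antipode $S$, the Drinfeld double $D(A)$ is the coalgebra $(A^*)^{\mathrm{cop}}\otimes A$ (tensor product of coalgebras) with unit $\varepsilon\otimes 1$ and product $$(f\otimes a)(g\otimes b)=f\,g\bigl(S^{-1}(a_{(3)})\,?\,a_{(1)}\bigr)\otimes a_{(2)}b ,$$ where $g(u\,?\,v)$ denotes the linear form $w\mapsto g(uwv)$ and the product of linear forms is the convolution product. **Theorem.** 1. Let $q\in P_m(k)$ and $\overline q\in P_n(k)$, and suppose that $n\ne m$, or that $m=n$ and $\overline q\ne q$.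 Then for all $\sigma,\sigma'\in U_{\gcd(m,n)}(k)$ there is an isomorphism of Hopf algebras $\mathrm T^{\sigma}_{n,m}(\overline q,q)\cong\mathrm T^{\sigma'}_{n,m}(\overline q,q)$ if and only if $\sigma=\sigma'$. 2. Let $q\in P_n(k)$. For all $\sigma,\sigma'\in U_n(k)$ there is an isomorphism of Hopf algebras $\mathrm T^{\sigma}_{n,n}(q,q)\cong\mathrm T^{\sigma'}_{n,n}(q,q)$ if and only if $\sigma'=\sigma$ or $\sigma'=\sigma^{-1}$. 3. Let $q\in P_n(k)$. For every $\alpha\in k^*$ there is an isomorphism of Hopf algebras $\mathrm Q^{\alpha}_n(q)\cong\mathrm Q^{1}_n(q)$. Moreover, $\mathrm Q^{1}_n(q)$ is isomorphic as a Hopf algebra to the Drinfeld double $D\bigl(T_{n^2}(q)\bigr)$. 4. Let $q\in P_n(k)$. For every $\sigma\in U_n(k)$, the Hopf algebras $\mathrm Q^{1}_n(q)$ and $\mathrm T^{\sigma}_{n,n}(q^{n-1},q)$ are not isomorphic. -/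

import Mathlib

open scoped TensorProduct

noncomputable section

namespace TaftDouble

universe u

section QBinomial

variable {k : Type u} [Field k]

/-- The Gaussian binomial coefficient `[i + j choose i]` at `q`. -/
def gaussCoeff (q : k) : ℕ → ℕ → k
  | 0, _ => 1
  | _ + 1, 0 => 1
  | i + 1, j + 1 => gaussCoeff q i (j + 1) + q ^ (i + 1) * gaussCoeff q (i + 1) j

theorem gaussCoeff_zero_left (q : k) (j : ℕ) : gaussCoeff q 0 j = 1 := by
  simp [gaussCoeff]

theorem gaussCoeff_zero_right (q : k) (i : ℕ) : gaussCoeff q i 0 = 1 := by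
  cases i <;> simp [gaussCoeff]

theorem gaussCoeff_succ (q : k) (i j : ℕ) : gaussCoeff q (i + 1) (j + 1) =
    gaussCoeff q i (j + 1) + q ^ (i + 1) * gaussCoeff q (i + 1) j := by
  simp [gaussCoeff]

theorem gaussCoeff_aux (q : k) (N : ℕ) : ∀ i j : ℕ, i + j = N →
    (1 - q ^ (i + 1)) * gaussCoeff q (i + 1) j = (1 - q ^ (i + j + 1)) * gaussCoeff q i j ∧
    (1 - q ^ (j + 1)) * gaussCoeff q i (j + 1) = (1 - q ^ (i + j + 1)) * gaussCoeff q i j := by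
  induction N with
  | zero =>
    intro i j h
    obtain ⟨rfl, rfl⟩ : i = 0 ∧ j = 0 := by omega
    simp [gaussCoeff]
  | succ N ih =>
    intro i j h
    constructor
    · cases j with
      | zero => simp [gaussCoeff_zero_right]
      | succ j =>
        have h2 := (ih i j (by omega)).2
        rw [gaussCoeff_succ]
        have h1 := (ih i j (by omega)).1
        linear_combination q ^ (i + 1) * h1 - q ^ (i + 1) * h2
    · cases i with
      | zero => simp [gaussCoeff_zero_left]
      | succ i =>
        have h2 := (ih i j (by omega)).2
        have h1 := (ih i j (by omega)).1
        rw [gaussCoeff_succ]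
        linear_combination h2 - h1

theorem pos_of_mem_primitiveRoots {m : ℕ} {q : k} (hq : q ∈ primitiveRoots m k) : 0 < m := by
  rcases Nat.eq_zero_or_pos m with rfl | h
  · simp at hq
  · exact h

variable {R : Type*} [Ring R] [Algebra k R]

theorem mul_pow_of_qcomm {q : k} {a b : R} (h : b * a = q • (a * b)) (j : ℕ) :
    b * a ^ j = q ^ j • (a ^ j * b) := by
  induction j with
  | zero => simp
  | succ j ih =>
    rw [pow_succ, ← mul_assoc, ih, smul_mul_assoc, mul_assoc, h, mul_smul_comm, smul_smul,
      ← pow_succ, mul_assoc]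

theorem mul_pow_eq_zero_of_qcomm {q : k} {a b : R} (h : b * a = q • (a * b)) {m : ℕ}
    (ha : a ^ m = 0) : (a * b) ^ m = 0 := by
  have key : ∀ j : ℕ, ∃ c : R, (a * b) ^ j = a ^ j * c := by
    intro j
    induction j with
    | zero => exact ⟨1, by simp⟩
    | succ j ih =>
      obtain ⟨c, hc⟩ := ih
      refine ⟨q ^ j • (b * c), ?_⟩
      rw [pow_succ', hc, mul_assoc, ← mul_assoc b, mul_pow_of_qcomm h, pow_succ']
      simp only [smul_mul_assoc, mul_smul_comm, mul_assoc]
  obtain ⟨c, hc⟩ := key m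
  rw [hc, ha, zero_mul]

theorem add_pow_of_qcomm {q : k} {a b : R} (h : b * a = q • (a * b)) (N : ℕ) :
    (a + b) ^ N = ∑ p ∈ Finset.HasAntidiagonal.antidiagonal N, gaussCoeff q p.1 p.2 • (a ^ p.1 * b ^ p.2) := by
  induction N with
  | zero => simp [gaussCoeff]
  | succ N ih =>
    have e : ∀ p : ℕ × ℕ, (a + b) * gaussCoeff q p.1 p.2 • (a ^ p.1 * b ^ p.2) =
        gaussCoeff q p.1 p.2 • (a ^ (p.1 + 1) * b ^ p.2) +
        (q ^ p.1 * gaussCoeff q p.1 p.2) • (a ^ p.1 * b ^ (p.2 + 1)) := by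
      intro p
      rw [mul_smul_comm, add_mul, smul_add, ← mul_assoc, ← mul_assoc, mul_pow_of_qcomm h,
        pow_succ', smul_mul_assoc, smul_smul, mul_assoc (a ^ p.1), ← pow_succ' b,
        mul_comm (q ^ p.1)]
    rw [pow_succ', ih, Finset.mul_sum, Finset.sum_congr rfl (fun p _ => e p),
      Finset.sum_add_distrib]
    cases N with
    | zero => rw [Finset.Nat.sum_antidiagonal_succ]; simp [gaussCoeff, add_comm]
    | succ N =>
      conv_rhs => rw [Finset.Nat.sum_antidiagonal_succ, Finset.Nat.sum_antidiagonal_succ']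
      conv_lhs =>
        congr
        · rw [Finset.Nat.sum_antidiagonal_succ']
        · rw [Finset.Nat.sum_antidiagonal_succ]
      simp only [gaussCoeff_succ, add_smul, Finset.sum_add_distrib, gaussCoeff_zero_left,
        gaussCoeff_zero_right]
      simp only [pow_zero, one_smul, mul_one, one_mul]
      abel

/-- The `q`-binomial formula at a primitive `m`-th root of unity. -/
theorem add_pow_of_primitive {m : ℕ} {q : k} (hq : q ∈ primitiveRoots m k) {a b : R}
    (h : b * a = q • (a * b)) : (a + b) ^ m = a ^ m + b ^ m := by
  have hm : 0 < m := pos_of_mem_primitiveRoots hq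
  have hp : IsPrimitiveRoot q m := (mem_primitiveRoots hm).1 hq
  obtain ⟨N, rfl⟩ : ∃ N, m = N + 1 := ⟨m - 1, by omega⟩
  rw [add_pow_of_qcomm h, Finset.Nat.sum_antidiagonal_succ]
  cases N with
  | zero => simp [gaussCoeff, add_comm]
  | succ N =>
    rw [Finset.Nat.sum_antidiagonal_succ']
    have : ∀ p ∈ Finset.HasAntidiagonal.antidiagonal N,
        gaussCoeff q (p.1 + 1) (p.2 + 1) • (a ^ (p.1 + 1) * b ^ (p.2 + 1)) = 0 := by
      intro p hpN
      have hs : p.1 + p.2 = N := by simpa using hpN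
      have h1 := (gaussCoeff_aux q _ p.1 (p.2 + 1) rfl).1
      rw [show p.1 + (p.2 + 1) + 1 = N + 1 + 1 by omega, hp.pow_eq_one, sub_self, zero_mul] at h1
      have h2 : (1 : k) - q ^ (p.1 + 1) ≠ 0 := fun h0 =>
        hp.pow_ne_one_of_pos_of_lt (by omega) (by omega) (sub_eq_zero.1 h0).symm
      rw [(mul_eq_zero.1 h1).resolve_left h2, zero_smul]
    rw [Finset.sum_eq_zero this]
    simp [gaussCoeff_zero_left, gaussCoeff_zero_right, add_comm]

theorem pow_pred_mem_primitiveRoots {n : ℕ} {q : k} (hq : q ∈ primitiveRoots n k) :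
    q ^ (n - 1) ∈ primitiveRoots n k := by
  have hn : 0 < n := pos_of_mem_primitiveRoots hq
  have hp : IsPrimitiveRoot q n := (mem_primitiveRoots hn).1 hq
  rw [mem_primitiveRoots hn]
  refine hp.pow_of_coprime _ ?_
  exact (Nat.coprime_self_sub_left hn).2 (Nat.coprime_one_left n)

end QBinomial

section Generators

open Coalgebra LinearMap WithConv

variable {k : Type u} [CommRing k] {B : Type*} [Ring B] [Bialgebra k B]

theorem conv_antihom_mul_id (f : B →ₗ[k] B) (hf : ∀ x y, f (x * y) = f y * f x) {x y : B}
    (hx : (toConv f * toConv LinearMap.id : WithConv (B →ₗ[k] B)) x = algebraMap k B (counit x))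
    (hy : (toConv f * toConv LinearMap.id : WithConv (B →ₗ[k] B)) y = algebraMap k B (counit y)) :
    (toConv f * toConv LinearMap.id : WithConv (B →ₗ[k] B)) (x * y) =
      algebraMap k B (counit (x * y)) := by
  rw [(ℛ k x).convMul_apply] at hx
  rw [(ℛ k y).convMul_apply] at hy
  rw [((ℛ k x).mul (ℛ k y)).convMul_apply]
  simp only [Coalgebra.Repr.mul_index, Coalgebra.Repr.mul_left, Coalgebra.Repr.mul_right,
    LinearMap.id_apply, hf] at hx hy ⊢
  rw [Finset.sum_product_right]
  have : ∀ j : B × B, ∑ i ∈ (ℛ k x).index, f ((ℛ k y).left j) * f ((ℛ k x).left i) *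
      ((ℛ k x).right i * (ℛ k y).right j) =
      (algebraMap k B (counit x)) * (f ((ℛ k y).left j) * (ℛ k y).right j) := by
    intro j
    rw [← mul_assoc, Algebra.commutes, ← hx, Finset.mul_sum, Finset.sum_mul]
    simp only [mul_assoc]
  rw [Finset.sum_congr rfl (fun j _ => this j), ← Finset.mul_sum, hy, Bialgebra.counit_mul, map_mul]

theorem conv_id_mul_antihom (f : B →ₗ[k] B) (hf : ∀ x y, f (x * y) = f y * f x) {x y : B}
    (hx : (toConv LinearMap.id * toConv f : WithConv (B →ₗ[k] B)) x = algebraMap k B (counit x))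
    (hy : (toConv LinearMap.id * toConv f : WithConv (B →ₗ[k] B)) y = algebraMap k B (counit y)) :
    (toConv LinearMap.id * toConv f : WithConv (B →ₗ[k] B)) (x * y) =
      algebraMap k B (counit (x * y)) := by
  rw [(ℛ k x).convMul_apply] at hx
  rw [(ℛ k y).convMul_apply] at hy
  rw [((ℛ k x).mul (ℛ k y)).convMul_apply]
  simp only [Coalgebra.Repr.mul_index, Coalgebra.Repr.mul_left, Coalgebra.Repr.mul_right,
    LinearMap.id_apply, hf] at hx hy ⊢
  rw [Finset.sum_product]
  have : ∀ i : B × B, ∑ j ∈ (ℛ k y).index, (ℛ k x).left i * (ℛ k y).left j *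
      (f ((ℛ k y).right j) * f ((ℛ k x).right i)) =
      (ℛ k x).left i * f ((ℛ k x).right i) * (algebraMap k B (counit y)) := by
    intro i
    rw [mul_assoc, ← Algebra.commutes, ← hy, Finset.sum_mul, Finset.mul_sum]
    simp only [mul_assoc]
  rw [Finset.sum_congr rfl (fun j _ => this j), ← Finset.sum_mul, hx, Bialgebra.counit_mul, map_mul]

theorem conv_mul_algebraMap (f g : B →ₗ[k] B) (hf : f 1 = 1) (hg : g 1 = 1) (r : k) :
    (toConv f * toConv g : WithConv (B →ₗ[k] B)) (algebraMap k B r) =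
      algebraMap k B (counit (algebraMap k B r)) := by
  rw [Algebra.algebraMap_eq_smul_one, map_smul, map_smul, convMul_apply]
  simp [Algebra.TensorProduct.one_def, hf, hg, Algebra.algebraMap_eq_smul_one]

/-- An anti-homomorphism which satisfies the antipode identities on algebra generators of a
bialgebra is an antipode. -/
abbrev hopfAlgebraOfGenerators (S : B →ₐ[k] Bᵐᵒᵖ) (s : Set B) (hs : Algebra.adjoin k s = ⊤)
    (hl : ∀ b ∈ s, (toConv ((MulOpposite.opLinearEquiv k).symm.toLinearMap ∘ₗ S.toLinearMap) *
      toConv LinearMap.id : WithConv (B →ₗ[k] B)) b = algebraMap k B (counit b))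
    (hr : ∀ b ∈ s, (toConv LinearMap.id * toConv ((MulOpposite.opLinearEquiv k).symm.toLinearMap ∘ₗ
      S.toLinearMap) : WithConv (B →ₗ[k] B)) b = algebraMap k B (counit b)) :
    HopfAlgebra k B := by
  refine .ofConvInverse ((MulOpposite.opLinearEquiv k).symm.toLinearMap ∘ₗ S.toLinearMap) ?_ ?_
  · apply WithConv.ext
    ext b
    have hb : b ∈ Algebra.adjoin k s := hs ▸ Algebra.mem_top
    change (_ * _ : WithConv (B →ₗ[k] B)) _ = algebraMap k B (counit _)
    induction hb using Algebra.adjoin_induction with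
    | mem x hx => exact hl x hx
    | algebraMap r => exact conv_mul_algebraMap _ _ (by simp) (by simp) r
    | add x y _ _ hx hy => rw [map_add, map_add, hx, hy, map_add]
    | mul x y _ _ hx hy => exact conv_antihom_mul_id _ (fun x y => by simp) hx hy
  · apply WithConv.ext
    ext b
    have hb : b ∈ Algebra.adjoin k s := hs ▸ Algebra.mem_top
    change (_ * _ : WithConv (B →ₗ[k] B)) _ = algebraMap k B (counit _)
    induction hb using Algebra.adjoin_induction with
    | mem x hx => exact hr x hx
    | algebraMap r => exact conv_mul_algebraMap _ _ (by simp) (by simp) r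
    | add x y _ _ hx hy => rw [map_add, map_add, hx, hy, map_add]
    | mul x y _ _ hx hy => exact conv_id_mul_antihom _ (fun x y => by simp) hx hy

end Generators

section TensorRelations

variable {k : Type u} [Field k] {A : Type*} [Ring A] [Algebra k A]

theorem groupLike_pow_tmul {g : A} {m : ℕ} (h : g ^ m = 1) : (g ⊗ₜ[k] g) ^ m = 1 := by
  rw [Algebra.TensorProduct.tmul_pow, h, Algebra.TensorProduct.one_def]

theorem skew_mul_groupLike {c : k} {x g G : A} (h : x * G = c • (G * x)) (hg : g * G = G * g) :
    (x ⊗ₜ[k] g + 1 ⊗ₜ x) * (G ⊗ₜ G) = c • ((G ⊗ₜ G) * (x ⊗ₜ g + 1 ⊗ₜ x)) := by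
  simp only [add_mul, mul_add, Algebra.TensorProduct.tmul_mul_tmul, h, hg, one_mul, mul_one,
    smul_add, TensorProduct.smul_tmul', TensorProduct.tmul_smul]

theorem groupLike_mul_skew {c : k} {x g G : A} (h : G * x = c • (x * G)) (hg : g * G = G * g) :
    (G ⊗ₜ[k] G) * (x ⊗ₜ g + 1 ⊗ₜ x) = c • ((x ⊗ₜ g + 1 ⊗ₜ x) * (G ⊗ₜ G)) := by
  simp only [add_mul, mul_add, Algebra.TensorProduct.tmul_mul_tmul, h, hg, one_mul, mul_one,
    smul_add, TensorProduct.smul_tmul', TensorProduct.tmul_smul]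

theorem skew_pow {m : ℕ} {q : k} (hq : q ∈ primitiveRoots m k) {x g : A}
    (h : x * g = q • (g * x)) (hx : x ^ m = 0) : (x ⊗ₜ[k] g + 1 ⊗ₜ x) ^ m = 0 := by
  rw [add_pow_of_primitive hq]
  · rw [Algebra.TensorProduct.tmul_pow, Algebra.TensorProduct.tmul_pow, hx, TensorProduct.zero_tmul,
      TensorProduct.tmul_zero, add_zero]
  · simp only [Algebra.TensorProduct.tmul_mul_tmul, h, one_mul, mul_one, TensorProduct.tmul_smul]

theorem skew_mul_skew {c a : k} {x g X G : A} (h1 : x * G = c • (G * x))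
    (h2 : g * X = c • (X * g)) (hg : g * G = G * g)
    (h3 : x * X = c • (X * x) + a • (1 - G * g)) :
    (x ⊗ₜ[k] g + 1 ⊗ₜ x) * (X ⊗ₜ G + 1 ⊗ₜ X) =
      c • ((X ⊗ₜ G + 1 ⊗ₜ X) * (x ⊗ₜ g + 1 ⊗ₜ x)) + a • (1 - (G ⊗ₜ G) * (g ⊗ₜ g)) := by
  simp only [add_mul, mul_add, Algebra.TensorProduct.tmul_mul_tmul, h1, h2, h3, hg, one_mul,
    mul_one, smul_add, TensorProduct.smul_tmul', TensorProduct.tmul_smul, TensorProduct.add_tmul,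
    TensorProduct.tmul_add, smul_sub, TensorProduct.sub_tmul, TensorProduct.tmul_sub,
    Algebra.TensorProduct.one_def]
  abel

theorem groupLike_inv {g : A} {m : ℕ} (hm : 0 < m) (h : g ^ m = 1) :
    g * g ^ (m - 1) = 1 ∧ g ^ (m - 1) * g = 1 := by
  rw [← pow_succ', ← pow_succ, Nat.sub_add_cancel hm]
  exact ⟨h, h⟩

theorem inv_mul_skew {c : k} {x G G' : A} (h1 : G * G' = 1) (h2 : G' * G = 1)
    (h : x * G = c • (G * x)) : G' * x = c • (x * G') := by
  calc G' * x = G' * (x * G) * G' := by rw [mul_assoc, mul_assoc, h1, mul_one]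
    _ = c • (x * G') := by rw [h, mul_smul_comm, smul_mul_assoc, ← mul_assoc G', h2, one_mul]

theorem skew_mul_inv {c : k} {x G G' : A} (h1 : G * G' = 1) (h2 : G' * G = 1)
    (h : G * x = c • (x * G)) : x * G' = c • (G' * x) := by
  calc x * G' = G' * (G * x) * G' := by rw [← mul_assoc, h2, one_mul]
    _ = c • (G' * x) := by
      rw [h, mul_smul_comm, smul_mul_assoc, mul_assoc, mul_assoc, h1, mul_one]

end TensorRelations

section Taft

variable {k : Type u} [Field k] {m : ℕ} {q : k}

/-- Names of the generators `h`, `x` of the Taft algebra. -/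
inductive TaftGen : Type
  | h | x

open FreeAlgebra in
/-- The defining relations `h ^ m = 1`, `x ^ m = 0`, `x h = q h x` of the Taft algebra. -/
inductive TaftRel (m : ℕ) (q : k) : FreeAlgebra k TaftGen → FreeAlgebra k TaftGen → Prop
  | h_pow : TaftRel m q (ι k .h ^ m) 1
  | x_pow : TaftRel m q (ι k .x ^ m) 0
  | x_h : TaftRel m q (ι k .x * ι k .h) (q • (ι k .h * ι k .x))

/-- The Taft algebra `T_{m²}(q)`, for a primitive `m`-th root of unity `q`: the algebra generated by
`h` and `x` subject to `h ^ m = 1`, `x ^ m = 0` and `x h = q h x`. -/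
def TaftAlgebra (_hq : q ∈ primitiveRoots m k) : Type u := RingQuot (TaftRel m q)

namespace TaftAlgebra

variable (hq : q ∈ primitiveRoots m k)

instance : Ring (TaftAlgebra hq) := inferInstanceAs (Ring (RingQuot _))

instance : Algebra k (TaftAlgebra hq) := inferInstanceAs (Algebra k (RingQuot _))

/-- The canonical projection from the free algebra. -/
def mk : FreeAlgebra k TaftGen →ₐ[k] TaftAlgebra hq := RingQuot.mkAlgHom k (TaftRel m q)

/-- The generator `h`. -/
def h : TaftAlgebra hq := mk hq (FreeAlgebra.ι k .h)

/-- The generator `x`. -/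
def x : TaftAlgebra hq := mk hq (FreeAlgebra.ι k .x)

theorem mk_rel {a b : FreeAlgebra k TaftGen} (hab : TaftRel m q a b) : mk hq a = mk hq b :=
  RingQuot.mkAlgHom_rel k hab

theorem h_pow : h hq ^ m = 1 := by
  simpa [h, x] using mk_rel hq .h_pow

theorem x_pow : x hq ^ m = 0 := by
  simpa [h, x] using mk_rel hq .x_pow

theorem x_mul_h : x hq * h hq = q • (h hq * x hq) := by
  simpa [h, x] using mk_rel hq .x_h

variable {A : Type*} [Ring A] [Algebra k A]

/-- The images of the generators prescribed by `a` and `b`. -/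
def genMap (a b : A) : TaftGen → A
  | .h => a
  | .x => b

/-- The universal property of the Taft algebra. -/
def lift (a b : A) (h1 : a ^ m = 1) (h2 : b ^ m = 0) (h3 : b * a = q • (a * b)) :
    TaftAlgebra hq →ₐ[k] A :=
  RingQuot.liftAlgHom k ⟨FreeAlgebra.lift k (genMap a b), by
    intro y z hyz
    cases hyz <;> simp [genMap, h1, h2, h3]⟩

@[simp]
theorem lift_h (a b : A) (h1 : a ^ m = 1) (h2 : b ^ m = 0) (h3 : b * a = q • (a * b)) :
    lift hq a b h1 h2 h3 (h hq) = a :=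
  (RingQuot.liftAlgHom_mkAlgHom_apply ..).trans (by simp [genMap])

@[simp]
theorem lift_x (a b : A) (h1 : a ^ m = 1) (h2 : b ^ m = 0) (h3 : b * a = q • (a * b)) :
    lift hq a b h1 h2 h3 (x hq) = b :=
  (RingQuot.liftAlgHom_mkAlgHom_apply ..).trans (by simp [genMap])

variable {hq} in
theorem algHom_ext {f g : TaftAlgebra hq →ₐ[k] A} (h1 : f (h hq) = g (h hq))
    (h2 : f (x hq) = g (x hq)) : f = g := by
  refine RingQuot.ringQuot_ext' (S := k) f g (FreeAlgebra.hom_ext ?_)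
  funext i
  cases i
  · exact h1
  · exact h2

theorem adjoin_eq_top : Algebra.adjoin k {h hq, x hq} = ⊤ := by
  have h0 := congrArg (Subalgebra.map (mk hq)) (FreeAlgebra.adjoin_range_ι k TaftGen)
  rw [AlgHom.map_adjoin, Algebra.map_top,
    (AlgHom.range_eq_top (mk hq)).2 (RingQuot.mkAlgHom_surjective k (TaftRel m q))] at h0
  rw [eq_top_iff, ← h0]
  refine Algebra.adjoin_mono ?_
  rintro _ ⟨_, ⟨i, rfl⟩, rfl⟩
  cases i
  · exact Or.inl rfl
  · exact Or.inr rfl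

/-- `h` is group-like and `x` is `(h, 1)`-primitive. -/
def comulHom : TaftAlgebra hq →ₐ[k] TaftAlgebra hq ⊗[k] TaftAlgebra hq :=
  lift hq (h hq ⊗ₜ h hq) (x hq ⊗ₜ h hq + 1 ⊗ₜ x hq) (groupLike_pow_tmul (h_pow hq))
    (skew_pow hq (x_mul_h hq) (x_pow hq)) (skew_mul_groupLike (x_mul_h hq) rfl)

/-- The counit: `ε(h) = 1` and `ε(x) = 0`. -/
def counitHom : TaftAlgebra hq →ₐ[k] k :=
  lift hq 1 0 (one_pow m) (zero_pow (pos_of_mem_primitiveRoots hq).ne') (by simp)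

/-- The antipode, as an anti-homomorphism: `S(h) = h⁻¹` and `S(x) = - x h⁻¹`. -/
def antipodeHom : TaftAlgebra hq →ₐ[k] (TaftAlgebra hq)ᵐᵒᵖ :=
  have hi := groupLike_inv (pos_of_mem_primitiveRoots hq) (h_pow hq)
  lift hq (.op (h hq ^ (m - 1))) (.op (-(x hq * h hq ^ (m - 1))))
    (by rw [← MulOpposite.op_pow, ← pow_mul, mul_comm, pow_mul, h_pow, one_pow,
      MulOpposite.op_one])
    (by rw [← MulOpposite.op_pow, neg_pow, mul_pow_eq_zero_of_qcomm
      (inv_mul_skew hi.1 hi.2 (x_mul_h hq)) (x_pow hq), mul_zero, MulOpposite.op_zero])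
    (by rw [← MulOpposite.op_mul, ← MulOpposite.op_mul, ← MulOpposite.op_smul, mul_neg, neg_mul,
      ← mul_assoc, inv_mul_skew hi.1 hi.2 (x_mul_h hq), smul_neg, smul_mul_assoc])

theorem antipodeHom_h : antipodeHom hq (h hq) = .op (h hq ^ (m - 1)) := by simp [antipodeHom]

theorem antipodeHom_x : antipodeHom hq (x hq) = .op (-(x hq * h hq ^ (m - 1))) := by
  simp [antipodeHom]

instance : Bialgebra k (TaftAlgebra hq) :=
  Bialgebra.ofAlgHom (comulHom hq) (counitHom hq)
    (algHom_ext (by simp [comulHom])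
      (by simp [comulHom, TensorProduct.add_tmul, TensorProduct.tmul_add,
        Algebra.TensorProduct.one_def, add_assoc]))
    (algHom_ext (by simp [comulHom, counitHom]) (by simp [comulHom, counitHom]))
    (algHom_ext (by simp [comulHom, counitHom]) (by simp [comulHom, counitHom]))

@[simp]
theorem comul_h : Coalgebra.comul (R := k) (h hq) = h hq ⊗ₜ h hq := lift_h ..

@[simp]
theorem comul_x : Coalgebra.comul (R := k) (x hq) = x hq ⊗ₜ h hq + 1 ⊗ₜ x hq := lift_x ..

@[simp]
theorem counit_h : Coalgebra.counit (R := k) (h hq) = 1 := lift_h ..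

@[simp]
theorem counit_x : Coalgebra.counit (R := k) (x hq) = 0 := lift_x ..

instance : HopfAlgebra k (TaftAlgebra hq) :=
  have hi := groupLike_inv (pos_of_mem_primitiveRoots hq) (h_pow hq)
  hopfAlgebraOfGenerators (antipodeHom hq) {h hq, x hq} (adjoin_eq_top hq)
    (by
      rintro b (rfl | rfl)
      · simp [antipodeHom, hi.2]
      · simp [antipodeHom, mul_assoc, hi.2])
    (by
      rintro b (rfl | rfl)
      · simp [antipodeHom, hi.1]
      · simp [antipodeHom])

theorem antipode_h : HopfAlgebra.antipode k (h hq) = h hq ^ (m - 1) :=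
  congrArg MulOpposite.unop (antipodeHom_h hq)

theorem antipode_x : HopfAlgebra.antipode k (x hq) = -(x hq * h hq ^ (m - 1)) :=
  congrArg MulOpposite.unop (antipodeHom_x hq)

end TaftAlgebra

end Taft

section Pair

variable {k : Type u} [Field k] {m n : ℕ} {q qb : k}

/-- Names of the generators `h`, `x`, `H`, `X` of the Hopf algebras which factor through two Taft
algebras. -/
inductive PairGen : Type
  | h | x | H | X

open FreeAlgebra in
/-- The relations
`h ^ m = H ^ n = 1`, `x ^ m = X ^ n = 0`, `x h = q h x`, `X H = qb H X`, `h H = H h`,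
`x H = σ H x`, `h X = σ X h`, `x X = σ X x + α (1 - H h)`. -/
inductive PairRel (m n : ℕ) (qb q σ α : k) : FreeAlgebra k PairGen → FreeAlgebra k PairGen → Prop
  | h_pow : PairRel m n qb q σ α (ι k .h ^ m) 1
  | x_pow : PairRel m n qb q σ α (ι k .x ^ m) 0
  | H_pow : PairRel m n qb q σ α (ι k .H ^ n) 1
  | X_pow : PairRel m n qb q σ α (ι k .X ^ n) 0
  | x_h : PairRel m n qb q σ α (ι k .x * ι k .h) (q • (ι k .h * ι k .x))
  | X_H : PairRel m n qb q σ α (ι k .X * ι k .H) (qb • (ι k .H * ι k .X))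
  | h_H : PairRel m n qb q σ α (ι k .h * ι k .H) (ι k .H * ι k .h)
  | x_H : PairRel m n qb q σ α (ι k .x * ι k .H) (σ • (ι k .H * ι k .x))
  | h_X : PairRel m n qb q σ α (ι k .h * ι k .X) (σ • (ι k .X * ι k .h))
  | x_X : PairRel m n qb q σ α (ι k .x * ι k .X)
      (σ • (ι k .X * ι k .x) + α • (1 - ι k .H * ι k .h))

/-- The algebra generated by `h`, `x`, `H`, `X` subject to the relations `PairRel`. -/
def PairAlgebra (_hqb : qb ∈ primitiveRoots n k) (_hq : q ∈ primitiveRoots m k) (σ α : k) :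
    Type u :=
  RingQuot (PairRel m n qb q σ α)

namespace PairAlgebra

variable (hqb : qb ∈ primitiveRoots n k) (hq : q ∈ primitiveRoots m k) (σ α : k)

instance : Ring (PairAlgebra hqb hq σ α) := inferInstanceAs (Ring (RingQuot _))

instance : Algebra k (PairAlgebra hqb hq σ α) := inferInstanceAs (Algebra k (RingQuot _))

/-- The canonical projection from the free algebra. -/
def mk : FreeAlgebra k PairGen →ₐ[k] PairAlgebra hqb hq σ α :=
  RingQuot.mkAlgHom k (PairRel m n qb q σ α)

/-- The generators. -/
def gen (i : PairGen) : PairAlgebra hqb hq σ α := mk hqb hq σ α (FreeAlgebra.ι k i)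

theorem mk_rel {a b : FreeAlgebra k PairGen} (hab : PairRel m n qb q σ α a b) :
    mk hqb hq σ α a = mk hqb hq σ α b :=
  RingQuot.mkAlgHom_rel k hab

/-- The defining relations, for elements `h x H X` of an arbitrary algebra. -/
structure IsPair {A : Type*} [Ring A] [Algebra k A] (m n : ℕ) (qb q σ α : k) (h x H X : A) :
    Prop where
  h_pow : h ^ m = 1
  x_pow : x ^ m = 0
  H_pow : H ^ n = 1
  X_pow : X ^ n = 0
  x_h : x * h = q • (h * x)
  X_H : X * H = qb • (H * X)
  h_H : h * H = H * h
  x_H : x * H = σ • (H * x)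
  h_X : h * X = σ • (X * h)
  x_X : x * X = σ • (X * x) + α • (1 - H * h)

theorem isPair : IsPair m n qb q σ α (gen hqb hq σ α .h) (gen hqb hq σ α .x) (gen hqb hq σ α .H)
    (gen hqb hq σ α .X) where
  h_pow := by simpa [gen] using mk_rel hqb hq σ α .h_pow
  x_pow := by simpa [gen] using mk_rel hqb hq σ α .x_pow
  H_pow := by simpa [gen] using mk_rel hqb hq σ α .H_pow
  X_pow := by simpa [gen] using mk_rel hqb hq σ α .X_pow
  x_h := by simpa [gen] using mk_rel hqb hq σ α .x_h
  X_H := by simpa [gen] using mk_rel hqb hq σ α .X_H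
  h_H := by simpa [gen] using mk_rel hqb hq σ α .h_H
  x_H := by simpa [gen] using mk_rel hqb hq σ α .x_H
  h_X := by simpa [gen] using mk_rel hqb hq σ α .h_X
  x_X := by simpa [gen] using mk_rel hqb hq σ α .x_X

variable {A : Type*} [Ring A] [Algebra k A] {σ α}

/-- The images of the generators prescribed by `a b c d`. -/
def genMap (a b c d : A) : PairGen → A
  | .h => a
  | .x => b
  | .H => c
  | .X => d

/-- The universal property of the presentation. -/
def lift {a b c d : A} (hr : IsPair m n qb q σ α a b c d) : PairAlgebra hqb hq σ α →ₐ[k] A :=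
  RingQuot.liftAlgHom k ⟨FreeAlgebra.lift k (genMap a b c d), by
    intro y z hyz
    cases hyz
    case h_pow => simpa [genMap] using hr.h_pow
    case x_pow => simpa [genMap] using hr.x_pow
    case H_pow => simpa [genMap] using hr.H_pow
    case X_pow => simpa [genMap] using hr.X_pow
    case x_h => simpa [genMap] using hr.x_h
    case X_H => simpa [genMap] using hr.X_H
    case h_H => simpa [genMap] using hr.h_H
    case x_H => simpa [genMap] using hr.x_H
    case h_X => simpa [genMap] using hr.h_X
    case x_X => simpa [genMap] using hr.x_X⟩

@[simp]
theorem lift_gen {a b c d : A} (hr : IsPair m n qb q σ α a b c d) (i : PairGen) :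
    lift hqb hq hr (gen hqb hq σ α i) = genMap a b c d i :=
  (RingQuot.liftAlgHom_mkAlgHom_apply ..).trans (by simp)

variable {hqb hq} in
theorem algHom_ext {f g : PairAlgebra hqb hq σ α →ₐ[k] A}
    (hfg : ∀ i, f (gen hqb hq σ α i) = g (gen hqb hq σ α i)) : f = g :=
  RingQuot.ringQuot_ext' (S := k) f g (FreeAlgebra.hom_ext (funext hfg))

variable (σ α)

theorem adjoin_eq_top : Algebra.adjoin k (Set.range (gen hqb hq σ α)) = ⊤ := by
  have h0 := congrArg (Subalgebra.map (mk hqb hq σ α)) (FreeAlgebra.adjoin_range_ι k PairGen)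
  rw [AlgHom.map_adjoin, Algebra.map_top, (AlgHom.range_eq_top (mk hqb hq σ α)).2
    (RingQuot.mkAlgHom_surjective k (PairRel m n qb q σ α)), ← Set.range_comp] at h0
  exact h0

theorem isPair_comul : IsPair m n qb q σ α
    (gen hqb hq σ α .h ⊗ₜ[k] gen hqb hq σ α .h)
    (gen hqb hq σ α .x ⊗ₜ[k] gen hqb hq σ α .h + 1 ⊗ₜ gen hqb hq σ α .x)
    (gen hqb hq σ α .H ⊗ₜ[k] gen hqb hq σ α .H)
    (gen hqb hq σ α .X ⊗ₜ[k] gen hqb hq σ α .H + 1 ⊗ₜ gen hqb hq σ α .X) :=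
  have r := isPair hqb hq σ α
  { h_pow := groupLike_pow_tmul r.h_pow
    x_pow := skew_pow hq r.x_h r.x_pow
    H_pow := groupLike_pow_tmul r.H_pow
    X_pow := skew_pow hqb r.X_H r.X_pow
    x_h := skew_mul_groupLike r.x_h rfl
    X_H := skew_mul_groupLike r.X_H rfl
    h_H := by rw [Algebra.TensorProduct.tmul_mul_tmul, Algebra.TensorProduct.tmul_mul_tmul, r.h_H]
    x_H := skew_mul_groupLike r.x_H r.h_H
    h_X := groupLike_mul_skew r.h_X r.h_H.symm
    x_X := skew_mul_skew r.x_H r.h_X r.h_H r.x_X }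

/-- `h`, `H` are group-like, `x` is `(h, 1)`-primitive and `X` is `(H, 1)`-primitive. -/
def comulHom : PairAlgebra hqb hq σ α →ₐ[k] PairAlgebra hqb hq σ α ⊗[k] PairAlgebra hqb hq σ α :=
  lift hqb hq (isPair_comul hqb hq σ α)

theorem isPair_counit (hm : m ≠ 0) (hn : n ≠ 0) : IsPair m n qb q σ α (1 : k) 0 1 0 where
  h_pow := one_pow m
  x_pow := zero_pow hm
  H_pow := one_pow n
  X_pow := zero_pow hn
  x_h := by simp
  X_H := by simp
  h_H := by simp
  x_H := by simp
  h_X := by simp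
  x_X := by simp

/-- The counit: `ε(h) = ε(H) = 1` and `ε(x) = ε(X) = 0`. -/
def counitHom : PairAlgebra hqb hq σ α →ₐ[k] k :=
  lift hqb hq (isPair_counit σ α (pos_of_mem_primitiveRoots hq).ne'
    (pos_of_mem_primitiveRoots hqb).ne')

theorem isPair_antipode : IsPair m n qb q σ α
    (MulOpposite.op (gen hqb hq σ α .h ^ (m - 1)))
    (MulOpposite.op (-(gen hqb hq σ α .x * gen hqb hq σ α .h ^ (m - 1))))
    (MulOpposite.op (gen hqb hq σ α .H ^ (n - 1)))
    (MulOpposite.op (-(gen hqb hq σ α .X * gen hqb hq σ α .H ^ (n - 1)))) := by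
  have r := isPair hqb hq σ α
  have hm := pos_of_mem_primitiveRoots hq
  have hn := pos_of_mem_primitiveRoots hqb
  have hi := groupLike_inv hm r.h_pow
  have Hi := groupLike_inv hn r.H_pow
  have hp : (gen hqb hq σ α .h ^ (m - 1)) ^ m = 1 := by
    rw [← pow_mul, mul_comm, pow_mul, r.h_pow, one_pow]
  have Hp : (gen hqb hq σ α .H ^ (n - 1)) ^ n = 1 := by
    rw [← pow_mul, mul_comm, pow_mul, r.H_pow, one_pow]
  have c : Commute (gen hqb hq σ α .h) (gen hqb hq σ α .H) := r.h_H
  have c1 := c.pow_left (m - 1)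
  have c2 := (c.pow_right (n - 1)).eq
  have c3 := (c1.pow_right (n - 1)).eq
  generalize gen hqb hq σ α .h ^ (m - 1) = h' at *
  generalize gen hqb hq σ α .H ^ (n - 1) = H' at *
  replace c1 := c1.eq
  generalize gen hqb hq σ α .h = h at *
  generalize gen hqb hq σ α .H = H at *
  generalize gen hqb hq σ α .x = x at *
  generalize gen hqb hq σ α .X = X at *
  have e1 : h' * x = q • (x * h') := inv_mul_skew hi.1 hi.2 r.x_h
  have e2 : H' * X = qb • (X * H') := inv_mul_skew Hi.1 Hi.2 r.X_H
  have e3 : H' * x = σ • (x * H') := inv_mul_skew Hi.1 Hi.2 r.x_H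
  have e4 : X * h' = σ • (h' * X) := skew_mul_inv hi.1 hi.2 r.h_X
  constructor
  · rw [← MulOpposite.op_pow, hp, MulOpposite.op_one]
  · rw [← MulOpposite.op_pow, neg_pow, mul_pow_eq_zero_of_qcomm e1 r.x_pow, mul_zero,
      MulOpposite.op_zero]
  · rw [← MulOpposite.op_pow, Hp, MulOpposite.op_one]
  · rw [← MulOpposite.op_pow, neg_pow, mul_pow_eq_zero_of_qcomm e2 r.X_pow, mul_zero,
      MulOpposite.op_zero]
  · rw [← MulOpposite.op_mul, ← MulOpposite.op_mul, ← MulOpposite.op_smul, mul_neg, neg_mul,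
      ← mul_assoc, e1, smul_neg, smul_mul_assoc]
  · rw [← MulOpposite.op_mul, ← MulOpposite.op_mul, ← MulOpposite.op_smul, mul_neg, neg_mul,
      ← mul_assoc, e2, smul_neg, smul_mul_assoc]
  · rw [← MulOpposite.op_mul, ← MulOpposite.op_mul, c3]
  · rw [← MulOpposite.op_mul, ← MulOpposite.op_mul, ← MulOpposite.op_smul, mul_neg, neg_mul,
      ← mul_assoc, e3, smul_neg, smul_mul_assoc, mul_assoc, mul_assoc, c3]
  · rw [← MulOpposite.op_mul, ← MulOpposite.op_mul, ← MulOpposite.op_smul, mul_neg, neg_mul,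
      mul_assoc, ← c3, ← mul_assoc, e4, smul_mul_assoc, smul_neg, mul_assoc]
  · rw [← MulOpposite.op_mul, ← MulOpposite.op_mul, ← MulOpposite.op_mul, ← MulOpposite.op_one,
      ← MulOpposite.op_sub, ← MulOpposite.op_smul, ← MulOpposite.op_smul, ← MulOpposite.op_add]
    congr 1
    rw [neg_mul_neg, neg_mul_neg]
    have f1 : X * H' * (x * h') = σ • (X * x * (h' * H')) := by
      rw [mul_assoc, ← mul_assoc H', e3, smul_mul_assoc, mul_smul_comm, c3]
      simp only [mul_assoc]
    have f2 : σ • (x * h' * (X * H')) = x * X * (h' * H') := by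
      calc σ • (x * h' * (X * H')) = x * (σ • (h' * X)) * H' := by
            simp only [mul_assoc, mul_smul_comm, smul_mul_assoc]
        _ = _ := by rw [← e4]; simp only [mul_assoc]
    have f3 : (1 - H * h) * (h' * H') = h' * H' - 1 := by
      rw [sub_mul, one_mul, mul_assoc, ← mul_assoc h, hi.1, one_mul, Hi.1]
    rw [f1, f2, r.x_X, add_mul, smul_mul_assoc, smul_mul_assoc, f3, add_assoc, ← smul_add]
    simp

/-- The antipode, as an anti-homomorphism: `S(h) = h⁻¹`, `S(x) = - x h⁻¹`, `S(H) = H⁻¹`,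
`S(X) = - X H⁻¹`. -/
def antipodeHom : PairAlgebra hqb hq σ α →ₐ[k] (PairAlgebra hqb hq σ α)ᵐᵒᵖ :=
  lift hqb hq (isPair_antipode hqb hq σ α)

instance : Bialgebra k (PairAlgebra hqb hq σ α) :=
  Bialgebra.ofAlgHom (comulHom hqb hq σ α) (counitHom hqb hq σ α)
    (algHom_ext (by
      rintro (_ | _ | _ | _) <;> simp [comulHom, genMap, TensorProduct.add_tmul,
        TensorProduct.tmul_add, Algebra.TensorProduct.one_def, add_assoc]))
    (algHom_ext (by rintro (_ | _ | _ | _) <;> simp [comulHom, counitHom, genMap]))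
    (algHom_ext (by rintro (_ | _ | _ | _) <;> simp [comulHom, counitHom, genMap]))

@[simp]
theorem comul_h : Coalgebra.comul (R := k) (gen hqb hq σ α .h) =
    gen hqb hq σ α .h ⊗ₜ gen hqb hq σ α .h :=
  lift_gen hqb hq (isPair_comul hqb hq σ α) .h

@[simp]
theorem comul_x : Coalgebra.comul (R := k) (gen hqb hq σ α .x) =
    gen hqb hq σ α .x ⊗ₜ gen hqb hq σ α .h + 1 ⊗ₜ gen hqb hq σ α .x :=
  lift_gen hqb hq (isPair_comul hqb hq σ α) .x

@[simp]
theorem comul_H : Coalgebra.comul (R := k) (gen hqb hq σ α .H) =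
    gen hqb hq σ α .H ⊗ₜ gen hqb hq σ α .H :=
  lift_gen hqb hq (isPair_comul hqb hq σ α) .H

@[simp]
theorem comul_X : Coalgebra.comul (R := k) (gen hqb hq σ α .X) =
    gen hqb hq σ α .X ⊗ₜ gen hqb hq σ α .H + 1 ⊗ₜ gen hqb hq σ α .X :=
  lift_gen hqb hq (isPair_comul hqb hq σ α) .X

@[simp]
theorem counit_h : Coalgebra.counit (R := k) (gen hqb hq σ α .h) = 1 :=
  lift_gen hqb hq (isPair_counit σ α (pos_of_mem_primitiveRoots hq).ne'
    (pos_of_mem_primitiveRoots hqb).ne') .h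

@[simp]
theorem counit_x : Coalgebra.counit (R := k) (gen hqb hq σ α .x) = 0 :=
  lift_gen hqb hq (isPair_counit σ α (pos_of_mem_primitiveRoots hq).ne'
    (pos_of_mem_primitiveRoots hqb).ne') .x

@[simp]
theorem counit_H : Coalgebra.counit (R := k) (gen hqb hq σ α .H) = 1 :=
  lift_gen hqb hq (isPair_counit σ α (pos_of_mem_primitiveRoots hq).ne'
    (pos_of_mem_primitiveRoots hqb).ne') .H

@[simp]
theorem counit_X : Coalgebra.counit (R := k) (gen hqb hq σ α .X) = 0 :=
  lift_gen hqb hq (isPair_counit σ α (pos_of_mem_primitiveRoots hq).ne'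
    (pos_of_mem_primitiveRoots hqb).ne') .X

instance : HopfAlgebra k (PairAlgebra hqb hq σ α) :=
  have r := isPair hqb hq σ α
  have hi := groupLike_inv (pos_of_mem_primitiveRoots hq) r.h_pow
  have Hi := groupLike_inv (pos_of_mem_primitiveRoots hqb) r.H_pow
  hopfAlgebraOfGenerators (antipodeHom hqb hq σ α) _ (adjoin_eq_top hqb hq σ α)
    (by
      rintro _ ⟨_ | _ | _ | _, rfl⟩
      · simp [antipodeHom, genMap, hi.2]
      · simp [antipodeHom, genMap, mul_assoc, hi.2]
      · simp [antipodeHom, genMap, Hi.2]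
      · simp [antipodeHom, genMap, mul_assoc, Hi.2])
    (by
      rintro _ ⟨_ | _ | _ | _, rfl⟩
      · simp [antipodeHom, genMap, hi.1]
      · simp [antipodeHom, genMap]
      · simp [antipodeHom, genMap, Hi.1]
      · simp [antipodeHom, genMap])

end PairAlgebra

/-- The Hopf algebra `T_{n,m}^σ(qb, q)`, generated by `h`, `x`, `H`, `X` subject to
`h ^ m = H ^ n = 1`, `x ^ m = X ^ n = 0`, `x h = q h x`, `X H = qb H X`, `x H = σ H x`,
`h X = σ X h`, `x X = σ X x`, `h H = H h`, where `h`, `H` are group-like, `x` is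
`(h, 1)`-primitive and `X` is `(H, 1)`-primitive. -/
abbrev TBicrossed (hqb : qb ∈ primitiveRoots n k) (hq : q ∈ primitiveRoots m k) (σ : k) : Type u :=
  PairAlgebra hqb hq σ 0

/-- The Hopf algebra `Q_n^α(q)`, generated by `h`, `x`, `H`, `X` subject to
`h ^ n = H ^ n = 1`, `x ^ n = X ^ n = 0`, `x h = q h x`, `X H = q ^ (n - 1) H X`, `x H = q H x`,
`h X = q X h`, `x X - q X x = α (1 - H h)`, `h H = H h`, where `h`, `H` are group-like, `x` is
`(h, 1)`-primitive and `X` is `(H, 1)`-primitive. -/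
abbrev QBicrossed (hq : q ∈ primitiveRoots n k) (α : k) : Type u :=
  PairAlgebra (pow_pred_mem_primitiveRoots hq) hq q α

end Pair

/-- The antipode is bijective. Every finite dimensional Hopf algebra over a field has this
property. -/
class HasBijectiveAntipode (k : Type*) (A : Type*) [CommRing k] [Ring A] [HopfAlgebra k A] :
    Prop where
  bijective : Function.Bijective (HopfAlgebra.antipode k (A := A))

namespace TaftAlgebra

variable {k : Type u} [Field k] {m : ℕ} {q : k} (hq : q ∈ primitiveRoots m k)

theorem span_eq_top :
    Submodule.span k (Set.range fun p : ℕ × ℕ => h hq ^ p.1 * x hq ^ p.2) = ⊤ := by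
  set W := Submodule.span k (Set.range fun p : ℕ × ℕ => h hq ^ p.1 * x hq ^ p.2) with hW
  have hh : ∀ w ∈ W, h hq * w ∈ W := by
    intro w hw
    induction hw using Submodule.span_induction with
    | mem w hw =>
      obtain ⟨p, rfl⟩ := hw
      exact Submodule.subset_span ⟨(p.1 + 1, p.2), by simp only [pow_succ', mul_assoc]⟩
    | zero => simp
    | add a b _ _ ha hb => rw [mul_add]; exact W.add_mem ha hb
    | smul c a _ ha => rw [mul_smul_comm]; exact W.smul_mem c ha
  have hx : ∀ w ∈ W, x hq * w ∈ W := by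
    intro w hw
    induction hw using Submodule.span_induction with
    | mem w hw =>
      obtain ⟨p, rfl⟩ := hw
      have e : x hq * (h hq ^ p.1 * x hq ^ p.2) = q ^ p.1 • (h hq ^ p.1 * x hq ^ (p.2 + 1)) := by
        rw [← mul_assoc, mul_pow_of_qcomm (x_mul_h hq), smul_mul_assoc, mul_assoc, ← pow_succ']
      change x hq * (h hq ^ p.1 * x hq ^ p.2) ∈ W
      rw [e]
      exact W.smul_mem _ (Submodule.subset_span ⟨(p.1, p.2 + 1), rfl⟩)
    | zero => simp
    | add a b _ _ ha hb => rw [mul_add]; exact W.add_mem ha hb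
    | smul c a _ ha => rw [mul_smul_comm]; exact W.smul_mem c ha
  have h1 : (1 : TaftAlgebra hq) ∈ W := Submodule.subset_span ⟨(0, 0), by simp⟩
  rw [eq_top_iff]
  intro a _
  have ha : a ∈ Algebra.adjoin k {h hq, x hq} := adjoin_eq_top hq ▸ Algebra.mem_top
  have key : ∀ w ∈ W, a * w ∈ W := by
    induction ha using Algebra.adjoin_induction with
    | mem y hy =>
      rcases hy with rfl | rfl
      · exact hh
      · exact hx
    | algebraMap r =>
      intro w hw
      rw [← Algebra.smul_def]
      exact W.smul_mem r hw
    | add y z _ _ hy hz =>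
      intro w hw
      rw [add_mul]
      exact W.add_mem (hy trivial w hw) (hz trivial w hw)
    | mul y z _ _ hy hz =>
      intro w hw
      rw [mul_assoc]
      exact hy trivial _ (hz trivial w hw)
  simpa using key 1 h1

instance : Module.Finite k (TaftAlgebra hq) := by
  classical
  refine ⟨⟨(Finset.range m ×ˢ Finset.range m).image
    (fun p : ℕ × ℕ => h hq ^ p.1 * x hq ^ p.2), ?_⟩⟩
  rw [eq_top_iff, ← span_eq_top hq, Submodule.span_le]
  rintro _ ⟨p, rfl⟩
  change h hq ^ p.1 * x hq ^ p.2 ∈ _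
  have hm := pos_of_mem_primitiveRoots hq
  by_cases hp : p.2 < m
  · have e : h hq ^ p.1 = h hq ^ (p.1 % m) := by
      conv_lhs => rw [← Nat.mod_add_div p.1 m, pow_add, pow_mul, h_pow, one_pow, mul_one]
    rw [e]
    refine Submodule.subset_span ?_
    simp only [Finset.coe_image, Set.mem_image, Finset.mem_coe, Finset.mem_product,
      Finset.mem_range]
    exact ⟨(p.1 % m, p.2), ⟨Nat.mod_lt _ hm, hp⟩, rfl⟩
  · rw [← Nat.sub_add_cancel (not_lt.1 hp), pow_add (x hq), x_pow, mul_zero, mul_zero]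
    exact Submodule.zero_mem _

/-- The inverse of the antipode, as an anti-homomorphism. -/
def antipodeInvHom : TaftAlgebra hq →ₐ[k] (TaftAlgebra hq)ᵐᵒᵖ :=
  have hi := groupLike_inv (pos_of_mem_primitiveRoots hq) (h_pow hq)
  have e := inv_mul_skew hi.1 hi.2 (x_mul_h hq)
  lift hq (.op (h hq ^ (m - 1))) (.op (-(h hq ^ (m - 1) * x hq)))
    (by rw [← MulOpposite.op_pow, ← pow_mul, mul_comm, pow_mul, h_pow, one_pow,
      MulOpposite.op_one])
    (by rw [← MulOpposite.op_pow, e, ← smul_neg, smul_pow, neg_pow,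
      mul_pow_eq_zero_of_qcomm e (x_pow hq), mul_zero, smul_zero, MulOpposite.op_zero])
    (by rw [← MulOpposite.op_mul, ← MulOpposite.op_mul, ← MulOpposite.op_smul, mul_neg, neg_mul,
      mul_assoc, smul_neg, ← mul_smul_comm, ← e])

theorem antipodeInvHom_h : antipodeInvHom hq (h hq) = .op (h hq ^ (m - 1)) := by
  simp [antipodeInvHom]

theorem antipodeInvHom_x : antipodeInvHom hq (x hq) = .op (-(h hq ^ (m - 1) * x hq)) := by
  simp [antipodeInvHom]

theorem antipode_antipodeInv (a : TaftAlgebra hq) :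
    HopfAlgebra.antipode k (antipodeInvHom hq a).unop = a := by
  have hi := groupLike_inv (pos_of_mem_primitiveRoots hq) (h_pow hq)
  have hh : HopfAlgebra.antipode k (h hq ^ (m - 1)) = h hq := by
    have e : HopfAlgebra.antipode k (h hq ^ (m - 1)) * h hq ^ (m - 1) = 1 := by
      rw [← antipode_h, ← HopfAlgebra.antipode_mul_antidistrib, antipode_h, hi.1,
        HopfAlgebra.antipode_one]
    calc HopfAlgebra.antipode k (h hq ^ (m - 1))
        = HopfAlgebra.antipode k (h hq ^ (m - 1)) * h hq ^ (m - 1) * h hq := by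
          rw [mul_assoc, hi.2, mul_one]
      _ = h hq := by rw [e, one_mul]
  have ha : a ∈ Algebra.adjoin k {h hq, x hq} := adjoin_eq_top hq ▸ Algebra.mem_top
  induction ha using Algebra.adjoin_induction with
  | mem y hy =>
    rcases hy with rfl | rfl
    · rw [antipodeInvHom_h, MulOpposite.unop_op, hh]
    · rw [antipodeInvHom_x, MulOpposite.unop_op, map_neg, HopfAlgebra.antipode_mul_antidistrib, hh,
        antipode_x, neg_mul, neg_neg, mul_assoc, hi.2, mul_one]
  | algebraMap r =>
    rw [AlgHom.commutes, MulOpposite.algebraMap_apply, MulOpposite.unop_op,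
      Algebra.algebraMap_eq_smul_one, map_smul, HopfAlgebra.antipode_one]
  | add y z _ _ hy hz => rw [map_add, MulOpposite.unop_add, map_add, hy, hz]
  | mul y z _ _ hy hz =>
    rw [map_mul, MulOpposite.unop_mul, HopfAlgebra.antipode_mul_antidistrib, hy, hz]

instance : HasBijectiveAntipode k (TaftAlgebra hq) where
  bijective := by
    have hs : Function.Surjective (HopfAlgebra.antipode k (A := TaftAlgebra hq)) :=
      fun a => ⟨_, antipode_antipodeInv hq a⟩
    exact ⟨LinearMap.injective_iff_surjective.2 hs, hs⟩

end TaftAlgebra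

section DualCop

open Coalgebra

variable (k : Type*) (A : Type*) [Field k] [Ring A]

/-- The dual `(A^*)^cop` of a finite dimensional bialgebra `A`: its product is the convolution
product `⟨f g, a⟩ = ⟨f, a₍₁₎⟩ ⟨g, a₍₂₎⟩`, its coproduct is opposite to the transpose of the product
of `A`. -/
def DualCop [Bialgebra k A] : Type _ := WithConv (A →ₗ[k] k)

namespace DualCop

variable [Bialgebra k A]

instance : Ring (DualCop k A) := inferInstanceAs (Ring (WithConv (A →ₗ[k] k)))

instance : Algebra k (DualCop k A) := inferInstanceAs (Algebra k (WithConv (A →ₗ[k] k)))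

/-- The elements of `(A^*)^cop` are the linear forms on `A`. -/
def toDual : DualCop k A ≃ₗ[k] Module.Dual k A := WithConv.linearEquiv k (A →ₗ[k] k)

variable {k A}

instance : CoeFun (DualCop k A) (fun _ => A → k) where
  coe f := toDual k A f

@[ext]
theorem ext {f g : DualCop k A} (h : ∀ a, f a = g a) : f = g :=
  (toDual k A).injective (LinearMap.ext h)

@[simp]
theorem symm_apply (φ : Module.Dual k A) (a : A) : ((toDual k A).symm φ) a = φ a := rfl

theorem mul_apply (f g : DualCop k A) {a : A} {ι : Type*} (r : Repr k a ι) :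
    (f * g) a = ∑ i ∈ r.index, f (r.left i) * g (r.right i) :=
  Coalgebra.Repr.convMul_apply r f g

@[simp]
theorem one_apply (a : A) : (1 : DualCop k A) a = counit (R := k) a := rfl

variable [Module.Finite k A]

variable (k A) in
/-- The pairing of `A^* ⊗ A^*` with `A ⊗ A`, `⟨f ⊗ g, a ⊗ b⟩ = ⟨f, a⟩ ⟨g, b⟩`, is perfect. -/
def pairing : DualCop k A ⊗[k] DualCop k A ≃ₗ[k] Module.Dual k (A ⊗[k] A) :=
  (TensorProduct.congr (toDual k A) (toDual k A)).trans (TensorProduct.dualDistribEquiv k A A)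

@[simp]
theorem pairing_tmul (f g : DualCop k A) (a b : A) :
    pairing k A (f ⊗ₜ g) (a ⊗ₜ b) = f a * g b := rfl

variable (k A) in
/-- The coproduct of `(A^*)^cop`, characterized by `⟨Δ f, a ⊗ b⟩ = ⟨f, b a⟩`. -/
def comulMap : DualCop k A →ₗ[k] DualCop k A ⊗[k] DualCop k A :=
  (pairing k A).symm.toLinearMap ∘ₗ
    (LinearMap.mul' k A ∘ₗ (TensorProduct.comm k A A).toLinearMap).dualMap ∘ₗ
      (toDual k A).toLinearMap

@[simp]
theorem pairing_comulMap (f : DualCop k A) (a b : A) :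
    pairing k A (comulMap k A f) (a ⊗ₜ b) = f (b * a) := by
  simp [comulMap]

variable (k A) in
/-- The counit of `(A^*)^cop` is the evaluation at `1`. -/
def counitMap : DualCop k A →ₗ[k] k where
  toFun f := f 1
  map_add' f g := by simp
  map_smul' c f := by simp

theorem pairing_ext {s t : DualCop k A ⊗[k] DualCop k A}
    (h : ∀ a b, pairing k A s (a ⊗ₜ b) = pairing k A t (a ⊗ₜ b)) : s = t :=
  (pairing k A).injective (TensorProduct.ext' h)

variable (k A) in
/-- The pairing of triple tensor products. -/
def pairing₃ : DualCop k A ⊗[k] (DualCop k A ⊗[k] DualCop k A) ≃ₗ[k]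
    Module.Dual k (A ⊗[k] (A ⊗[k] A)) :=
  (TensorProduct.congr (toDual k A) (pairing k A)).trans
    (TensorProduct.dualDistribEquiv k A (A ⊗[k] A))

theorem pairing₃_tmul (f : DualCop k A) (t : DualCop k A ⊗[k] DualCop k A) (a : A)
    (b : A ⊗[k] A) : pairing₃ k A (f ⊗ₜ t) (a ⊗ₜ b) = f a * pairing k A t b := rfl

theorem pairing₃_lTensor (t : DualCop k A ⊗[k] DualCop k A) (a b c : A) :
    pairing₃ k A ((comulMap k A).lTensor _ t) (a ⊗ₜ (b ⊗ₜ c)) =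
      pairing k A t (a ⊗ₜ (c * b)) := by
  induction t with
  | zero => simp
  | tmul f g => simp [pairing₃_tmul]
  | add s t hs ht => simp only [map_add, LinearMap.add_apply, hs, ht]

theorem pairing₃_assoc (t : DualCop k A ⊗[k] DualCop k A) (f : DualCop k A) (a b c : A) :
    pairing₃ k A (TensorProduct.assoc k _ _ _ (t ⊗ₜ f)) (a ⊗ₜ (b ⊗ₜ c)) =
      pairing k A t (a ⊗ₜ b) * f c := by
  induction t with
  | zero => simp
  | tmul f g => simp [pairing₃_tmul, mul_assoc]
  | add s t hs ht => simp only [TensorProduct.add_tmul, map_add, LinearMap.add_apply, hs, ht,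
      add_mul]

theorem pairing₃_rTensor (t : DualCop k A ⊗[k] DualCop k A) (a b c : A) :
    pairing₃ k A (TensorProduct.assoc k _ _ _ ((comulMap k A).rTensor _ t)) (a ⊗ₜ (b ⊗ₜ c)) =
      pairing k A t ((b * a) ⊗ₜ c) := by
  induction t with
  | zero => simp
  | tmul f g => simp [pairing₃_assoc]
  | add s t hs ht => simp only [map_add, LinearMap.add_apply, hs, ht]

theorem rTensor_counitMap (t : DualCop k A ⊗[k] DualCop k A) :
    ∃ f : DualCop k A, (counitMap k A).rTensor _ t = 1 ⊗ₜ f ∧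
      ∀ a, f a = pairing k A t (1 ⊗ₜ a) := by
  induction t with
  | zero => exact ⟨0, by simp, by simp⟩
  | tmul f g =>
    refine ⟨f 1 • g, ?_, by simp⟩
    rw [LinearMap.rTensor_tmul, TensorProduct.tmul_smul, TensorProduct.smul_tmul', smul_eq_mul,
      mul_one]
    rfl
  | add s t hs ht =>
    obtain ⟨f, hf, hf'⟩ := hs
    obtain ⟨g, hg, hg'⟩ := ht
    exact ⟨f + g, by rw [map_add, hf, hg, TensorProduct.tmul_add], by simp [hf', hg']⟩

theorem lTensor_counitMap (t : DualCop k A ⊗[k] DualCop k A) :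
    ∃ f : DualCop k A, (counitMap k A).lTensor _ t = f ⊗ₜ 1 ∧
      ∀ a, f a = pairing k A t (a ⊗ₜ 1) := by
  induction t with
  | zero => exact ⟨0, by simp, by simp⟩
  | tmul f g =>
    refine ⟨g 1 • f, ?_, by simp [mul_comm]⟩
    rw [LinearMap.lTensor_tmul, TensorProduct.smul_tmul, smul_eq_mul, mul_one]
    rfl
  | add s t hs ht =>
    obtain ⟨f, hf, hf'⟩ := hs
    obtain ⟨g, hg, hg'⟩ := ht
    exact ⟨f + g, by rw [map_add, hf, hg, TensorProduct.add_tmul], by simp [hf', hg']⟩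

instance : Coalgebra k (DualCop k A) where
  comul := comulMap k A
  counit := counitMap k A
  coassoc := by
    refine LinearMap.ext fun f => (pairing₃ k A).injective ?_
    refine TensorProduct.ext_threefold' ?_
    intro a b c
    simp only [LinearMap.comp_apply, LinearEquiv.coe_coe, pairing₃_rTensor, pairing₃_lTensor,
      pairing_comulMap, mul_assoc]
  rTensor_counit_comp_comul := by
    refine LinearMap.ext fun f => ?_
    obtain ⟨g, hg, hg'⟩ := rTensor_counitMap (comulMap k A f)
    have : g = f := by ext a; simp [hg']
    rw [LinearMap.comp_apply, hg, this]
    rfl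
  lTensor_counit_comp_comul := by
    refine LinearMap.ext fun f => ?_
    obtain ⟨g, hg, hg'⟩ := lTensor_counitMap (comulMap k A f)
    have : g = f := by ext a; simp [hg']
    rw [LinearMap.comp_apply, hg, this]
    rfl

theorem pairing_comul (f : DualCop k A) (a b : A) :
    pairing k A (comul f) (a ⊗ₜ b) = f (b * a) := pairing_comulMap f a b

theorem counit_apply (f : DualCop k A) : counit (R := k) f = f 1 := rfl

theorem pairing_mul (s t : DualCop k A ⊗[k] DualCop k A) {a b : A} {ι κ : Type*}
    (r : Repr k a ι) (r' : Repr k b κ) :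
    pairing k A (s * t) (a ⊗ₜ b) = ∑ i ∈ r.index, ∑ j ∈ r'.index,
      pairing k A s (r.left i ⊗ₜ r'.left j) * pairing k A t (r.right i ⊗ₜ r'.right j) := by
  induction s with
  | zero => simp
  | add s s' hs hs' => simp only [add_mul, map_add, LinearMap.add_apply, hs, hs',
      Finset.sum_add_distrib]
  | tmul f g =>
    induction t with
    | zero => simp
    | add t t' ht ht' => simp only [mul_add, map_add, LinearMap.add_apply, ht, ht',
        Finset.sum_add_distrib]
    | tmul f' g' =>
      rw [Algebra.TensorProduct.tmul_mul_tmul, pairing_tmul, mul_apply f f' r, mul_apply g g' r',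
        Finset.sum_mul_sum]
      refine Finset.sum_congr rfl fun i _ => Finset.sum_congr rfl fun j _ => ?_
      rw [pairing_tmul, pairing_tmul]
      ring

instance : Bialgebra k (DualCop k A) :=
  Bialgebra.mk' k (DualCop k A)
    (by rw [counit_apply]; simp)
    (by
      intro f g
      rw [counit_apply, counit_apply, counit_apply, mul_apply f g
        (⟨{()}, fun _ => 1, fun _ => 1, by simp [Algebra.TensorProduct.one_def]⟩ :
          Repr k (1 : A) Unit)]
      simp)
    (by
      refine pairing_ext fun a b => ?_
      rw [pairing_comul, Algebra.TensorProduct.one_def]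
      simp [mul_comm])
    (by
      intro f g
      refine pairing_ext fun a b => ?_
      rw [pairing_comul, pairing_mul _ _ (ℛ k a) (ℛ k b), mul_apply f g ((ℛ k b).mul (ℛ k a))]
      simp only [pairing_comul, Repr.mul_index, Repr.mul_left, Repr.mul_right]
      rw [Finset.sum_product_right])

end DualCop

end DualCop

section Antipode

open Coalgebra LinearMap WithConv HopfAlgebra

variable (k : Type*) {A : Type*} [Field k] [Ring A] [HopfAlgebra k A]

theorem comul_antipode (a : A) : comul (R := k) (antipode k a) =
    TensorProduct.map (antipode k) (antipode k) (TensorProduct.comm k A A (comul a)) := by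
  let i₁ : A →ₐ[k] A ⊗[k] A := Algebra.TensorProduct.includeLeft
  let i₂ : A →ₐ[k] A ⊗[k] A := Algebra.TensorProduct.includeRight
  have hδ : (toConv comul : WithConv (A →ₗ[k] A ⊗[k] A)) =
      toConv i₁.toLinearMap * toConv i₂.toLinearMap := by
    apply WithConv.ext
    ext a
    change comul a = (_ * _ : WithConv (A →ₗ[k] A ⊗[k] A)) a
    rw [(ℛ k a).convMul_apply]
    simp [i₁, i₂, (ℛ k a).eq]
  have hG : (toConv (i₂.toLinearMap ∘ₗ antipode k) * toConv (i₁.toLinearMap ∘ₗ antipode k) :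
      WithConv (A →ₗ[k] A ⊗[k] A)) = toConv (TensorProduct.map (antipode k) (antipode k) ∘ₗ
        (TensorProduct.comm k A A).toLinearMap ∘ₗ comul) := by
    apply WithConv.ext
    ext a
    change (_ * _ : WithConv (A →ₗ[k] A ⊗[k] A)) a = _
    rw [(ℛ k a).convMul_apply]
    simp [i₁, i₂, ← (ℛ k a).eq]
  have h1 : ∀ i : A →ₐ[k] A ⊗[k] A, (toConv (i.toLinearMap ∘ₗ antipode k) *
      toConv i.toLinearMap : WithConv (A →ₗ[k] A ⊗[k] A)) = 1 := by
    intro i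
    have := LinearMap.algHom_comp_convMul_distrib i (toConv (antipode k (A := A)))
      (toConv LinearMap.id)
    rw [LinearMap.antipode_mul_id] at this
    apply WithConv.ext
    refine this.symm.trans ?_
    ext a
    simp [LinearMap.convOne_def]
  have h2 : (toConv (TensorProduct.map (antipode k) (antipode k) ∘ₗ
        (TensorProduct.comm k A A).toLinearMap ∘ₗ comul) * toConv comul :
        WithConv (A →ₗ[k] A ⊗[k] A)) = 1 := by
    rw [← hG, hδ, mul_assoc, ← mul_assoc (toConv (i₁.toLinearMap ∘ₗ antipode k)), h1, one_mul, h1]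
  have h3 := left_inv_eq_right_inv h2 LinearMap.comul_right_inv
  exact (congrArg (fun φ : WithConv (A →ₗ[k] A ⊗[k] A) => φ a) h3).symm

variable [HasBijectiveAntipode k A]

variable (A) in
/-- The inverse `S⁻¹` of the antipode. -/
def antipodeInv : A →ₗ[k] A :=
  (LinearEquiv.ofBijective (antipode k (A := A)) HasBijectiveAntipode.bijective).symm.toLinearMap

@[simp]
theorem antipode_antipodeInv (a : A) : antipode k (antipodeInv k A a) = a :=
  (LinearEquiv.ofBijective (antipode k (A := A)) HasBijectiveAntipode.bijective).apply_symm_apply a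

@[simp]
theorem antipodeInv_antipode (a : A) : antipodeInv k A (antipode k a) = a :=
  (LinearEquiv.ofBijective (antipode k (A := A)) HasBijectiveAntipode.bijective).symm_apply_apply a

theorem antipode_injective : Function.Injective (antipode k (A := A)) :=
  HasBijectiveAntipode.bijective.1

@[simp]
theorem antipodeInv_one : antipodeInv k A 1 = 1 :=
  antipode_injective k (by simp)

theorem antipodeInv_mul (a b : A) :
    antipodeInv k A (a * b) = antipodeInv k A b * antipodeInv k A a :=
  antipode_injective k (by simp [antipode_mul_antidistrib])

@[simp]
theorem counit_antipodeInv (a : A) : counit (R := k) (antipodeInv k A a) = counit (R := k) a := by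
  conv_rhs => rw [← antipode_antipodeInv k a, counit_antipode]

theorem comul_antipodeInv (a : A) : comul (R := k) (antipodeInv k A a) =
    TensorProduct.map (antipodeInv k A) (antipodeInv k A) (TensorProduct.comm k A A (comul a)) := by
  have h := comul_antipode k (antipodeInv k A a)
  rw [antipode_antipodeInv] at h
  rw [h, ← TensorProduct.map_comm, TensorProduct.map_map,
    show antipodeInv k A ∘ₗ antipode k = LinearMap.id from LinearMap.ext (antipodeInv_antipode k)]
  generalize comul (R := k) (antipodeInv k A a) = t
  induction t with
  | zero => simp
  | tmul x y => simp
  | add s t hs ht => rw [map_add, map_add, map_add, ← hs, ← ht]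

theorem sum_right_mul_antipodeInv_left {a : A} {ι : Type*} (r : Repr k a ι) :
    ∑ i ∈ r.index, r.right i * antipodeInv k A (r.left i) = algebraMap k A (counit a) := by
  refine antipode_injective k ?_
  simp only [map_sum, antipode_mul_antidistrib, antipode_antipodeInv]
  rw [sum_mul_antipode_eq_algebraMap_counit r, Algebra.algebraMap_eq_smul_one, map_smul,
    antipode_one]

theorem sum_antipodeInv_right_mul_left {a : A} {ι : Type*} (r : Repr k a ι) :
    ∑ i ∈ r.index, antipodeInv k A (r.right i) * r.left i = algebraMap k A (counit a) := by
  refine antipode_injective k ?_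
  simp only [map_sum, antipode_mul_antidistrib, antipode_antipodeInv]
  rw [sum_antipode_mul_eq_algebraMap_counit r, Algebra.algebraMap_eq_smul_one, map_smul,
    antipode_one]

/-- The coproduct of `S⁻¹(a)` in terms of the one of `a`. -/
def reprAntipodeInv {a : A} {ι : Type*} (r : Repr k a ι) : Repr k (antipodeInv k A a) ι where
  index := r.index
  left i := antipodeInv k A (r.right i)
  right i := antipodeInv k A (r.left i)
  eq := by rw [comul_antipodeInv, ← r.eq]; simp

end Antipode

section Double

open Coalgebra LinearMap WithConv HopfAlgebra

variable (k : Type*) (A : Type*) [Field k] [Ring A] [HopfAlgebra k A]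

/-- Right translation: `⟨x · f, y⟩ = ⟨f, y x⟩`. -/
def rightTranslation : A →ₐ[k] Module.End k (DualCop k A) :=
  AlgHom.ofLinearMap
    { toFun x := (DualCop.toDual k A).symm.toLinearMap ∘ₗ (LinearMap.mulRight k x).dualMap ∘ₗ
        (DualCop.toDual k A).toLinearMap
      map_add' x x' := by ext f y; simp [mul_add]
      map_smul' c x := by ext f y; simp }
    (by ext f y; simp) (fun x x' => by ext f y; simp [mul_assoc])

@[simp]
theorem rightTranslation_apply (x : A) (f : DualCop k A) (y : A) :
    (rightTranslation k A x f) y = f (y * x) := rfl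

/-- Left multiplication by an element of `(A^*)^cop` on `(A^*)^cop ⊗ A`. -/
def dualMul : DualCop k A →ₐ[k] Module.End k (DualCop k A ⊗[k] A) :=
  (Module.End.rTensorAlgHom k (DualCop k A) A).comp (Algebra.lmul k (DualCop k A))

theorem dualMul_tmul (f g : DualCop k A) (b : A) : dualMul k A f (g ⊗ₜ b) = (f * g) ⊗ₜ b := rfl

variable [HasBijectiveAntipode k A]

/-- Left translation by `S⁻¹`: `⟨z · f, y⟩ = ⟨f, S⁻¹(z) y⟩`. -/
def leftTranslation : A →ₐ[k] Module.End k (DualCop k A) :=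
  AlgHom.ofLinearMap
    { toFun z := (DualCop.toDual k A).symm.toLinearMap ∘ₗ
        (LinearMap.mulLeft k (antipodeInv k A z)).dualMap ∘ₗ (DualCop.toDual k A).toLinearMap
      map_add' x x' := by ext f y; simp [add_mul]
      map_smul' c x := by ext f y; simp }
    (by ext f y; simp) (fun x x' => by ext f y; simp [antipodeInv_mul])

@[simp]
theorem leftTranslation_apply (z : A) (f : DualCop k A) (y : A) :
    (leftTranslation k A z f) y = f (antipodeInv k A z * y) := rfl

/-- The action of `A ⊗ A ⊗ A` on `(A^*)^cop ⊗ A` given by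
`(x ⊗ y ⊗ z) · (f ⊗ b) = f(S⁻¹(z) ? x) ⊗ y b`. -/
def action₃ : A ⊗[k] (A ⊗[k] A) →ₐ[k] Module.End k (DualCop k A ⊗[k] A) :=
  Algebra.TensorProduct.lift
    ((Module.End.rTensorAlgHom k (DualCop k A) A).comp (rightTranslation k A))
    (Algebra.TensorProduct.lift
      ((Module.End.lTensorAlgHom k A (DualCop k A)).comp (Algebra.lmul k A))
      ((Module.End.rTensorAlgHom k (DualCop k A) A).comp (leftTranslation k A))
      (fun y z => TensorProduct.ext' fun f b => rfl))
    (fun x t => by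
      induction t with
      | zero => simp
      | tmul y z =>
        have e : ∀ f : DualCop k A, rightTranslation k A x (leftTranslation k A z f) =
            leftTranslation k A z (rightTranslation k A x f) := by
          intro f
          ext w
          simp [mul_assoc]
        refine TensorProduct.ext' fun f b => ?_
        exact congrArg (fun u => u ⊗ₜ[k] (y * b)) (e f)
      | add s t hs ht => rw [map_add]; exact hs.add_right ht)

theorem action₃_tmul (x y z : A) (f : DualCop k A) (b : A) :
    action₃ k A (x ⊗ₜ (y ⊗ₜ z)) (f ⊗ₜ b) =
      rightTranslation k A x (leftTranslation k A z f) ⊗ₜ (y * b) := rfl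

/-- The action of `A` on `(A^*)^cop ⊗ A` given by
`a · (f ⊗ b) = f(S⁻¹(a₍₃₎) ? a₍₁₎) ⊗ a₍₂₎ b`. -/
def straighten : A →ₐ[k] Module.End k (DualCop k A ⊗[k] A) :=
  (action₃ k A).comp ((Algebra.TensorProduct.map (.id k A) (Bialgebra.comulAlgHom k A)).comp
    (Bialgebra.comulAlgHom k A))

theorem straighten_apply (a : A) :
    straighten k A a = action₃ k A ((comul (R := k)).lTensor A (comul a)) := rfl

/-- Left multiplication in the Drinfeld double:
`(f ⊗ a) (g ⊗ b) = f g(S⁻¹(a₍₃₎) ? a₍₁₎) ⊗ a₍₂₎ b`. -/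
def leftMul : DualCop k A ⊗[k] A →ₗ[k] Module.End k (DualCop k A ⊗[k] A) :=
  TensorProduct.lift ((LinearMap.mul k (Module.End k (DualCop k A ⊗[k] A))).compl₁₂
    (dualMul k A).toLinearMap (straighten k A).toLinearMap)

theorem leftMul_tmul (f : DualCop k A) (a : A) :
    leftMul k A (f ⊗ₜ a) = dualMul k A f * straighten k A a := rfl

end Double

section DoubleMul

open Coalgebra LinearMap WithConv HopfAlgebra

variable {k : Type*} {A : Type*} [Field k] [Ring A] [HopfAlgebra k A]

theorem rTensor_rightTranslation_mul (g : DualCop k A) {a : A} {ι : Type*} (r : Repr k a ι) :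
    (rightTranslation k A a).rTensor A * dualMul k A g = ∑ i ∈ r.index,
      dualMul k A (rightTranslation k A (r.left i) g) *
        (rightTranslation k A (r.right i)).rTensor A := by
  have e : ∀ f : DualCop k A, rightTranslation k A a (g * f) = ∑ i ∈ r.index,
      rightTranslation k A (r.left i) g * rightTranslation k A (r.right i) f := by
    intro f
    ext y
    rw [rightTranslation_apply, DualCop.mul_apply g f ((ℛ k y).mul r), map_sum,
      LinearMap.sum_apply]
    simp only [Repr.mul_index, Repr.mul_left, Repr.mul_right]
    rw [Finset.sum_product_right]
    refine Finset.sum_congr rfl fun i _ => ?_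
    rw [DualCop.mul_apply _ _ (ℛ k y)]
    rfl
  refine TensorProduct.ext' fun f b => ?_
  rw [LinearMap.sum_apply]
  change rightTranslation k A a (g * f) ⊗ₜ b = _
  rw [e, TensorProduct.sum_tmul]
  rfl

variable [HasBijectiveAntipode k A]

theorem rTensor_leftTranslation_mul (g : DualCop k A) {a : A} {ι : Type*} (r : Repr k a ι) :
    (leftTranslation k A a).rTensor A * dualMul k A g = ∑ i ∈ r.index,
      dualMul k A (leftTranslation k A (r.right i) g) *
        (leftTranslation k A (r.left i)).rTensor A := by
  have e : ∀ f : DualCop k A, leftTranslation k A a (g * f) = ∑ i ∈ r.index,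
      leftTranslation k A (r.right i) g * leftTranslation k A (r.left i) f := by
    intro f
    ext y
    rw [leftTranslation_apply, DualCop.mul_apply g f ((reprAntipodeInv k r).mul (ℛ k y)), map_sum,
      LinearMap.sum_apply]
    simp only [Repr.mul_index, Repr.mul_left, Repr.mul_right, reprAntipodeInv]
    rw [Finset.sum_product]
    refine Finset.sum_congr rfl fun i _ => ?_
    rw [DualCop.mul_apply _ _ (ℛ k y)]
    rfl
  refine TensorProduct.ext' fun f b => ?_
  rw [LinearMap.sum_apply]
  change leftTranslation k A a (g * f) ⊗ₜ b = _
  rw [e, TensorProduct.sum_tmul]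
  rfl

end DoubleMul

section Triple

open Coalgebra LinearMap WithConv

variable {k : Type*} {A E : Type*} [Field k] [Ring A] [Bialgebra k A] [Ring E] [Algebra k E]

theorem conv₃_apply (F G H : A →ₗ[k] E) (a : A) :
    (toConv F * (toConv G * toConv H) : WithConv (A →ₗ[k] E)) a =
      (LinearMap.mul' k E ∘ₗ TensorProduct.map F (LinearMap.mul' k E ∘ₗ TensorProduct.map G H))
        ((comul (R := k)).lTensor A (comul a)) := by
  rw [convMul_apply]
  generalize comul (R := k) a = t
  induction t with
  | zero => simp
  | tmul x y => simp [convMul_apply]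
  | add s t hs ht => simp only [map_add, hs, ht]

variable (k A) in
/-- The constant map, in the convolution algebra. -/
def convConst (e : E) : WithConv (A →ₗ[k] E) := toConv ((counit (R := k) (A := A)).smulRight e)

theorem mul_convConst_apply (F : WithConv (A →ₗ[k] E)) (e : E) (a : A) :
    (F * convConst k A e) a = F a * e := by
  have h : F * convConst k A e = toConv (LinearMap.mulRight k e ∘ₗ F.ofConv) := by
    conv_rhs => rw [← mul_one F]
    apply WithConv.ext
    ext a
    change (_ * _ : WithConv (A →ₗ[k] E)) a = (F * 1 : WithConv (A →ₗ[k] E)) a * e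
    rw [(ℛ k a).convMul_apply, (ℛ k a).convMul_apply, Finset.sum_mul]
    simp [convConst, Algebra.algebraMap_eq_smul_one]
  rw [h]
  rfl

theorem convConst_mul_apply (F : WithConv (A →ₗ[k] E)) (e : E) (a : A) :
    (convConst k A e * F) a = e * F a := by
  have h : convConst k A e * F = toConv (LinearMap.mulLeft k e ∘ₗ F.ofConv) := by
    conv_rhs => rw [← one_mul F]
    apply WithConv.ext
    ext a
    change (_ * _ : WithConv (A →ₗ[k] E)) a = e * (1 * F : WithConv (A →ₗ[k] E)) a
    rw [(ℛ k a).convMul_apply, (ℛ k a).convMul_apply, Finset.mul_sum]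
    simp [convConst, Algebra.algebraMap_eq_smul_one]
  rw [h]
  rfl

end Triple

section DoubleAssoc

open Coalgebra LinearMap WithConv HopfAlgebra

variable {k : Type*} {A : Type*} [Field k] [Ring A] [HopfAlgebra k A] [HasBijectiveAntipode k A]

theorem straighten_eq_conv (a : A) : straighten k A a =
    (toConv (((rTensorHom A).comp (rightTranslation k A).toLinearMap)) *
      (toConv ((lTensorHom (DualCop k A)).comp (LinearMap.mul k A)) *
        toConv ((rTensorHom A).comp (leftTranslation k A).toLinearMap)) :
      WithConv (A →ₗ[k] Module.End k (DualCop k A ⊗[k] A))) a := by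
  rw [conv₃_apply, straighten_apply]
  generalize (comul (R := k)).lTensor A (comul a) = t
  refine LinearMap.congr_fun (f := (action₃ k A).toLinearMap) ?_ t
  refine TensorProduct.ext_threefold' fun x y z => ?_
  exact TensorProduct.ext' fun f b => rfl

theorem leftMul_dualMul (f : DualCop k A) (w : DualCop k A ⊗[k] A) :
    leftMul k A (dualMul k A f w) = dualMul k A f * leftMul k A w := by
  induction w with
  | zero => simp
  | add s t hs ht => simp only [map_add, hs, ht, mul_add]
  | tmul g b => rw [dualMul_tmul, leftMul_tmul, leftMul_tmul, map_mul, mul_assoc]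

theorem straighten_one_tmul (a b : A) : straighten k A a (1 ⊗ₜ b) = 1 ⊗ₜ (a * b) := by
  have e : ∀ x, rightTranslation k A x (1 : DualCop k A) = counit (R := k) x • 1 := by
    intro x
    ext y
    simp [mul_comm]
  have e' : ∀ x, leftTranslation k A x (1 : DualCop k A) = counit (R := k) x • 1 := by
    intro x
    ext y
    simp
  have h : ∀ t : A ⊗[k] (A ⊗[k] A), action₃ k A t (1 ⊗ₜ b) = 1 ⊗ₜ ((TensorProduct.lid k A
      ((counit (R := k) (A := A)).rTensor A ((TensorProduct.rid k A).toLinearMap.lTensor A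
        (((counit (R := k) (A := A)).lTensor A).lTensor A t)))) * b) := by
    intro t
    induction t with
    | zero => simp
    | add s t hs ht => simp only [map_add, LinearMap.add_apply, hs, ht, add_mul,
        TensorProduct.tmul_add]
    | tmul x s =>
      induction s with
      | zero => simp
      | add s t hs ht => simp only [TensorProduct.tmul_add, map_add, LinearMap.add_apply, hs, ht,
          add_mul]
      | tmul y z =>
        rw [action₃_tmul, e', map_smul, e, smul_smul, ← TensorProduct.smul_tmul', LinearMap.lTensor_tmul,
          LinearMap.lTensor_tmul, LinearMap.lTensor_tmul, LinearMap.rTensor_tmul,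
          TensorProduct.lid_tmul, LinearEquiv.coe_coe, TensorProduct.rid_tmul, smul_smul,
          smul_mul_assoc, TensorProduct.tmul_smul, mul_comm]
  rw [straighten_apply, h]
  have e2 : ((counit (R := k) (A := A)).lTensor A).lTensor A
      ((comul (R := k)).lTensor A (comul (R := k) a)) =
      ((TensorProduct.mk k A k).flip 1).lTensor A (comul (R := k) a) := by
    rw [← LinearMap.comp_apply, ← LinearMap.lTensor_comp, Coalgebra.lTensor_counit_comp_comul]
  have e3 : (TensorProduct.rid k A).toLinearMap.lTensor A
      (((TensorProduct.mk k A k).flip 1).lTensor A (comul (R := k) a)) = comul (R := k) a := by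
    rw [← LinearMap.comp_apply, ← LinearMap.lTensor_comp]
    convert LinearMap.lTensor_id_apply A A (comul (R := k) a)
    ext
    simp
  rw [e2, e3, Coalgebra.rTensor_counit_comul, TensorProduct.lid_tmul, one_smul]

variable [Module.Finite k A]

theorem leftMul_straighten_one (a : A) (g : DualCop k A) :
    leftMul k A (straighten k A a (g ⊗ₜ 1)) = straighten k A a * dualMul k A g := by
  let E := Module.End k (DualCop k A ⊗[k] A)
  let rr : WithConv (A →ₗ[k] E) := toConv ((rTensorHom A).comp (rightTranslation k A).toLinearMap)
  let mm : WithConv (A →ₗ[k] E) := toConv ((lTensorHom (DualCop k A)).comp (LinearMap.mul k A))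
  let nn : WithConv (A →ₗ[k] E) := toConv ((rTensorHom A).comp (leftTranslation k A).toLinearMap)
  let F : DualCop k A → WithConv (A →ₗ[k] E) := fun f =>
    toConv ((dualMul k A).toLinearMap ∘ₗ (rightTranslation k A).toLinearMap.flip f)
  let sc : DualCop k A → WithConv (A →ₗ[k] E) := fun c =>
    toConv ((DualCop.toDual k A c ∘ₗ antipodeInv k A).smulRight 1)
  let r := ℛ k g
  have hL : ∀ z, leftTranslation k A z g =
      ∑ i ∈ r.index, (r.right i) (antipodeInv k A z) • r.left i := by
    intro z
    ext y
    rw [leftTranslation_apply, ← DualCop.pairing_comul, ← r.eq, map_sum, map_sum,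
      LinearMap.sum_apply, LinearMap.sum_apply]
    simp [mul_comm]
  have hrr : ∀ f, rr * convConst k A (dualMul k A f) = F f * rr := by
    intro f
    apply WithConv.ext
    ext1 a
    change (_ * _ : WithConv (A →ₗ[k] E)) a = (_ * _ : WithConv (A →ₗ[k] E)) a
    rw [mul_convConst_apply, (ℛ k a).convMul_apply]
    exact rTensor_rightTranslation_mul f (ℛ k a)
  have hmm : ∀ f, mm * convConst k A (dualMul k A f) = convConst k A (dualMul k A f) * mm := by
    intro f
    apply WithConv.ext
    ext1 a
    change (_ * _ : WithConv (A →ₗ[k] E)) a = (_ * _ : WithConv (A →ₗ[k] E)) a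
    rw [mul_convConst_apply, convConst_mul_apply]
    exact TensorProduct.ext' fun f b => rfl
  have hnn : nn * convConst k A (dualMul k A g) =
      ∑ i ∈ r.index, convConst k A (dualMul k A (r.left i)) * (nn * sc (r.right i)) := by
    apply WithConv.ext
    ext1 a
    change (_ * _ : WithConv (A →ₗ[k] E)) a = WithConv.linearEquiv k (A →ₗ[k] E) (∑ i ∈ r.index, _) a
    rw [mul_convConst_apply, map_sum, LinearMap.sum_apply]
    refine (rTensor_leftTranslation_mul g (ℛ k a)).trans ?_
    simp only [hL, map_sum, map_smul, Finset.sum_mul, smul_mul_assoc]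
    rw [Finset.sum_comm]
    refine Finset.sum_congr rfl fun i _ => ?_
    change _ = (_ * _ : WithConv (A →ₗ[k] E)) a
    rw [convConst_mul_apply, (ℛ k a).convMul_apply, Finset.mul_sum]
    refine Finset.sum_congr rfl fun j _ => ?_
    simp [sc, nn]
  have hΛ : toConv (straighten k A).toLinearMap = rr * (mm * nn) :=
    WithConv.ext (LinearMap.ext fun a => straighten_eq_conv a)
  have key : toConv (straighten k A).toLinearMap * convConst k A (dualMul k A g) =
      ∑ i ∈ r.index, F (r.left i) * (toConv (straighten k A).toLinearMap * sc (r.right i)) := by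
    rw [hΛ, mul_assoc, mul_assoc, hnn, Finset.mul_sum, Finset.mul_sum]
    refine Finset.sum_congr rfl fun i _ => ?_
    rw [← mul_assoc mm, hmm, mul_assoc, ← mul_assoc rr, hrr]
    simp only [mul_assoc]
  have e := congrArg (fun φ : WithConv (A →ₗ[k] E) => φ a) key
  change (_ * _ : WithConv (A →ₗ[k] E)) a = WithConv.linearEquiv k (A →ₗ[k] E) (∑ i ∈ r.index, _) a at e
  rw [mul_convConst_apply, map_sum, LinearMap.sum_apply] at e
  refine Eq.trans ?_ e.symm
  have e2 : ∀ i, (WithConv.linearEquiv k (A →ₗ[k] E)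
      (F (r.left i) * (toConv (straighten k A).toLinearMap * sc (r.right i)))) a = _ :=
    fun i => conv₃_apply _ _ _ a
  simp only [e2]
  rw [straighten_apply, ← LinearMap.sum_apply]
  generalize (comul (R := k)).lTensor A (comul a) = t
  refine LinearMap.congr_fun (f := leftMul k A ∘ₗ
    (LinearMap.applyₗ (g ⊗ₜ[k] (1 : A))) ∘ₗ (action₃ k A).toLinearMap) ?_ t
  refine TensorProduct.ext_threefold' fun x y z => ?_
  rw [LinearMap.sum_apply]
  change leftMul k A (action₃ k A (x ⊗ₜ (y ⊗ₜ z)) (g ⊗ₜ 1)) = _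
  rw [action₃_tmul, hL, leftMul_tmul, mul_one]
  simp only [map_sum, map_smul, Finset.sum_mul, smul_mul_assoc]
  refine Finset.sum_congr rfl fun i _ => ?_
  simp

theorem leftMul_straighten (a : A) (w : DualCop k A ⊗[k] A) :
    leftMul k A (straighten k A a w) = straighten k A a * leftMul k A w := by
  have h1 : ∀ (t : A ⊗[k] (A ⊗[k] A)) (g : DualCop k A) (b : A),
      leftMul k A (action₃ k A t (g ⊗ₜ b)) =
        leftMul k A (action₃ k A t (g ⊗ₜ 1)) * straighten k A b := by
    intro t g b
    refine LinearMap.congr_fun (f := leftMul k A ∘ₗ (LinearMap.applyₗ (g ⊗ₜ[k] b)) ∘ₗ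
      (action₃ k A).toLinearMap) (g := LinearMap.mulRight k (straighten k A b) ∘ₗ leftMul k A ∘ₗ
      (LinearMap.applyₗ (g ⊗ₜ[k] (1 : A))) ∘ₗ (action₃ k A).toLinearMap) ?_ t
    refine TensorProduct.ext_threefold' fun x y z => ?_
    change leftMul k A (action₃ k A (x ⊗ₜ (y ⊗ₜ z)) (g ⊗ₜ b)) =
      leftMul k A (action₃ k A (x ⊗ₜ (y ⊗ₜ z)) (g ⊗ₜ 1)) * straighten k A b
    rw [action₃_tmul, action₃_tmul, leftMul_tmul, leftMul_tmul, map_mul, mul_one, mul_assoc]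
  induction w with
  | zero => simp
  | add s t hs ht => simp only [map_add, hs, ht, mul_add]
  | tmul g b =>
    rw [straighten_apply, h1, ← straighten_apply, leftMul_straighten_one, leftMul_tmul, mul_assoc]

theorem leftMul_leftMul (v w : DualCop k A ⊗[k] A) :
    leftMul k A (leftMul k A v w) = leftMul k A v * leftMul k A w := by
  induction v with
  | zero => simp
  | add s t hs ht => simp only [map_add, LinearMap.add_apply, hs, ht, add_mul]
  | tmul f a => rw [leftMul_tmul, Module.End.mul_apply, leftMul_dualMul, leftMul_straighten,
      mul_assoc]

end DoubleAssoc

section DrinfeldDouble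

open Coalgebra LinearMap WithConv HopfAlgebra

variable (k : Type*) (A : Type*) [Field k] [Ring A] [HopfAlgebra k A]

/-- The Drinfeld double `D(A) = (A^*)^cop ⋈ A` of a finite dimensional Hopf algebra: the coalgebra
`(A^*)^cop ⊗ A` with the product
`(f ⊗ a) (g ⊗ b) = f g(S⁻¹(a₍₃₎) ? a₍₁₎) ⊗ a₍₂₎ b`. -/
def DrinfeldDouble : Type _ := DualCop k A ⊗[k] A

namespace DrinfeldDouble

instance : AddCommGroup (DrinfeldDouble k A) := inferInstanceAs (AddCommGroup (DualCop k A ⊗[k] A))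

instance : Module k (DrinfeldDouble k A) := inferInstanceAs (Module k (DualCop k A ⊗[k] A))

/-- The coalgebra structure is the one of the tensor product of coalgebras. -/
instance [Module.Finite k A] : Coalgebra k (DrinfeldDouble k A) :=
  inferInstanceAs (Coalgebra k (DualCop k A ⊗[k] A))

instance : One (DrinfeldDouble k A) := ⟨(1 : DualCop k A) ⊗ₜ (1 : A)⟩

theorem one_def : (1 : DrinfeldDouble k A) = (1 : DualCop k A) ⊗ₜ[k] (1 : A) := rfl

variable [HasBijectiveAntipode k A]

instance : Mul (DrinfeldDouble k A) := ⟨fun v w => leftMul k A v w⟩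

theorem mul_def (v w : DrinfeldDouble k A) : v * w = leftMul k A v w := rfl

variable [Module.Finite k A]

instance : Ring (DrinfeldDouble k A) where
  __ := (inferInstance : AddCommGroup (DrinfeldDouble k A))
  left_distrib u v w := map_add (leftMul k A u) v w
  right_distrib u v w := LinearMap.congr_fun (map_add (leftMul k A) u v) w
  zero_mul w := LinearMap.congr_fun (map_zero (leftMul k A)) w
  mul_zero w := map_zero (leftMul k A w)
  mul_assoc u v w := LinearMap.congr_fun (leftMul_leftMul u v) w
  one_mul w := by
    rw [mul_def, one_def, leftMul_tmul, map_one, map_one]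
    rfl
  mul_one w := by
    rw [mul_def, one_def]
    refine LinearMap.congr_fun (f := (leftMul k A).flip ((1 : DualCop k A) ⊗ₜ (1 : A)))
      (g := LinearMap.id) (TensorProduct.ext' fun f a => ?_) w
    change leftMul k A (f ⊗ₜ a) (1 ⊗ₜ 1) = f ⊗ₜ a
    rw [leftMul_tmul, Module.End.mul_apply, straighten_one_tmul, dualMul_tmul, mul_one, mul_one]

instance : Algebra k (DrinfeldDouble k A) :=
  Algebra.ofModule (fun c v w => LinearMap.congr_fun (map_smul (leftMul k A) c v) w)
    (fun c v w => map_smul (leftMul k A v) c w)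

variable {k A}

/-- The element `f ⊗ a` of the Drinfeld double. -/
def tmul (f : DualCop k A) (a : A) : DrinfeldDouble k A := f ⊗ₜ[k] a

/-- The product of the Drinfeld double, in terms of an expression
`(id ⊗ Δ)(Δ(a)) = ∑ i, x i ⊗ y i ⊗ z i`. -/
theorem tmul_mul_tmul (f g : DualCop k A) (a b : A) {ι : Type*} (s : Finset ι) (x y z : ι → A)
    (h : (comul (R := k)).lTensor A (comul a) = ∑ i ∈ s, x i ⊗ₜ (y i ⊗ₜ z i)) :
    tmul f a * tmul g b = ∑ i ∈ s, tmul (f * (DualCop.toDual k A).symm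
      ((DualCop.toDual k A g) ∘ₗ LinearMap.mulLeft k (antipodeInv k A (z i)) ∘ₗ
        LinearMap.mulRight k (x i))) (y i * b) := by
  rw [mul_def, tmul, tmul, leftMul_tmul, Module.End.mul_apply, straighten_apply, h, map_sum,
    LinearMap.sum_apply, map_sum]
  rfl

end DrinfeldDouble

end DrinfeldDouble

namespace DrinfeldDouble

section DrinfeldBialgebra

open Coalgebra LinearMap WithConv HopfAlgebra

variable {k : Type*} {A : Type*} [Field k] [Ring A] [HopfAlgebra k A] [HasBijectiveAntipode k A]
variable [Module.Finite k A]


variable (k A) in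
/-- The inclusion of `(A^*)^cop` in the Drinfeld double. -/
def inclDual : DualCop k A →ₐ[k] DrinfeldDouble k A :=
  AlgHom.ofLinearMap ((TensorProduct.mk k (DualCop k A) A).flip 1) rfl (fun f g => by
    change (f * g) ⊗ₜ[k] (1 : A) = leftMul k A (f ⊗ₜ 1) (g ⊗ₜ 1)
    rw [leftMul_tmul, map_one, mul_one, dualMul_tmul])

variable (k A) in
/-- The inclusion of `A` in the Drinfeld double. -/
def incl : A →ₐ[k] DrinfeldDouble k A :=
  AlgHom.ofLinearMap (TensorProduct.mk k (DualCop k A) A 1) rfl (fun a b => by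
    change (1 : DualCop k A) ⊗ₜ[k] (a * b) = leftMul k A (1 ⊗ₜ a) (1 ⊗ₜ b)
    rw [leftMul_tmul, map_one, one_mul, straighten_one_tmul])

theorem tmul_eq_mul (f : DualCop k A) (a : A) : tmul f a = inclDual k A f * incl k A a := by
  change f ⊗ₜ a = leftMul k A (f ⊗ₜ 1) (1 ⊗ₜ a)
  rw [leftMul_tmul, map_one, mul_one, dualMul_tmul, mul_one]

theorem incl_mul_inclDual (a : A) (g : DualCop k A) :
    incl k A a * inclDual k A g = straighten k A a (g ⊗ₜ 1) := by
  change leftMul k A (1 ⊗ₜ a) (g ⊗ₜ 1) = _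
  rw [leftMul_tmul, map_one, one_mul]

variable (k A) in
/-- The exchange of the two middle factors. -/
def shuffle : (DualCop k A ⊗[k] DualCop k A) ⊗[k] (A ⊗[k] A) ≃ₗ[k]
    DrinfeldDouble k A ⊗[k] DrinfeldDouble k A :=
  TensorProduct.AlgebraTensorModule.tensorTensorTensorComm k k k k _ _ _ _

theorem comul_tmul_eq_shuffle (f : DualCop k A) (a : A) : comul (R := k) (tmul f a) =
    shuffle k A (comul (R := k) f ⊗ₜ[k] comul (R := k) a) := rfl

theorem comul_tmul (f : DualCop k A) (a : A) : comul (R := k) (tmul f a) =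
    Algebra.TensorProduct.map (inclDual k A) (inclDual k A) (comul (R := k) f) *
      Algebra.TensorProduct.map (incl k A) (incl k A) (comul (R := k) a) := by
  rw [comul_tmul_eq_shuffle]
  generalize comul (R := k) f = s
  generalize comul (R := k) a = t
  refine LinearMap.congr_fun₂ (f := (TensorProduct.mk k _ _).compr₂
    (shuffle k A).toLinearMap)
    (g := (LinearMap.mul k (DrinfeldDouble k A ⊗[k] DrinfeldDouble k A)).compl₁₂
      (Algebra.TensorProduct.map (inclDual k A) (inclDual k A)).toLinearMap
      (Algebra.TensorProduct.map (incl k A) (incl k A)).toLinearMap) ?_ s t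
  refine TensorProduct.ext' fun f f' => TensorProduct.ext' fun a a' => ?_
  change tmul f a ⊗ₜ[k] tmul f' a' = (inclDual k A f ⊗ₜ[k] inclDual k A f') *
    (incl k A a ⊗ₜ[k] incl k A a')
  rw [Algebra.TensorProduct.tmul_mul_tmul, tmul_eq_mul, tmul_eq_mul]

theorem comul_inclDual (f : DualCop k A) : comul (R := k) (inclDual k A f) =
    Algebra.TensorProduct.map (inclDual k A) (inclDual k A) (comul (R := k) f) := by
  have := comul_tmul f (1 : A)
  rwa [tmul_eq_mul, map_one, mul_one, Bialgebra.comul_one, map_one, mul_one] at this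

theorem comul_incl (a : A) : comul (R := k) (incl k A a) =
    Algebra.TensorProduct.map (incl k A) (incl k A) (comul (R := k) a) := by
  have := comul_tmul (1 : DualCop k A) a
  rwa [tmul_eq_mul, map_one, one_mul, Bialgebra.comul_one, map_one, one_mul] at this

/-- Evaluation of the first factor: `f ⊗ a ↦ f(y) a`. -/
def evalAt (y : A) : DrinfeldDouble k A →ₗ[k] A :=
  TensorProduct.lift ((LinearMap.lsmul k A).comp
    ((LinearMap.applyₗ y).comp (DualCop.toDual k A).toLinearMap))

theorem evalAt_tmul (y : A) (f : DualCop k A) (a : A) : evalAt y (tmul f a) = f y • a := rfl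

theorem map_evalAt_comm (y z : A) (s : DualCop k A ⊗[k] DualCop k A) (t : A ⊗[k] A) :
    TensorProduct.map (evalAt y) (evalAt z)
      (shuffle k A (s ⊗ₜ[k] t)) =
      DualCop.pairing k A s (y ⊗ₜ z) • t := by
  refine LinearMap.congr_fun₂ (f := (TensorProduct.mk k _ _).compr₂
    ((TensorProduct.map (evalAt y) (evalAt z)) ∘ₗ (shuffle k A).toLinearMap))
    (g := (LinearMap.lsmul k (A ⊗[k] A)).comp ((LinearMap.applyₗ (y ⊗ₜ[k] z)).comp
      (DualCop.pairing k A).toLinearMap)) ?_ s t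
  refine TensorProduct.ext' fun f f' => TensorProduct.ext' fun a a' => ?_
  change evalAt y (tmul f a) ⊗ₜ[k] evalAt z (tmul f' a') = (f y * f' z) • (a ⊗ₜ[k] a')
  rw [evalAt_tmul, evalAt_tmul, TensorProduct.smul_tmul_smul]

theorem map_evalAt_injective {s t : DrinfeldDouble k A ⊗[k] DrinfeldDouble k A}
    (h : ∀ y z, TensorProduct.map (evalAt y) (evalAt z) s =
      TensorProduct.map (evalAt y) (evalAt z) t) : s = t := by
  let e := shuffle k A
  let Φ := (TensorProduct.congr (DualCop.pairing k A) (LinearEquiv.refl k (A ⊗[k] A))).trans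
    (dualTensorHomEquiv k (A ⊗[k] A) (A ⊗[k] A))
  obtain ⟨s, rfl⟩ := e.surjective s
  obtain ⟨t, rfl⟩ := e.surjective t
  refine congrArg e (Φ.injective (TensorProduct.ext' fun y z => ?_))
  have hΦ : ∀ u, Φ u (y ⊗ₜ z) = TensorProduct.map (evalAt y) (evalAt z) (e u) := by
    intro u
    refine LinearMap.congr_fun (f := (LinearMap.applyₗ (y ⊗ₜ[k] z)) ∘ₗ Φ.toLinearMap)
      (g := TensorProduct.map (evalAt y) (evalAt z) ∘ₗ e.toLinearMap)
      (TensorProduct.ext' fun s t => ?_) u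
    refine Eq.trans ?_ (map_evalAt_comm y z s t).symm
    simp [Φ]
  rw [hΦ, hΦ]
  exact h y z

theorem map_evalAt_comul (y z : A) (w : DrinfeldDouble k A) :
    TensorProduct.map (evalAt y) (evalAt z) (comul (R := k) w) =
      comul (R := k) (evalAt (z * y) w) := by
  refine LinearMap.congr_fun (f := TensorProduct.map (evalAt y) (evalAt z) ∘ₗ comul)
    (g := comul ∘ₗ evalAt (z * y)) (TensorProduct.ext' fun f a => ?_) w
  refine (map_evalAt_comm y z (comul (R := k) f) (comul (R := k) a)).trans ?_
  rw [DualCop.pairing_comul]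
  exact (map_smul (comul (R := k)) (f (z * y)) a).symm

end DrinfeldBialgebra

end DrinfeldDouble

namespace DrinfeldDouble

section DrinfeldComul

open Coalgebra LinearMap WithConv HopfAlgebra

variable {k : Type*} {A : Type*} [Field k] [Ring A] [HopfAlgebra k A]

variable (k A) in
/-- An algebra in which the iterated coproducts are computed. -/
abbrev Aux : Type _ := Aᵐᵒᵖ ⊗[k] (A ⊗[k] A)

variable (k A) in
/-- `a ↦ a ⊗ (1 ⊗ 1)`. -/
def auxLeft : A →ₗ[k] Aux k A :=
  (TensorProduct.mk k Aᵐᵒᵖ (A ⊗[k] A)).flip 1 ∘ₗ (MulOpposite.opLinearEquiv k).toLinearMap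

theorem auxLeft_apply (a : A) : auxLeft k A a = .op a ⊗ₜ 1 := rfl

variable (k A) in
/-- `t ↦ 1 ⊗ t`. -/
def auxRight : A ⊗[k] A →ₐ[k] Aux k A := Algebra.TensorProduct.includeRight

theorem auxRight_apply (t : A ⊗[k] A) : auxRight k A t = 1 ⊗ₜ t := rfl

theorem auxLeft_mul (a b : A) : auxLeft k A a * auxLeft k A b = auxLeft k A (b * a) := by
  simp [auxLeft_apply]

theorem auxLeft_mul_comm (a : A) (t : A ⊗[k] A) :
    auxRight k A t * auxLeft k A a = auxLeft k A a * auxRight k A t := by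
  simp [auxLeft_apply, auxRight_apply]

/-- Evaluation of `g` on the first factor. -/
def auxEval (g : DualCop k A) : Aux k A →ₗ[k] A ⊗[k] A :=
  TensorProduct.lift ((LinearMap.lsmul k (A ⊗[k] A)).comp
    (DualCop.toDual k A g ∘ₗ (MulOpposite.opLinearEquiv k).symm.toLinearMap))

theorem auxEval_apply (g : DualCop k A) (a : A) (t : A ⊗[k] A) :
    auxEval g (auxLeft k A a * auxRight k A t) = g a • t := by
  rw [auxLeft_apply, auxRight_apply, Algebra.TensorProduct.tmul_mul_tmul, one_mul, mul_one]
  rfl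

theorem aux_triple (a b c : A) (t : A ⊗[k] A) :
    auxLeft k A a * auxLeft k A b * (auxRight k A t * auxLeft k A c) =
      auxLeft k A (c * b * a) * auxRight k A t := by
  rw [auxLeft_mul_comm, auxLeft_mul, ← mul_assoc, auxLeft_mul, mul_assoc]

variable [HasBijectiveAntipode k A]

variable (k A) in
/-- `y ↦ ∑ S⁻¹(a₍₃₎) y a₍₁₎ ⊗ φ(a₍₂₎)`, in the convolution algebra. -/
def auxConj (φ : A →ₗ[k] A ⊗[k] A) (y : A) : WithConv (A →ₗ[k] Aux k A) :=
  toConv (LinearMap.mulRight k (auxLeft k A y) ∘ₗ auxLeft k A) *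
    (toConv ((auxRight k A).toLinearMap ∘ₗ φ) * toConv (auxLeft k A ∘ₗ antipodeInv k A))

theorem auxConj_eq (φ : A →ₗ[k] A ⊗[k] A) (y : A) : auxConj k A φ y =
    toConv (auxLeft k A) * (convConst k A (auxLeft k A y) *
      (toConv ((auxRight k A).toLinearMap ∘ₗ φ) * toConv (auxLeft k A ∘ₗ antipodeInv k A))) := by
  rw [auxConj, ← mul_assoc (toConv (auxLeft k A))]
  congr 1
  apply WithConv.ext
  ext1 a
  exact (mul_convConst_apply _ _ _).symm

theorem auxLeft_antipodeInv_mul :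
    (toConv (auxLeft k A ∘ₗ antipodeInv k A) * toConv (auxLeft k A) :
      WithConv (A →ₗ[k] Aux k A)) = 1 := by
  apply WithConv.ext
  ext1 a
  change (_ * _ : WithConv (A →ₗ[k] Aux k A)) a = _
  rw [(ℛ k a).convMul_apply]
  change ∑ i ∈ _, auxLeft k A (antipodeInv k A _) * auxLeft k A _ = algebraMap k _ (counit a)
  simp only [auxLeft_mul, ← map_sum]
  rw [sum_right_mul_antipodeInv_left, auxLeft_apply, Algebra.TensorProduct.algebraMap_apply]
  rfl

theorem mul_cancel_middle {M : Type*} [Monoid M] {i j j' s y z : M} (h : s * i = 1)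
    (hz : j * z = z * j) :
    i * (y * (j * s)) * (i * (z * (j' * s))) = i * (y * z * (j * j' * s)) := by
  simp only [mul_assoc]
  rw [← mul_assoc s, h, one_mul, ← mul_assoc j z, hz, mul_assoc]

theorem auxConj_mul_auxConj (y z : A) :
    auxConj k A (Algebra.TensorProduct.includeLeft : A →ₐ[k] A ⊗[k] A).toLinearMap y *
      auxConj k A (Algebra.TensorProduct.includeRight : A →ₐ[k] A ⊗[k] A).toLinearMap z =
      auxConj k A comul (z * y) := by
  let i₁ : A →ₐ[k] A ⊗[k] A := Algebra.TensorProduct.includeLeft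
  let i₂ : A →ₐ[k] A ⊗[k] A := Algebra.TensorProduct.includeRight
  have h1 : (toConv ((auxRight k A).toLinearMap ∘ₗ i₁.toLinearMap) : WithConv (A →ₗ[k] Aux k A)) *
      convConst k A (auxLeft k A z) = convConst k A (auxLeft k A z) *
        toConv ((auxRight k A).toLinearMap ∘ₗ i₁.toLinearMap) := by
    apply WithConv.ext
    ext1 a
    change (_ * _ : WithConv (A →ₗ[k] Aux k A)) a = (_ * _ : WithConv (A →ₗ[k] Aux k A)) a
    rw [mul_convConst_apply, convConst_mul_apply]
    exact auxLeft_mul_comm _ _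
  have h2 : convConst k A (auxLeft k A y) * convConst k A (auxLeft k A z) =
      convConst k A (auxLeft k A (z * y)) := by
    apply WithConv.ext
    ext1 a
    change (_ * _ : WithConv (A →ₗ[k] Aux k A)) a = _
    rw [mul_convConst_apply, ← auxLeft_mul]
    exact smul_mul_assoc ..
  have h3 : (toConv ((auxRight k A).toLinearMap ∘ₗ i₁.toLinearMap) : WithConv (A →ₗ[k] Aux k A)) *
      toConv ((auxRight k A).toLinearMap ∘ₗ i₂.toLinearMap) =
        toConv ((auxRight k A).toLinearMap ∘ₗ comul) := by
    apply WithConv.ext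
    ext1 a
    change (_ * _ : WithConv (A →ₗ[k] Aux k A)) a = auxRight k A (comul a)
    rw [(ℛ k a).convMul_apply, ← (ℛ k a).eq, map_sum]
    refine Finset.sum_congr rfl fun i _ => ?_
    change auxRight k A (i₁ _) * auxRight k A (i₂ _) = _
    rw [← map_mul]
    simp [i₁, i₂]
  rw [auxConj_eq, auxConj_eq, auxConj_eq, ← h2, ← h3]
  exact mul_cancel_middle (M := WithConv (A →ₗ[k] Aux k A)) auxLeft_antipodeInv_mul h1

variable (k A) in
/-- `auxConj` before the application of the coproduct. -/
def auxTriple (φ : A →ₗ[k] A ⊗[k] A) (y : A) : A ⊗[k] (A ⊗[k] A) →ₗ[k] Aux k A :=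
  LinearMap.mul' k (Aux k A) ∘ₗ TensorProduct.map
    (LinearMap.mulRight k (auxLeft k A y) ∘ₗ auxLeft k A)
    (LinearMap.mul' k (Aux k A) ∘ₗ TensorProduct.map ((auxRight k A).toLinearMap ∘ₗ φ)
      (auxLeft k A ∘ₗ antipodeInv k A))

theorem auxConj_apply (φ : A →ₗ[k] A ⊗[k] A) (y a : A) : auxConj k A φ y a =
    auxTriple k A φ y ((comul (R := k)).lTensor A (comul a)) := conv₃_apply _ _ _ _

theorem auxTriple_tmul (φ : A →ₗ[k] A ⊗[k] A) (y a b c : A) :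
    auxTriple k A φ y (a ⊗ₜ (b ⊗ₜ c)) =
      auxLeft k A (antipodeInv k A c * y * a) * auxRight k A (φ b) := by
  rw [← aux_triple]
  simp [auxTriple]

variable [Module.Finite k A]

variable (k A) in
/-- `(x ⊗ y ⊗ z, f) ↦ f(S⁻¹(z) ? x) ⊗ y`. -/
def twist : A ⊗[k] (A ⊗[k] A) →ₗ[k] DualCop k A →ₗ[k] DrinfeldDouble k A :=
  (LinearMap.lcomp k (DualCop k A ⊗[k] A) ((TensorProduct.mk k (DualCop k A) A).flip 1)).comp
    (action₃ k A).toLinearMap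

theorem incl_mul_inclDual' (a : A) (f : DualCop k A) : incl k A a * inclDual k A f =
    twist k A ((comul (R := k)).lTensor A (comul a)) f := incl_mul_inclDual a f

theorem evalAt_twist (y a b c : A) (f : DualCop k A) :
    evalAt y (twist k A (a ⊗ₜ (b ⊗ₜ c)) f) = f (antipodeInv k A c * y * a) • b := by
  change f (antipodeInv k A c * (y * a)) • (b * 1) = _
  rw [mul_assoc, mul_one]

theorem comul_evalAt_straighten (y a : A) (g : DualCop k A) :
    comul (R := k) (evalAt y (straighten k A a (g ⊗ₜ 1))) = auxEval g (auxConj k A comul y a) := by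
  rw [auxConj_apply, straighten_apply]
  refine LinearMap.congr_fun (f := comul ∘ₗ evalAt y ∘ₗ (LinearMap.applyₗ (g ⊗ₜ[k] (1 : A))) ∘ₗ
    (action₃ k A).toLinearMap) (g := auxEval g ∘ₗ auxTriple k A comul y) ?_ _
  refine TensorProduct.ext_threefold' fun b c d => ?_
  change comul (R := k) (evalAt y (action₃ k A (b ⊗ₜ (c ⊗ₜ d)) (g ⊗ₜ 1))) =
    auxEval g (auxTriple k A comul y (b ⊗ₜ (c ⊗ₜ d)))
  rw [auxTriple_tmul, auxEval_apply, action₃_tmul, mul_one]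
  refine (congrArg _ (evalAt_tmul ..)).trans ?_
  rw [map_smul, rightTranslation_apply, leftTranslation_apply, mul_assoc]

theorem evalAt_straighten_tmul (y z a b : A) (s : DualCop k A ⊗[k] DualCop k A)
    (g : DualCop k A) (hs : ∀ c d, DualCop.pairing k A s (c ⊗ₜ d) = g (d * c)) :
    TensorProduct.map (evalAt y) (evalAt z) ((incl k A a ⊗ₜ[k] incl k A b) *
      Algebra.TensorProduct.map (inclDual k A) (inclDual k A) s) = auxEval g
        (auxConj k A (Algebra.TensorProduct.includeLeft : A →ₐ[k] A ⊗[k] A).toLinearMap y a *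
        auxConj k A (Algebra.TensorProduct.includeRight : A →ₐ[k] A ⊗[k] A).toLinearMap z b) := by
  have h1 : (incl k A a ⊗ₜ[k] incl k A b) *
      Algebra.TensorProduct.map (inclDual k A) (inclDual k A) s =
      TensorProduct.map (twist k A ((comul (R := k)).lTensor A (comul a)))
        (twist k A ((comul (R := k)).lTensor A (comul b))) s := by
    refine LinearMap.congr_fun (f := LinearMap.mulLeft k (incl k A a ⊗ₜ[k] incl k A b) ∘ₗ
      (Algebra.TensorProduct.map (inclDual k A) (inclDual k A)).toLinearMap)
      (TensorProduct.ext' fun f f' => ?_) s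
    change (incl k A a ⊗ₜ[k] incl k A b) * (inclDual k A f ⊗ₜ[k] inclDual k A f') = _
    rw [Algebra.TensorProduct.tmul_mul_tmul, incl_mul_inclDual', incl_mul_inclDual',
      TensorProduct.map_tmul]
  have h2 : ∀ b c d b' c' d' : A, TensorProduct.map
      (evalAt y ∘ₗ twist k A (b ⊗ₜ (c ⊗ₜ d))) (evalAt z ∘ₗ twist k A (b' ⊗ₜ (c' ⊗ₜ d'))) s =
      DualCop.pairing k A s ((antipodeInv k A d * y * b) ⊗ₜ (antipodeInv k A d' * z * b')) •
        (c ⊗ₜ[k] c') := by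
    intro b c d b' c' d'
    refine LinearMap.congr_fun (g := (LinearMap.toSpanSingleton k _ (c ⊗ₜ[k] c')) ∘ₗ
      (LinearMap.applyₗ ((antipodeInv k A d * y * b) ⊗ₜ[k] (antipodeInv k A d' * z * b'))) ∘ₗ
        (DualCop.pairing k A).toLinearMap) (TensorProduct.ext' fun f f' => ?_) s
    rw [TensorProduct.map_tmul, LinearMap.comp_apply, LinearMap.comp_apply, evalAt_twist,
      evalAt_twist, TensorProduct.smul_tmul_smul]
    rfl
  have h3 : ∀ t u : A ⊗[k] (A ⊗[k] A), TensorProduct.map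
      (evalAt y ∘ₗ twist k A t) (evalAt z ∘ₗ twist k A u) s = auxEval g
        (auxTriple k A (Algebra.TensorProduct.includeLeft : A →ₐ[k] A ⊗[k] A).toLinearMap y t *
        auxTriple k A (Algebra.TensorProduct.includeRight : A →ₐ[k] A ⊗[k] A).toLinearMap z u) := by
    intro t u
    induction t with
    | zero => simp
    | add t t' ht ht' =>
      simp only [map_add, LinearMap.comp_add, TensorProduct.map_add_left,
        LinearMap.add_apply, add_mul, ht, ht']
    | tmul b t =>
      induction t with
      | zero => simp
      | add t t' ht ht' =>
        simp only [TensorProduct.tmul_add, map_add, LinearMap.comp_add,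
          TensorProduct.map_add_left, LinearMap.add_apply, add_mul, ht, ht']
      | tmul c d =>
        induction u with
        | zero => simp
        | add u u' hu hu' =>
          simp only [map_add, LinearMap.comp_add, TensorProduct.map_add_right,
            LinearMap.add_apply, mul_add, hu, hu']
        | tmul b' u =>
          induction u with
          | zero => simp
          | add u u' hu hu' =>
            simp only [TensorProduct.tmul_add, map_add, LinearMap.comp_add,
              TensorProduct.map_add_right, LinearMap.add_apply, mul_add, hu, hu']
          | tmul c' d' =>
            rw [h2, hs, auxTriple_tmul, auxTriple_tmul]
            have e : ∀ (v w : A) (p r : A ⊗[k] A), auxLeft k A v * auxRight k A p *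
                (auxLeft k A w * auxRight k A r) = auxLeft k A (w * v) * auxRight k A (p * r) := by
              intro v w p r
              rw [mul_assoc, ← mul_assoc (auxRight k A p), auxLeft_mul_comm,
                map_mul (auxRight k A), ← auxLeft_mul]
              simp only [mul_assoc]
            rw [e, auxEval_apply]
            simp
  rw [h1, auxConj_apply, auxConj_apply, ← h3, TensorProduct.map_comp]
  rfl

theorem comul_incl_mul_inclDual (a : A) (g : DualCop k A) :
    comul (R := k) (incl k A a * inclDual k A g) =
      comul (R := k) (incl k A a) * comul (R := k) (inclDual k A g) := by
  refine map_evalAt_injective fun y z => ?_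
  rw [map_evalAt_comul, incl_mul_inclDual, comul_evalAt_straighten, ← auxConj_mul_auxConj,
    (ℛ k a).convMul_apply, comul_incl, comul_inclDual, ← (ℛ k a).eq, map_sum, map_sum,
    Finset.sum_mul, map_sum]
  refine Finset.sum_congr rfl fun i _ => ?_
  exact (evalAt_straighten_tmul y z _ _ _ g (DualCop.pairing_comul g)).symm

theorem map_mul_of_incl {E : Type*} [Ring E] [Algebra k E] (φ : DrinfeldDouble k A →ₗ[k] E)
    (h1 : ∀ f a, φ (inclDual k A f * incl k A a) = φ (inclDual k A f) * φ (incl k A a))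
    (hU : ∀ f g, φ (inclDual k A (f * g)) = φ (inclDual k A f) * φ (inclDual k A g))
    (hA : ∀ a b, φ (incl k A (a * b)) = φ (incl k A a) * φ (incl k A b))
    (h2 : ∀ a f, φ (incl k A a * inclDual k A f) = φ (incl k A a) * φ (inclDual k A f))
    (v w : DrinfeldDouble k A) : φ (v * w) = φ v * φ w := by
  have h3 : ∀ f w, φ (inclDual k A f * w) = φ (inclDual k A f) * φ w := by
    intro f w
    refine LinearMap.congr_fun (f := φ ∘ₗ LinearMap.mulLeft k (inclDual k A f))
      (g := LinearMap.mulLeft k (φ (inclDual k A f)) ∘ₗ φ) (TensorProduct.ext' fun g b => ?_) w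
    change φ (inclDual k A f * tmul g b) = φ (inclDual k A f) * φ (tmul g b)
    rw [tmul_eq_mul, ← mul_assoc, ← map_mul, h1, h1, hU, mul_assoc]
  have h4 : ∀ w a, φ (w * incl k A a) = φ w * φ (incl k A a) := by
    intro w a
    refine LinearMap.congr_fun (f := φ ∘ₗ LinearMap.mulRight k (incl k A a))
      (g := LinearMap.mulRight k (φ (incl k A a)) ∘ₗ φ) (TensorProduct.ext' fun g b => ?_) w
    change φ (tmul g b * incl k A a) = φ (tmul g b) * φ (incl k A a)
    rw [tmul_eq_mul, mul_assoc, ← map_mul, h1, h1, hA, mul_assoc]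
  have h5 : ∀ (f : DualCop k A) (a : A) (g : DualCop k A) (b : A),
      φ (tmul f a * tmul g b) = φ (tmul f a) * φ (tmul g b) := by
    intro f a g b
    rw [tmul_eq_mul, tmul_eq_mul, mul_assoc, ← mul_assoc (incl k A a), h3, h4, h2, h1, h1]
    simp only [mul_assoc]
  refine LinearMap.congr_fun₂ (f := (LinearMap.mul k (DrinfeldDouble k A)).compr₂ φ)
    (g := (LinearMap.mul k E).compl₁₂ φ φ)
    (TensorProduct.ext' fun f a => TensorProduct.ext' fun g b => ?_) v w
  exact h5 f a g b

theorem comul_mul' (v w : DrinfeldDouble k A) :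
    comul (R := k) (v * w) = comul (R := k) v * comul (R := k) w := by
  have h1 : ∀ f a, comul (R := k) (inclDual k A f * incl k A a) =
      comul (R := k) (inclDual k A f) * comul (R := k) (incl k A a) := by
    intro f a
    rw [← tmul_eq_mul, comul_tmul, comul_inclDual, comul_incl]
  have hU : ∀ f g, comul (R := k) (inclDual k A (f * g)) =
      comul (R := k) (inclDual k A f) * comul (R := k) (inclDual k A g) := by
    intro f g
    rw [comul_inclDual, Bialgebra.comul_mul, map_mul, comul_inclDual, comul_inclDual]
  have hA : ∀ a b, comul (R := k) (incl k A (a * b)) =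
      comul (R := k) (incl k A a) * comul (R := k) (incl k A b) := by
    intro a b
    rw [comul_incl, Bialgebra.comul_mul, map_mul, comul_incl, comul_incl]
  exact map_mul_of_incl comul h1 hU hA comul_incl_mul_inclDual v w

theorem counit_tmul (f : DualCop k A) (a : A) :
    counit (R := k) (tmul f a) = f 1 * counit (R := k) a := by
  change counit (R := k) (f ⊗ₜ[k] a) = _
  rw [TensorProduct.counit_tmul, DualCop.counit_apply, smul_eq_mul, mul_comm]

theorem counit_inclDual (f : DualCop k A) : counit (R := k) (inclDual k A f) = f 1 :=
  (counit_tmul f 1).trans (by rw [Bialgebra.counit_one, mul_one])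

theorem counit_incl (a : A) : counit (R := k) (incl k A a) = counit (R := k) a :=
  (counit_tmul 1 a).trans (by rw [DualCop.one_apply, Bialgebra.counit_one, one_mul])

theorem counit_incl_mul_inclDual (a : A) (g : DualCop k A) :
    counit (R := k) (incl k A a * inclDual k A g) =
      counit (R := k) (incl k A a) * counit (R := k) (inclDual k A g) := by
  let p : A ⊗[k] A →ₗ[k] A := (TensorProduct.lid k A).toLinearMap ∘ₗ counit.rTensor A
  let μ : A ⊗[k] A →ₗ[k] A := LinearMap.mul' k A ∘ₗ (TensorProduct.comm k A A).toLinearMap ∘ₗ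
    (antipodeInv k A).lTensor A
  have h1 : ∀ t, counit (R := k) (twist k A t g) = g (μ (p.lTensor A t)) := by
    intro t
    refine LinearMap.congr_fun (f := counit ∘ₗ (twist k A).flip g)
      (g := DualCop.toDual k A g ∘ₗ μ ∘ₗ p.lTensor A) ?_ t
    refine TensorProduct.ext_threefold' fun b c d => ?_
    refine (counit_tmul _ _).trans ?_
    change g (antipodeInv k A d * (1 * b)) * counit (R := k) (c * 1) =
      g (antipodeInv k A (counit (R := k) c • d) * b)
    rw [mul_one, one_mul, map_smul, smul_mul_assoc, map_smul, smul_eq_mul, mul_comm]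
  have h2 : p.lTensor A ((comul (R := k)).lTensor A (comul (R := k) a)) = comul (R := k) a := by
    rw [← LinearMap.comp_apply, ← LinearMap.lTensor_comp]
    convert LinearMap.lTensor_id_apply A A (comul (R := k) a)
    ext b
    simp [p]
  have h3 : μ (comul (R := k) a) = algebraMap k A (counit (R := k) a) := by
    rw [← sum_antipodeInv_right_mul_left k (ℛ k a)]
    conv_lhs => rw [← (ℛ k a).eq]
    simp [μ]
  rw [incl_mul_inclDual', h1, h2, h3, Algebra.algebraMap_eq_smul_one, map_smul, smul_eq_mul,
    counit_incl, counit_inclDual]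

theorem counit_mul' (v w : DrinfeldDouble k A) :
    counit (R := k) (v * w) = counit (R := k) v * counit (R := k) w := by
  have h1 : ∀ f a, counit (R := k) (inclDual k A f * incl k A a) =
      counit (R := k) (inclDual k A f) * counit (R := k) (incl k A a) := by
    intro f a
    rw [← tmul_eq_mul, counit_tmul, counit_inclDual, counit_incl]
  have hU : ∀ f g, counit (R := k) (inclDual k A (f * g)) =
      counit (R := k) (inclDual k A f) * counit (R := k) (inclDual k A g) := by
    intro f g
    rw [counit_inclDual, ← DualCop.counit_apply, Bialgebra.counit_mul, counit_inclDual,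
      counit_inclDual, DualCop.counit_apply, DualCop.counit_apply]
  have hA : ∀ a b, counit (R := k) (incl k A (a * b)) =
      counit (R := k) (incl k A a) * counit (R := k) (incl k A b) := by
    intro a b
    rw [counit_incl, counit_incl, counit_incl, Bialgebra.counit_mul]
  exact map_mul_of_incl counit h1 hU hA counit_incl_mul_inclDual v w

instance : Bialgebra k (DrinfeldDouble k A) :=
  Bialgebra.mk' k (DrinfeldDouble k A)
    ((counit_tmul 1 1).trans (by simp))
    (fun {v w} => counit_mul' v w)
    ((comul_inclDual 1).trans (by rw [Bialgebra.comul_one, map_one]))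
    (fun {v w} => comul_mul' v w)

end DrinfeldComul

end DrinfeldDouble

section DoubleHopf

open Coalgebra LinearMap HopfAlgebra

variable {k : Type*} {A : Type*} [Field k] [Ring A] [HopfAlgebra k A] [HasBijectiveAntipode k A]

namespace DualCop

variable (k A) in
/-- The antipode `f ↦ f ∘ S⁻¹` of `(A^*)^cop`. -/
def antipodeMap : DualCop k A →ₗ[k] DualCop k A :=
  (toDual k A).symm.toLinearMap ∘ₗ (antipodeInv k A).dualMap ∘ₗ (toDual k A).toLinearMap

theorem antipodeMap_apply (f : DualCop k A) (a : A) :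
    antipodeMap k A f a = f (antipodeInv k A a) := rfl

variable [Module.Finite k A]

instance : HopfAlgebra k (DualCop k A) where
  antipode := antipodeMap k A
  mul_antipode_rTensor_comul := by
    ext f a
    have h : ∀ s : DualCop k A ⊗[k] DualCop k A,
        (LinearMap.mul' k (DualCop k A) ((antipodeMap k A).rTensor _ s)) a =
        ∑ i ∈ (ℛ k a).index,
          pairing k A s (antipodeInv k A ((ℛ k a).left i) ⊗ₜ (ℛ k a).right i) := by
      intro s
      induction s with
      | zero => simp
      | add s t hs ht => simp only [map_add, LinearMap.add_apply, hs, ht, Finset.sum_add_distrib]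
      | tmul f g => simp [mul_apply (antipodeMap k A f) g (ℛ k a), antipodeMap_apply]
    refine (h (comul f)).trans ?_
    simp only [pairing_comul, ← map_sum]
    rw [sum_right_mul_antipodeInv_left]
    simp [Algebra.algebraMap_eq_smul_one, counit_apply, mul_comm]
  mul_antipode_lTensor_comul := by
    ext f a
    have h : ∀ s : DualCop k A ⊗[k] DualCop k A,
        (LinearMap.mul' k (DualCop k A) ((antipodeMap k A).lTensor _ s)) a =
        ∑ i ∈ (ℛ k a).index,
          pairing k A s ((ℛ k a).left i ⊗ₜ antipodeInv k A ((ℛ k a).right i)) := by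
      intro s
      induction s with
      | zero => simp
      | add s t hs ht => simp only [map_add, LinearMap.add_apply, hs, ht, Finset.sum_add_distrib]
      | tmul f g => simp [mul_apply f (antipodeMap k A g) (ℛ k a), antipodeMap_apply]
    refine (h (comul f)).trans ?_
    simp only [pairing_comul, ← map_sum]
    rw [sum_antipodeInv_right_mul_left]
    simp [Algebra.algebraMap_eq_smul_one, counit_apply, mul_comm]

end DualCop

namespace DrinfeldDouble

variable [Module.Finite k A]

variable (k A) in
/-- The antipode `f ⊗ a ↦ S(a) S(f)` of the Drinfeld double. -/
def antipodeMap : DrinfeldDouble k A →ₗ[k] DrinfeldDouble k A :=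
  TensorProduct.lift ((LinearMap.mul k (DrinfeldDouble k A)).flip.compl₁₂
    ((inclDual k A).toLinearMap ∘ₗ antipode k) ((incl k A).toLinearMap ∘ₗ antipode k))

theorem antipodeMap_tmul (f : DualCop k A) (a : A) : antipodeMap k A (tmul f a) =
    incl k A (antipode k a) * inclDual k A (antipode k f) := rfl

theorem comul_tmul_eq_sum (f : DualCop k A) (a : A) : comul (R := k) (tmul f a) =
    ∑ j ∈ (ℛ k a).index, ∑ i ∈ (ℛ k f).index, tmul ((ℛ k f).left i) ((ℛ k a).left j) ⊗ₜ
      tmul ((ℛ k f).right i) ((ℛ k a).right j) := by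
  rw [comul_tmul_eq_shuffle]
  conv_lhs => rw [← (ℛ k a).eq, ← (ℛ k f).eq]
  rw [TensorProduct.tmul_sum, map_sum]
  refine Finset.sum_congr rfl fun j _ => ?_
  rw [TensorProduct.sum_tmul, map_sum]
  rfl

instance : HopfAlgebra k (DrinfeldDouble k A) where
  antipode := antipodeMap k A
  mul_antipode_rTensor_comul := by
    refine TensorProduct.ext' fun f a => ?_
    change LinearMap.mul' k _ ((antipodeMap k A).rTensor _ (comul (R := k) (tmul f a))) =
      algebraMap k _ (counit (R := k) (tmul f a))
    have h : ∀ j, ∑ i ∈ (ℛ k f).index, antipodeMap k A (tmul ((ℛ k f).left i) ((ℛ k a).left j)) *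
        tmul ((ℛ k f).right i) ((ℛ k a).right j) = counit (R := k) f •
          incl k A (antipode k ((ℛ k a).left j) * (ℛ k a).right j) := by
      intro j
      have e : ∀ i, antipodeMap k A (tmul ((ℛ k f).left i) ((ℛ k a).left j)) *
          tmul ((ℛ k f).right i) ((ℛ k a).right j) = incl k A (antipode k ((ℛ k a).left j)) *
            inclDual k A (antipode k ((ℛ k f).left i) * (ℛ k f).right i) *
            incl k A ((ℛ k a).right j) := by
        intro i
        rw [antipodeMap_tmul, tmul_eq_mul, map_mul]
        simp only [mul_assoc]
      simp only [e]
      rw [← Finset.sum_mul, ← Finset.mul_sum, ← map_sum,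
        sum_antipode_mul_eq_algebraMap_counit (ℛ k f), AlgHom.commutes, ← Algebra.commutes,
        mul_assoc, ← map_mul, ← Algebra.smul_def]
    rw [comul_tmul_eq_sum, map_sum, map_sum]
    simp only [map_sum, LinearMap.rTensor_tmul, LinearMap.mul'_apply, h]
    rw [← Finset.smul_sum, ← map_sum, sum_antipode_mul_eq_algebraMap_counit (ℛ k a),
      AlgHom.commutes, counit_tmul, DualCop.counit_apply, map_mul, Algebra.smul_def]
  mul_antipode_lTensor_comul := by
    refine TensorProduct.ext' fun f a => ?_
    change LinearMap.mul' k _ ((antipodeMap k A).lTensor _ (comul (R := k) (tmul f a))) =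
      algebraMap k _ (counit (R := k) (tmul f a))
    have h : ∀ i, ∑ j ∈ (ℛ k a).index, tmul ((ℛ k f).left i) ((ℛ k a).left j) *
        antipodeMap k A (tmul ((ℛ k f).right i) ((ℛ k a).right j)) = counit (R := k) a •
          inclDual k A ((ℛ k f).left i * antipode k ((ℛ k f).right i)) := by
      intro i
      have e : ∀ j, tmul ((ℛ k f).left i) ((ℛ k a).left j) *
          antipodeMap k A (tmul ((ℛ k f).right i) ((ℛ k a).right j)) =
            inclDual k A ((ℛ k f).left i) * incl k A ((ℛ k a).left j *
              antipode k ((ℛ k a).right j)) * inclDual k A (antipode k ((ℛ k f).right i)) := by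
        intro j
        rw [antipodeMap_tmul, tmul_eq_mul, map_mul]
        simp only [mul_assoc]
      simp only [e]
      rw [← Finset.sum_mul, ← Finset.mul_sum, ← map_sum,
        sum_mul_antipode_eq_algebraMap_counit (ℛ k a), AlgHom.commutes, ← Algebra.commutes,
        mul_assoc, ← map_mul, ← Algebra.smul_def]
    rw [comul_tmul_eq_sum, Finset.sum_comm, map_sum, map_sum]
    simp only [map_sum, LinearMap.lTensor_tmul, LinearMap.mul'_apply, h]
    rw [← Finset.smul_sum, ← map_sum, sum_mul_antipode_eq_algebraMap_counit (ℛ k f),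
      AlgHom.commutes, counit_tmul, DualCop.counit_apply, map_mul, Algebra.smul_def,
      Algebra.commutes]

end DrinfeldDouble

end DoubleHopf

end TaftDouble

end

/-!
Skew primitive elements of the dual of a Hopf algebra are its `(γ, ε)`-skew derivations. For
`T_{n,m}^σ(qb, q)`, modulo the inner ones `c (γ - ε)`, they are supported on `x` or on `X`, and
their character `γ` sends `(h, H)` to `(q⁻¹, σ⁻¹)` in the first case and to `(σ, qb⁻¹)` in the
second. An isomorphism transports such a `γ` together with the `(h, 1)`-primitive element `x`,
so it either fixes `(q, σ)` or exchanges the two Taft algebras, which requires `qb = q` and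
inverts `σ`.

The algebras of type `Q` are distinguished by having fewer characters: the relation
`x X - q X x = α (1 - H h)` forces `γ(H) = γ(h)⁻¹`.

The dual of the Taft algebra is generated by the character `h ↦ q⁻¹` and the skew derivation
`x ↦ 1`, since the pairing of their monomials with `h ^ i x ^ j` is a Vandermonde matrix up to
nonzero `q`-factorials. In the double these satisfy, together with `h` and `x`, the relations of
`Q_n^{-q}(q)`. The resulting surjection onto the double is bijective because the triangular
decomposition gives `dim Q_n^{-q}(q) ≤ n ^ 4`.
-/

noncomputable section

namespace TaftDouble

section Matrix

theorem diagonal_one_pow {R : Type*} [CommRing R] (u : R) (r : ℕ) :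
    !![u, 0; 0, 1] ^ r = !![u ^ r, 0; 0, 1] := by
  induction r with
  | zero => simp [Matrix.one_fin_two]
  | succ r ih => simp [pow_succ, ih]

theorem strictlyUpperTriangular_pow {R : Type*} [CommRing R] (a : R) {r : ℕ} (hr : 2 ≤ r) :
    !![0, a; 0, 0] ^ r = 0 := by
  refine pow_eq_zero_of_le hr ?_
  simp [pow_two, ← Matrix.ext_iff, Fin.forall_fin_two]

end Matrix

section SkewDerivations

variable {k A : Type*} [CommRing k] [Ring A] [Algebra k A]

/-- An `(a, b)`-skew derivation, for two characters `a` and `b` of `A`: a linear form `D` with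
`D(x y) = a(x) D(y) + D(x) b(y)`. These are the skew primitive elements of the dual of `A`. -/
structure IsSkewDerivation (a b : A →ₐ[k] k) (D : A →ₗ[k] k) : Prop where
  map_mul : ∀ x y, D (x * y) = a x * D y + D x * b y

namespace IsSkewDerivation

variable {a b : A →ₐ[k] k} {D E : A →ₗ[k] k}

theorem map_one (hD : IsSkewDerivation a b D) : D 1 = 0 := by
  simpa using hD.map_mul 1 1

theorem sub (hD : IsSkewDerivation a b D) (hE : IsSkewDerivation a b E) :
    IsSkewDerivation a b (D - E) where
  map_mul x y := by simp only [LinearMap.sub_apply, hD.map_mul, hE.map_mul]; ring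

theorem smul (c : k) (hD : IsSkewDerivation a b D) : IsSkewDerivation a b (c • D) where
  map_mul x y := by simp only [LinearMap.smul_apply, smul_eq_mul, hD.map_mul]; ring

theorem sub_algHom (a b : A →ₐ[k] k) :
    IsSkewDerivation a b (a.toLinearMap - b.toLinearMap) where
  map_mul x y := by simp; ring

theorem comp {B : Type*} [Ring B] [Algebra k B] (hD : IsSkewDerivation a b D) (φ : B →ₐ[k] A) :
    IsSkewDerivation (a.comp φ) (b.comp φ) (D ∘ₗ φ.toLinearMap) where
  map_mul x y := by simp [hD.map_mul]

theorem eq_zero (hD : IsSkewDerivation a b D) {s : Set A} (hs : Algebra.adjoin k s = ⊤)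
    (h0 : ∀ x ∈ s, D x = 0) : D = 0 := by
  ext x
  have hx : x ∈ Algebra.adjoin k s := hs ▸ Algebra.mem_top
  induction hx using Algebra.adjoin_induction with
  | mem x hx => exact h0 x hx
  | algebraMap r => rw [Algebra.algebraMap_eq_smul_one, map_smul, hD.map_one]; simp
  | add x y _ _ hx hy => rw [map_add, hx, hy]; simp
  | mul x y _ _ hx hy => rw [hD.map_mul, hx, hy]; simp

theorem of_upperTriangular (ρ : A →ₐ[k] Matrix (Fin 2) (Fin 2) k) {s : Set A}
    (hs : Algebra.adjoin k s = ⊤) (hρ : ∀ x ∈ s, ∃ c, ρ x = !![a x, c; 0, b x]) :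
    IsSkewDerivation a b (Matrix.entryLinearMap k k 0 1 ∘ₗ ρ.toLinearMap) := by
  have key (x : A) : ∃ c, ρ x = !![a x, c; 0, b x] := by
    have hx : x ∈ Algebra.adjoin k s := hs ▸ Algebra.mem_top
    induction hx using Algebra.adjoin_induction with
    | mem x hx => exact hρ x hx
    | algebraMap r =>
      refine ⟨0, ?_⟩
      ext i j
      fin_cases i <;> fin_cases j <;> simp [Matrix.algebraMap_matrix_apply]
    | add x y _ _ hx hy =>
      obtain ⟨c, hc⟩ := hx
      obtain ⟨d, hd⟩ := hy
      exact ⟨c + d, by simp [hc, hd]⟩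
    | mul x y _ _ hx hy =>
      obtain ⟨c, hc⟩ := hx
      obtain ⟨d, hd⟩ := hy
      exact ⟨a x * d + c * b y, by simp [hc, hd]⟩
  refine ⟨fun x y => ?_⟩
  obtain ⟨c, hc⟩ := key x
  obtain ⟨d, hd⟩ := key y
  simp [hc, hd]

end IsSkewDerivation

end SkewDerivations

section SkewPrimitive

open Coalgebra

variable {R A B : Type*} [CommSemiring R] [Semiring A] [Semiring B] [Bialgebra R A] [Bialgebra R B]

variable (R) in
/-- The element `y` is `(g, 1)`-primitive; `g` is not required to be group-like. -/
structure IsSkewPrimitive (g y : A) : Prop where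
  comul_eq : comul (R := R) y = y ⊗ₜ g + 1 ⊗ₜ y

namespace IsSkewPrimitive

variable {g y : A}

theorem smul (hy : IsSkewPrimitive R g y) (c : R) : IsSkewPrimitive R g (c • y) where
  comul_eq := by
    rw [map_smul, hy.comul_eq, smul_add, TensorProduct.smul_tmul', TensorProduct.tmul_smul]

theorem map (hy : IsSkewPrimitive R g y) (f : A →ₐc[R] B) : IsSkewPrimitive R (f g) (f y) where
  comul_eq := by
    rw [← CoalgHomClass.map_comp_comul_apply, hy.comul_eq]
    simp

end IsSkewPrimitive

theorem IsSkewPrimitive.counit_eq_zero {R A : Type*} [CommRing R] [Ring A] [Bialgebra R A]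
    {g y : A} (hy : IsSkewPrimitive R g y) (hg : IsGroupLikeElem R g) :
    counit (R := R) y = 0 := by
  have h := congrArg (TensorProduct.rid R A) (lTensor_counit_comul (R := R) y)
  simp only [hy.comul_eq, map_add, LinearMap.lTensor_tmul, TensorProduct.rid_tmul,
    hg.counit_eq_one, one_smul, add_eq_left] at h
  simpa using congrArg (counit (R := R)) h

end SkewPrimitive

section Winding

variable {R A : Type*} [CommSemiring R] [Semiring A] [Bialgebra R A] (γ : A →ₐ[R] R) {g y : A}

/-- The right winding endomorphism `a ↦ a₍₁₎ γ(a₍₂₎)` of a character `γ`. -/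
def rightWinding : A →ₐ[R] A :=
  ((Algebra.TensorProduct.rid R R A).toAlgHom.comp
    (Algebra.TensorProduct.map (AlgHom.id R A) γ)).comp (Bialgebra.comulAlgHom R A)

/-- The left winding endomorphism `a ↦ γ(a₍₁₎) a₍₂₎` of a character `γ`. -/
def leftWinding : A →ₐ[R] A :=
  ((Algebra.TensorProduct.lid R A).toAlgHom.comp
    (Algebra.TensorProduct.map γ (AlgHom.id R A))).comp (Bialgebra.comulAlgHom R A)

theorem rightWinding_of_isGroupLikeElem (hg : IsGroupLikeElem R g) :
    rightWinding γ g = γ g • g := by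
  simp [rightWinding, hg.comul_eq_tmul_self]

theorem leftWinding_of_isGroupLikeElem (hg : IsGroupLikeElem R g) :
    leftWinding γ g = γ g • g := by
  simp [leftWinding, hg.comul_eq_tmul_self]

theorem rightWinding_of_isSkewPrimitive (hy : IsSkewPrimitive R g y) (hγ : γ y = 0) :
    rightWinding γ y = γ g • y := by
  simp [rightWinding, hy.comul_eq, hγ]

theorem leftWinding_of_isSkewPrimitive (hy : IsSkewPrimitive R g y) (hγ : γ y = 0) :
    leftWinding γ y = y := by
  simp [leftWinding, hy.comul_eq, hγ]

end Winding

section RootsOfUnity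

variable {k : Type*} [Field k] {r : ℕ} {ζ : k}

theorem pow_eq_one_of_mem_primitiveRoots (hζ : ζ ∈ primitiveRoots r k) : ζ ^ r = 1 :=
  (isPrimitiveRoot_of_mem_primitiveRoots hζ).pow_eq_one

theorem inv_pow_eq_one_of_mem_primitiveRoots (hζ : ζ ∈ primitiveRoots r k) : ζ⁻¹ ^ r = 1 := by
  rw [inv_pow, pow_eq_one_of_mem_primitiveRoots hζ, inv_one]

theorem ne_zero_of_mem_primitiveRoots (hζ : ζ ∈ primitiveRoots r k) : ζ ≠ 0 :=
  (isPrimitiveRoot_of_mem_primitiveRoots hζ).ne_zero (pos_of_mem_primitiveRoots hζ).ne'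

theorem ne_one_of_mem_primitiveRoots (hr : 2 ≤ r) (hζ : ζ ∈ primitiveRoots r k) : ζ ≠ 1 :=
  (isPrimitiveRoot_of_mem_primitiveRoots hζ).ne_one hr

end RootsOfUnity

namespace PairAlgebra

variable {k : Type*} [Field k] {m n : ℕ} {q qb : k} {hqb : qb ∈ primitiveRoots n k}
  {hq : q ∈ primitiveRoots m k} {σ σ' α α' : k}

section Generators

variable (hqb hq σ α)

theorem isGroupLikeElem_h : IsGroupLikeElem k (gen hqb hq σ α .h) :=
  ⟨counit_h .., comul_h ..⟩

theorem isGroupLikeElem_H : IsGroupLikeElem k (gen hqb hq σ α .H) :=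
  ⟨counit_H .., comul_H ..⟩

theorem isSkewPrimitive_x : IsSkewPrimitive k (gen hqb hq σ α .h) (gen hqb hq σ α .x) :=
  ⟨comul_x ..⟩

theorem isSkewPrimitive_X : IsSkewPrimitive k (gen hqb hq σ α .H) (gen hqb hq σ α .X) :=
  ⟨comul_X ..⟩

theorem isNilpotent_x : IsNilpotent (gen hqb hq σ α .x) :=
  ⟨m, (isPair hqb hq σ α).x_pow⟩

theorem isNilpotent_X : IsNilpotent (gen hqb hq σ α .X) :=
  ⟨n, (isPair hqb hq σ α).X_pow⟩

end Generators

section Characters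

variable {γ δ χ : PairAlgebra hqb hq σ α →ₐ[k] k}

theorem algHom_x (γ : PairAlgebra hqb hq σ α →ₐ[k] k) : γ (gen hqb hq σ α .x) = 0 :=
  ((isNilpotent_x hqb hq σ α).map γ).eq_zero

theorem algHom_X (γ : PairAlgebra hqb hq σ α →ₐ[k] k) : γ (gen hqb hq σ α .X) = 0 :=
  ((isNilpotent_X hqb hq σ α).map γ).eq_zero

theorem algHom_h_pow (γ : PairAlgebra hqb hq σ α →ₐ[k] k) : γ (gen hqb hq σ α .h) ^ m = 1 := by
  rw [← map_pow, (isPair hqb hq σ α).h_pow, map_one]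

theorem algHom_H_pow (γ : PairAlgebra hqb hq σ α →ₐ[k] k) : γ (gen hqb hq σ α .H) ^ n = 1 := by
  rw [← map_pow, (isPair hqb hq σ α).H_pow, map_one]

theorem mul_one_sub_algHom_H_mul_h (γ : PairAlgebra hqb hq σ α →ₐ[k] k) :
    α * (1 - γ (gen hqb hq σ α .H) * γ (gen hqb hq σ α .h)) = 0 := by
  simpa [algHom_x γ, algHom_X γ] using (congrArg γ (isPair hqb hq σ α).x_X).symm

theorem character_ext (hh : γ (gen hqb hq σ α .h) = δ (gen hqb hq σ α .h))
    (hH : γ (gen hqb hq σ α .H) = δ (gen hqb hq σ α .H)) : γ = δ := by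
  refine algHom_ext ?_
  rintro (_ | _ | _ | _)
  · exact hh
  · rw [algHom_x, algHom_x]
  · exact hH
  · rw [algHom_X, algHom_X]

theorem comp_leftWinding_eq (γ δ : PairAlgebra hqb hq σ α →ₐ[k] k) :
    δ.comp (leftWinding γ) = δ.comp (rightWinding γ) := by
  refine character_ext ?_ ?_ <;> simp only [AlgHom.comp_apply]
  · rw [leftWinding_of_isGroupLikeElem γ (isGroupLikeElem_h ..),
      rightWinding_of_isGroupLikeElem γ (isGroupLikeElem_h ..)]
  · rw [leftWinding_of_isGroupLikeElem γ (isGroupLikeElem_H ..),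
      rightWinding_of_isGroupLikeElem γ (isGroupLikeElem_H ..)]

end Characters

section SkewDerivation

variable {γ : PairAlgebra hqb hq σ α →ₐ[k] k} {D : PairAlgebra hqb hq σ α →ₗ[k] k}

theorem skewDerivation_eq_zero {δ : PairAlgebra hqb hq σ α →ₐ[k] k}
    (hD : IsSkewDerivation γ δ D) (hh : D (gen hqb hq σ α .h) = 0)
    (hx : D (gen hqb hq σ α .x) = 0) (hH : D (gen hqb hq σ α .H) = 0)
    (hX : D (gen hqb hq σ α .X) = 0) : D = 0 := by
  refine hD.eq_zero (adjoin_eq_top hqb hq σ α) ?_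
  rintro _ ⟨_ | _ | _ | _, rfl⟩
  exacts [hh, hx, hH, hX]

/-- `(a, b)` is the pair of values at `(x, X)` of a `(γ, ε)`-skew derivation: these are the
conditions imposed by the relations between `x`, `X` on one side and `h`, `H` on the other. -/
structure IsSkewDatum (γ : PairAlgebra hqb hq σ α →ₐ[k] k) (a b : k) : Prop where
  x_h : q * γ (gen hqb hq σ α .h) * a = a
  x_H : σ * γ (gen hqb hq σ α .H) * a = a
  h_X : γ (gen hqb hq σ α .h) * b = σ * b
  X_H : qb * γ (gen hqb hq σ α .H) * b = b

theorem isSkewDatum (hD : IsSkewDerivation γ (Bialgebra.counitAlgHom k _) D) :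
    IsSkewDatum γ (D (gen hqb hq σ α .x)) (D (gen hqb hq σ α .X)) := by
  have r := isPair hqb hq σ α
  have hx := congrArg D r.x_h
  have hxH := congrArg D r.x_H
  have hX := congrArg D r.h_X
  have hXH := congrArg D r.X_H
  simp only [hD.map_mul, map_smul, smul_eq_mul, algHom_x, algHom_X, zero_mul, zero_add, add_zero,
    Bialgebra.counitAlgHom_apply, counit_h, counit_x, counit_H, counit_X, mul_one, mul_zero]
    at hx hxH hX hXH
  exact ⟨by rw [mul_assoc, ← hx], by rw [mul_assoc, ← hxH], hX, by rw [mul_assoc, ← hXH]⟩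

theorem exists_eq_mul_algHom_sub_one (hD : IsSkewDerivation γ (Bialgebra.counitAlgHom k _) D)
    (hγ : γ ≠ Bialgebra.counitAlgHom k _) :
    ∃ c, D (gen hqb hq σ α .h) = c * (γ (gen hqb hq σ α .h) - 1) ∧
      D (gen hqb hq σ α .H) = c * (γ (gen hqb hq σ α .H) - 1) := by
  have hcomm := congrArg D (isPair hqb hq σ α).h_H
  simp only [hD.map_mul, Bialgebra.counitAlgHom_apply, counit_h, counit_H, mul_one] at hcomm
  by_cases hh : γ (gen hqb hq σ α .h) = 1
  · have hH : γ (gen hqb hq σ α .H) - 1 ≠ 0 := fun hH =>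
      hγ (character_ext (by simp [hh]) (by simpa using sub_eq_zero.1 hH))
    refine ⟨D (gen hqb hq σ α .H) / (γ (gen hqb hq σ α .H) - 1), ?_, by field_simp⟩
    rw [hh] at hcomm ⊢
    have : (γ (gen hqb hq σ α .H) - 1) * D (gen hqb hq σ α .h) = 0 := by linear_combination -hcomm
    simpa [hH] using this
  · have hh' : γ (gen hqb hq σ α .h) - 1 ≠ 0 := sub_ne_zero.2 hh
    refine ⟨D (gen hqb hq σ α .h) / (γ (gen hqb hq σ α .h) - 1), by field_simp, ?_⟩
    field_simp
    linear_combination hcomm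

theorem IsSkewDatum.left {a b : k} (hab : IsSkewDatum γ a b) : IsSkewDatum γ a 0 :=
  ⟨hab.x_h, hab.x_H, by simp, by simp⟩

theorem IsSkewDatum.right {a b : k} (hab : IsSkewDatum γ a b) : IsSkewDatum γ 0 b :=
  ⟨by simp, by simp, hab.h_X, hab.X_H⟩

theorem IsSkewDatum.isPair (hm : 2 ≤ m) (hn : 2 ≤ n) {a b : k} (hab : IsSkewDatum γ a b) :
    IsPair m n qb q σ α !![γ (gen hqb hq σ α .h), 0; 0, 1] !![0, a; 0, 0]
      !![γ (gen hqb hq σ α .H), 0; 0, 1] !![0, b; 0, 0] where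
  h_pow := by rw [diagonal_one_pow, algHom_h_pow, Matrix.one_fin_two]
  x_pow := strictlyUpperTriangular_pow a hm
  H_pow := by rw [diagonal_one_pow, algHom_H_pow, Matrix.one_fin_two]
  X_pow := strictlyUpperTriangular_pow b hn
  x_h := by ext i j; fin_cases i <;> fin_cases j <;> simp [← mul_assoc, hab.x_h]
  X_H := by ext i j; fin_cases i <;> fin_cases j <;> simp [← mul_assoc, hab.X_H]
  h_H := by simp [mul_comm]
  x_H := by ext i j; fin_cases i <;> fin_cases j <;> simp [← mul_assoc, hab.x_H]
  h_X := by simp [hab.h_X]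
  x_X := by simp [Matrix.one_fin_two, mul_one_sub_algHom_H_mul_h γ]

theorem IsSkewDatum.exists_isSkewDerivation (hm : 2 ≤ m) (hn : 2 ≤ n) {a b : k}
    (hab : IsSkewDatum γ a b) :
    ∃ D, IsSkewDerivation γ (Bialgebra.counitAlgHom k _) D ∧ D (gen hqb hq σ α .h) = 0 ∧
      D (gen hqb hq σ α .x) = a ∧ D (gen hqb hq σ α .H) = 0 ∧ D (gen hqb hq σ α .X) = b := by
  refine ⟨_, .of_upperTriangular (lift hqb hq (hab.isPair hm hn)) (adjoin_eq_top hqb hq σ α) ?_,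
    ?_, ?_, ?_, ?_⟩
  · rintro _ ⟨_ | _ | _ | _, rfl⟩ <;> simp [genMap, algHom_x, algHom_X]
  all_goals simp [genMap]

theorem apply_rightWinding (hD : IsSkewDerivation γ (Bialgebra.counitAlgHom k _) D)
    (hh : D (gen hqb hq σ α .h) = 0) (hH : D (gen hqb hq σ α .H) = 0)
    (χ : PairAlgebra hqb hq σ α →ₐ[k] k) {c : k}
    (hx : χ (gen hqb hq σ α .h) * D (gen hqb hq σ α .x) = c * D (gen hqb hq σ α .x))
    (hX : χ (gen hqb hq σ α .H) * D (gen hqb hq σ α .X) = c * D (gen hqb hq σ α .X))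
    (y : PairAlgebra hqb hq σ α) : D (rightWinding χ y) = c * D (leftWinding χ y) := by
  have hR := hD.comp (rightWinding χ)
  have hL := (hD.comp (leftWinding χ)).smul c
  rw [comp_leftWinding_eq, comp_leftWinding_eq] at hL
  refine sub_eq_zero.1 (LinearMap.congr_fun (skewDerivation_eq_zero (hR.sub hL) ?_ ?_ ?_ ?_) y)
  · simp [leftWinding_of_isGroupLikeElem χ (isGroupLikeElem_h ..),
      rightWinding_of_isGroupLikeElem χ (isGroupLikeElem_h ..), hh]
  · simp [leftWinding_of_isSkewPrimitive χ (isSkewPrimitive_x ..) (algHom_x χ),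
      rightWinding_of_isSkewPrimitive χ (isSkewPrimitive_x ..) (algHom_x χ), hx]
  · simp [leftWinding_of_isGroupLikeElem χ (isGroupLikeElem_H ..),
      rightWinding_of_isGroupLikeElem χ (isGroupLikeElem_H ..), hH]
  · simp [leftWinding_of_isSkewPrimitive χ (isSkewPrimitive_X ..) (algHom_X χ),
      rightWinding_of_isSkewPrimitive χ (isSkewPrimitive_X ..) (algHom_X χ), hX]

theorem algHom_eq_of_isSkewPrimitive (hD : IsSkewDerivation γ (Bialgebra.counitAlgHom k _) D)
    (hh : D (gen hqb hq σ α .h) = 0) (hH : D (gen hqb hq σ α .H) = 0)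
    {g y : PairAlgebra hqb hq σ α} (hy : IsSkewPrimitive k g y) (hnil : IsNilpotent y)
    (hDy : D y ≠ 0) (χ : PairAlgebra hqb hq σ α →ₐ[k] k) {c : k}
    (hx : χ (gen hqb hq σ α .h) * D (gen hqb hq σ α .x) = c * D (gen hqb hq σ α .x))
    (hX : χ (gen hqb hq σ α .H) * D (gen hqb hq σ α .X) = c * D (gen hqb hq σ α .X)) :
    χ g = c := by
  have hχy : χ y = 0 := (hnil.map χ).eq_zero
  have key := apply_rightWinding hD hh hH χ hx hX y
  rw [rightWinding_of_isSkewPrimitive χ hy hχy, leftWinding_of_isSkewPrimitive χ hy hχy, map_smul,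
    smul_eq_mul] at key
  exact mul_right_cancel₀ hDy key

theorem algHom_eq_of_apply_X_eq_zero (hD : IsSkewDerivation γ (Bialgebra.counitAlgHom k _) D)
    (hh : D (gen hqb hq σ α .h) = 0) (hH : D (gen hqb hq σ α .H) = 0)
    (hX : D (gen hqb hq σ α .X) = 0) {g y : PairAlgebra hqb hq σ α} (hy : IsSkewPrimitive k g y)
    (hnil : IsNilpotent y) (hDy : D y ≠ 0) :
    γ (gen hqb hq σ α .h) = q⁻¹ ∧ γ (gen hqb hq σ α .H) = σ⁻¹ ∧
      ∀ χ : PairAlgebra hqb hq σ α →ₐ[k] k, χ g = χ (gen hqb hq σ α .h) := by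
  have hx : D (gen hqb hq σ α .x) ≠ 0 := fun hx =>
    hDy (by rw [skewDerivation_eq_zero hD hh hx hH hX, LinearMap.zero_apply])
  refine ⟨eq_inv_of_mul_eq_one_right (mul_right_cancel₀ hx ?_),
    eq_inv_of_mul_eq_one_right (mul_right_cancel₀ hx ?_),
    fun χ => algHom_eq_of_isSkewPrimitive hD hh hH hy hnil hDy χ rfl (by simp [hX])⟩
  · rw [(isSkewDatum hD).x_h, one_mul]
  · rw [(isSkewDatum hD).x_H, one_mul]

theorem algHom_eq_of_apply_x_eq_zero (hD : IsSkewDerivation γ (Bialgebra.counitAlgHom k _) D)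
    (hh : D (gen hqb hq σ α .h) = 0) (hx : D (gen hqb hq σ α .x) = 0)
    (hH : D (gen hqb hq σ α .H) = 0) {g y : PairAlgebra hqb hq σ α} (hy : IsSkewPrimitive k g y)
    (hnil : IsNilpotent y) (hDy : D y ≠ 0) :
    γ (gen hqb hq σ α .h) = σ ∧ γ (gen hqb hq σ α .H) = qb⁻¹ ∧
      ∀ χ : PairAlgebra hqb hq σ α →ₐ[k] k, χ g = χ (gen hqb hq σ α .H) := by
  have hX : D (gen hqb hq σ α .X) ≠ 0 := fun hX =>
    hDy (by rw [skewDerivation_eq_zero hD hh hx hH hX, LinearMap.zero_apply])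
  refine ⟨mul_right_cancel₀ hX (isSkewDatum hD).h_X,
    eq_inv_of_mul_eq_one_right (mul_right_cancel₀ hX ?_),
    fun χ => algHom_eq_of_isSkewPrimitive hD hh hH hy hnil hDy χ (by simp [hx]) rfl⟩
  rw [(isSkewDatum hD).X_H, one_mul]

theorem algHom_eq_or_of_isSkewPrimitive (hm : 2 ≤ m) (hn : 2 ≤ n)
    (hD : IsSkewDerivation γ (Bialgebra.counitAlgHom k _) D)
    (hγ : γ ≠ Bialgebra.counitAlgHom k _) {g y : PairAlgebra hqb hq σ α}
    (hy : IsSkewPrimitive k g y) (hg : IsGroupLikeElem k g) (hnil : IsNilpotent y)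
    (hDy : D y ≠ 0) :
    (γ (gen hqb hq σ α .h) = q⁻¹ ∧ γ (gen hqb hq σ α .H) = σ⁻¹ ∧
      ∀ χ : PairAlgebra hqb hq σ α →ₐ[k] k, χ g = χ (gen hqb hq σ α .h)) ∨
    (γ (gen hqb hq σ α .h) = σ ∧ γ (gen hqb hq σ α .H) = qb⁻¹ ∧
      ∀ χ : PairAlgebra hqb hq σ α →ₐ[k] k, χ g = χ (gen hqb hq σ α .H)) := by
  -- Modulo the inner skew derivation `c (γ - ε)`, `D` is the sum of `E` supported on `x` and `F`
  -- supported on `X`, and `γ - ε` vanishes on `y`.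
  obtain ⟨c, hch, hcH⟩ := exists_eq_mul_algHom_sub_one hD hγ
  obtain ⟨E, hE, hEh, hEx, hEH, hEX⟩ := (isSkewDatum hD).left.exists_isSkewDerivation hm hn
  obtain ⟨F, hF, hFh, hFx, hFH, hFX⟩ := (isSkewDatum hD).right.exists_isSkewDerivation hm hn
  have hsum : D - c • (γ.toLinearMap - (Bialgebra.counitAlgHom k _).toLinearMap) - E - F = 0 := by
    refine skewDerivation_eq_zero (((hD.sub ((IsSkewDerivation.sub_algHom γ _).smul c)).sub hE).sub
      hF) ?_ ?_ ?_ ?_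
    · simp [hch, hEh, hFh]
    · simp [hEx, hFx, algHom_x]
    · simp [hcH, hEH, hFH]
    · simp [hEX, hFX, algHom_X]
  by_cases hEy : E y = 0
  · refine .inr (algHom_eq_of_apply_x_eq_zero hF hFh hFx hFH hy hnil fun hFy => hDy ?_)
    simpa [hEy, hFy, (hnil.map γ).eq_zero, hy.counit_eq_zero hg] using LinearMap.congr_fun hsum y
  · exact .inl (algHom_eq_of_apply_X_eq_zero hE hEh hEH hEX hy hnil hEy)

end SkewDerivation

section BialgHom

variable {B : Type*} [Ring B] [Bialgebra k B]

theorem bialgHom_ext {f g : PairAlgebra hqb hq σ α →ₐc[k] B}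
    (hfg : ∀ i, f (gen hqb hq σ α i) = g (gen hqb hq σ α i)) : f = g :=
  BialgHom.coe_toAlgHom_injective (algHom_ext hfg)

variable (hqb hq) in
/-- The universal property of `PairAlgebra` among bialgebras. -/
def liftBialgHom {a b c d : B} (hr : IsPair m n qb q σ α a b c d) (ha : IsGroupLikeElem k a)
    (hb : IsSkewPrimitive k a b) (hc : IsGroupLikeElem k c) (hd : IsSkewPrimitive k c d) :
    PairAlgebra hqb hq σ α →ₐc[k] B :=
  .ofAlgHom (lift hqb hq hr)
    (algHom_ext (by
      rintro (_ | _ | _ | _) <;> simp [genMap, ha.counit_eq_one, hc.counit_eq_one,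
        hb.counit_eq_zero ha, hd.counit_eq_zero hc]))
    (algHom_ext (by
      rintro (_ | _ | _ | _) <;> simp [genMap, ha.comul_eq_tmul_self, hc.comul_eq_tmul_self,
        hb.comul_eq, hd.comul_eq]))

@[simp]
theorem liftBialgHom_gen {a b c d : B} (hr : IsPair m n qb q σ α a b c d)
    (ha : IsGroupLikeElem k a) (hb : IsSkewPrimitive k a b) (hc : IsGroupLikeElem k c)
    (hd : IsSkewPrimitive k c d) (i : PairGen) :
    liftBialgHom hqb hq hr ha hb hc hd (gen hqb hq σ α i) = genMap a b c d i :=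
  lift_gen hqb hq hr i

end BialgHom

section Swap

variable {A : Type*} [Ring A] [Algebra k A]

theorem IsPair.swap {h x H X : A} (r : IsPair m n qb q σ α h x H X) (hσ : σ' * σ = 1)
    (hα : σ' * α + α' = 0) : IsPair n m q qb σ' α' H X h x where
  h_pow := r.H_pow
  x_pow := r.X_pow
  H_pow := r.h_pow
  X_pow := r.x_pow
  x_h := r.X_H
  X_H := r.x_h
  h_H := r.h_H.symm
  x_H := by rw [r.h_X, smul_smul, hσ, one_smul]
  h_X := by rw [r.x_H, smul_smul, hσ, one_smul]
  x_X := by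
    rw [r.x_X, smul_add, smul_smul, hσ, one_smul, smul_smul, r.h_H, add_assoc, ← add_smul, hα,
      zero_smul, add_zero]

/-- The exchange of the two Taft algebras, `h ↔ H` and `x ↔ X`. -/
def swapHom (hσ : σ * σ' = 1) (hα : σ * α' + α = 0) :
    PairAlgebra hqb hq σ α →ₐc[k] PairAlgebra hq hqb σ' α' :=
  liftBialgHom hqb hq ((isPair hq hqb σ' α').swap hσ hα) (isGroupLikeElem_H ..)
    (isSkewPrimitive_X ..) (isGroupLikeElem_h ..) (isSkewPrimitive_x ..)

theorem swapHom_comp_swapHom (hσ : σ * σ' = 1) (hα : σ * α' + α = 0) (hσ' : σ' * σ = 1)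
    (hα' : σ' * α + α' = 0) :
    (swapHom (hqb := hq) (hq := hqb) hσ' hα').comp (swapHom hσ hα) = BialgHom.id k _ := by
  refine bialgHom_ext ?_
  rintro (_ | _ | _ | _) <;> simp [swapHom, genMap]

theorem nonempty_bialgEquiv_swap (hσ : σ * σ' = 1) (hα : σ * α' + α = 0) :
    Nonempty (PairAlgebra hqb hq σ α ≃ₐc[k] PairAlgebra hq hqb σ' α') := by
  have hσ' : σ' * σ = 1 := mul_comm σ σ' ▸ hσ
  have hα' : σ' * α + α' = 0 := by linear_combination σ' * hα - α' * hσ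
  exact ⟨.ofBialgHom (swapHom hσ hα) (swapHom hσ' hα') (swapHom_comp_swapHom ..)
    (swapHom_comp_swapHom ..)⟩

end Swap

section Scale

variable {A : Type*} [Ring A] [Algebra k A]

theorem IsPair.scale {h x H X : A} (r : IsPair m n qb q σ α h x H X) (c : k) :
    IsPair m n qb q σ (c * α) h (c • x) H X :=
  { r with
    x_pow := by rw [smul_pow, r.x_pow, smul_zero]
    x_h := by rw [smul_mul_assoc, r.x_h, mul_smul_comm, smul_comm]
    x_H := by rw [smul_mul_assoc, r.x_H, mul_smul_comm, smul_comm]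
    x_X := by rw [smul_mul_assoc, r.x_X, mul_smul_comm, smul_add, smul_comm, smul_smul, smul_smul] }

/-- The rescaling `x ↦ c x`. -/
def scaleHom (c : k) (hα : c * α' = α) :
    PairAlgebra hqb hq σ α →ₐc[k] PairAlgebra hqb hq σ α' :=
  liftBialgHom hqb hq (hα ▸ (isPair hqb hq σ α').scale c) (isGroupLikeElem_h ..)
    ((isSkewPrimitive_x ..).smul c) (isGroupLikeElem_H ..) (isSkewPrimitive_X ..)

theorem scaleHom_comp_scaleHom {c d : k} (hα : c * α' = α) (hα' : d * α = α') (hcd : c * d = 1) :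
    (scaleHom (hqb := hqb) (hq := hq) (σ := σ) d hα').comp (scaleHom c hα) = BialgHom.id k _ := by
  refine bialgHom_ext ?_
  rintro (_ | _ | _ | _) <;> simp [scaleHom, genMap, smul_smul, hcd]

theorem nonempty_bialgEquiv_scale (hα : α ≠ 0) (hα' : α' ≠ 0) :
    Nonempty (PairAlgebra hqb hq σ α ≃ₐc[k] PairAlgebra hqb hq σ α') :=
  ⟨.ofBialgHom (scaleHom (α / α') (by field_simp)) (scaleHom (α' / α) (by field_simp))
    (scaleHom_comp_scaleHom _ _ (by field_simp)) (scaleHom_comp_scaleHom _ _ (by field_simp))⟩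

end Scale

section Transport

theorem algHom_eq_or_of_bialgEquiv (hm : 2 ≤ m) (hn : 2 ≤ n)
    (φ : PairAlgebra hqb hq σ α ≃ₐc[k] PairAlgebra hqb hq σ' α')
    {γ : PairAlgebra hqb hq σ α →ₐ[k] k} {D : PairAlgebra hqb hq σ α →ₗ[k] k}
    (hD : IsSkewDerivation γ (Bialgebra.counitAlgHom k _) D)
    (hγ : γ ≠ Bialgebra.counitAlgHom k _) {g y : PairAlgebra hqb hq σ α}
    (hy : IsSkewPrimitive k g y) (hg : IsGroupLikeElem k g) (hnil : IsNilpotent y)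
    (hDy : D y ≠ 0) :
    (γ (φ.symm (gen hqb hq σ' α' .h)) = q⁻¹ ∧ γ (φ.symm (gen hqb hq σ' α' .H)) = σ'⁻¹ ∧
      ∀ χ : PairAlgebra hqb hq σ α →ₐ[k] k, χ g = χ (φ.symm (gen hqb hq σ' α' .h))) ∨
    (γ (φ.symm (gen hqb hq σ' α' .h)) = σ' ∧ γ (φ.symm (gen hqb hq σ' α' .H)) = qb⁻¹ ∧
      ∀ χ : PairAlgebra hqb hq σ α →ₐ[k] k, χ g = χ (φ.symm (gen hqb hq σ' α' .H))) := by
  let ψ : PairAlgebra hqb hq σ' α' →ₐ[k] PairAlgebra hqb hq σ α := AlgHomClass.toAlgHom φ.symm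
  have hψφ (a) : ψ (φ a) = a := φ.symm_apply_apply a
  have hε : (Bialgebra.counitAlgHom k _).comp ψ = Bialgebra.counitAlgHom k _ :=
    AlgHom.ext fun a => CoalgHomClass.counit_comp_apply φ.symm a
  have hγψ : γ.comp ψ ≠ Bialgebra.counitAlgHom k _ := fun h =>
    hγ ((AlgHom.cancel_right φ.symm.surjective).1 (h.trans hε.symm))
  have key := algHom_eq_or_of_isSkewPrimitive hm hn (hε ▸ hD.comp ψ) hγψ (hy.map φ.toBialgHom)
    (hg.map φ) (hnil.map φ) (by simpa [hψφ] using hDy)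
  refine key.imp (fun h => ⟨h.1, h.2.1, fun χ => ?_⟩) (fun h => ⟨h.1, h.2.1, fun χ => ?_⟩)
  all_goals exact (congr_arg χ (hψφ g)).symm.trans (h.2.2 (χ.comp ψ))

end Transport

end PairAlgebra

section Classification

open PairAlgebra

variable {k : Type*} [Field k] {m n : ℕ} {q qb : k} {hqb : qb ∈ primitiveRoots n k}
  {hq : q ∈ primitiveRoots m k} {σ σ' α : k}

variable (hqb hq σ) in
/-- The character `h ↦ u`, `H ↦ v`, `x, X ↦ 0` of `T_{n,m}^σ(qb, q)`. -/
def TBicrossed.character {u v : k} (hu : u ^ m = 1) (hv : v ^ n = 1) :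
    TBicrossed hqb hq σ →ₐ[k] k :=
  lift hqb hq (show IsPair m n qb q σ 0 u 0 v 0 from
    { h_pow := hu
      x_pow := zero_pow (pos_of_mem_primitiveRoots hq).ne'
      H_pow := hv
      X_pow := zero_pow (pos_of_mem_primitiveRoots hqb).ne'
      x_h := by simp
      X_H := by simp
      h_H := mul_comm u v
      x_H := by simp
      h_X := by simp
      x_X := by simp })

@[simp]
theorem TBicrossed.character_h {u v : k} (hu : u ^ m = 1) (hv : v ^ n = 1) :
    character hqb hq σ hu hv (gen hqb hq σ 0 .h) = u :=
  lift_gen ..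

@[simp]
theorem TBicrossed.character_H {u v : k} (hu : u ^ m = 1) (hv : v ^ n = 1) :
    character hqb hq σ hu hv (gen hqb hq σ 0 .H) = v :=
  lift_gen ..

theorem TBicrossed.character_ne_counit_of_h_ne_one {u v : k} (hu : u ^ m = 1) (hv : v ^ n = 1)
    (hu1 : u ≠ 1) : character hqb hq σ hu hv ≠ Bialgebra.counitAlgHom k _ := fun h =>
  hu1 (by simpa using DFunLike.congr_fun h (gen hqb hq σ 0 .h))

theorem TBicrossed.character_ne_counit_of_H_ne_one {u v : k} (hu : u ^ m = 1) (hv : v ^ n = 1)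
    (hv1 : v ≠ 1) : character hqb hq σ hu hv ≠ Bialgebra.counitAlgHom k _ := fun h =>
  hv1 (by simpa using DFunLike.congr_fun h (gen hqb hq σ 0 .H))

theorem TBicrossed.exists_isSkewDerivation_x (hm : 2 ≤ m) (hn : 2 ≤ n) (hσ : σ⁻¹ ^ n = 1) :
    ∃ D, IsSkewDerivation (character hqb hq σ (inv_pow_eq_one_of_mem_primitiveRoots hq) hσ)
      (Bialgebra.counitAlgHom k _) D ∧ D (gen hqb hq σ 0 .x) ≠ 0 := by
  have hσ0 : σ ≠ 0 := by rintro rfl; simp [zero_pow (by omega : n ≠ 0)] at hσ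
  have hdatum : IsSkewDatum (character hqb hq σ (inv_pow_eq_one_of_mem_primitiveRoots hq) hσ) 1 0 :=
    ⟨by simp [ne_zero_of_mem_primitiveRoots hq], by simp [hσ0], by simp, by simp⟩
  obtain ⟨D, hD, -, hDx, -, -⟩ := hdatum.exists_isSkewDerivation hm hn
  exact ⟨D, hD, hDx ▸ one_ne_zero⟩

theorem TBicrossed.exists_isSkewDerivation_X (hm : 2 ≤ m) (hn : 2 ≤ n) (hσ : σ ^ m = 1) :
    ∃ D, IsSkewDerivation (character hqb hq σ hσ (inv_pow_eq_one_of_mem_primitiveRoots hqb))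
      (Bialgebra.counitAlgHom k _) D ∧ D (gen hqb hq σ 0 .X) ≠ 0 := by
  have hdatum : IsSkewDatum
      (character hqb hq σ hσ (inv_pow_eq_one_of_mem_primitiveRoots hqb)) 0 1 :=
    ⟨by simp, by simp, by simp, by simp [ne_zero_of_mem_primitiveRoots hqb]⟩
  obtain ⟨D, hD, -, -, -, hDX⟩ := hdatum.exists_isSkewDerivation hm hn
  exact ⟨D, hD, hDX ▸ one_ne_zero⟩

theorem TBicrossed.eq_or_of_bialgEquiv (hm : 2 ≤ m) (hn : 2 ≤ n) (hσ : σ ^ Nat.gcd m n = 1)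
    (φ : TBicrossed hqb hq σ ≃ₐc[k] TBicrossed hqb hq σ') : σ = σ' ∨ qb = q ∧ σ' = σ⁻¹ := by
  have hσm : σ ^ m = 1 := orderOf_dvd_iff_pow_eq_one.1
    ((orderOf_dvd_of_pow_eq_one hσ).trans (Nat.gcd_dvd_left m n))
  have hσn : σ⁻¹ ^ n = 1 := by
    rw [inv_pow, inv_eq_one, ← orderOf_dvd_iff_pow_eq_one]
    exact (orderOf_dvd_of_pow_eq_one hσ).trans (Nat.gcd_dvd_right m n)
  have hcharacter (g : TBicrossed hqb hq σ)
      (hh : ∀ χ : TBicrossed hqb hq σ →ₐ[k] k, χ (gen hqb hq σ 0 .h) = χ g)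
      (hH : ∀ χ : TBicrossed hqb hq σ →ₐ[k] k, χ (gen hqb hq σ 0 .H) = χ g) : False :=
    ne_one_of_mem_primitiveRoots hm hq (by
      simpa using (hh (character hqb hq σ (pow_eq_one_of_mem_primitiveRoots hq)
        (one_pow n))).trans (hH _).symm)
  obtain ⟨D, hD, hDx⟩ := exists_isSkewDerivation_x (hqb := hqb) (hq := hq) hm hn hσn
  obtain ⟨E, hE, hEX⟩ := exists_isSkewDerivation_X (hqb := hqb) (hq := hq) hm hn hσm
  rcases algHom_eq_or_of_bialgEquiv hm hn φ hD
      (character_ne_counit_of_h_ne_one _ _ (inv_ne_one.2 (ne_one_of_mem_primitiveRoots hm hq)))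
      (isSkewPrimitive_x ..) (isGroupLikeElem_h ..) (isNilpotent_x ..) hDx
    with ⟨-, -, hx⟩ | ⟨-, hxH, hx⟩ <;>
  rcases algHom_eq_or_of_bialgEquiv hm hn φ hE
      (character_ne_counit_of_H_ne_one _ _ (inv_ne_one.2 (ne_one_of_mem_primitiveRoots hn hqb)))
      (isSkewPrimitive_X ..) (isGroupLikeElem_H ..) (isNilpotent_X ..) hEX
    with ⟨-, hXH, hX⟩ | ⟨hXh, -, hX⟩
  · exact (hcharacter _ hx hX).elim
  · exact .inl (by rw [← hXh, ← hx, character_h])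
  · refine .inr ⟨inv_injective ?_, inv_injective ?_⟩
    · rw [← hxH, ← hx, character_h]
    · rw [← hXH, ← hx, character_h, inv_inv]
  · exact (hcharacter _ hx hX).elim

theorem TBicrossed.nonempty_bialgEquiv_iff (hm : 2 ≤ m) (hn : 2 ≤ n) (hne : qb ≠ q)
    (hσ : σ ^ Nat.gcd m n = 1) :
    Nonempty (TBicrossed hqb hq σ ≃ₐc[k] TBicrossed hqb hq σ') ↔ σ = σ' := by
  refine ⟨fun ⟨φ⟩ => (eq_or_of_bialgEquiv hm hn hσ φ).resolve_right fun h => hne h.1, ?_⟩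
  rintro rfl
  exact ⟨BialgEquiv.refl k _⟩

theorem TBicrossed.nonempty_bialgEquiv_self_iff (hm : 2 ≤ m) (hσ : σ ^ m = 1) :
    Nonempty (TBicrossed hq hq σ ≃ₐc[k] TBicrossed hq hq σ') ↔ σ' = σ ∨ σ' = σ⁻¹ := by
  constructor
  · rintro ⟨φ⟩
    exact (eq_or_of_bialgEquiv hm hm ((Nat.gcd_self m).symm ▸ hσ) φ).imp Eq.symm And.right
  · rintro (rfl | rfl)
    · exact ⟨BialgEquiv.refl k _⟩
    · have hσ0 : σ ≠ 0 := by rintro rfl; simp [zero_pow (by omega : m ≠ 0)] at hσ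
      exact nonempty_bialgEquiv_swap (mul_inv_cancel₀ hσ0) (by simp)

theorem PairAlgebra.algHom_apply_h_injective (hα : α ≠ 0) :
    Function.Injective fun γ : PairAlgebra hqb hq σ α →ₐ[k] k => γ (gen hqb hq σ α .h) := by
  intro γ δ (h : γ _ = δ _)
  have hmul (χ : PairAlgebra hqb hq σ α →ₐ[k] k) :
      χ (gen hqb hq σ α .H) * χ (gen hqb hq σ α .h) = 1 :=
    (sub_eq_zero.1 ((mul_eq_zero.1 (mul_one_sub_algHom_H_mul_h χ)).resolve_left hα)).symm
  refine character_ext h (mul_right_cancel₀ (right_ne_zero_of_mul_eq_one (hmul δ)) ?_)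
  rw [hmul, ← h, hmul]

theorem TBicrossed.character_injective : Function.Injective
    fun p : rootsOfUnity m k × rootsOfUnity n k => character hqb hq σ
      ((mem_rootsOfUnity' m _).1 p.1.2) ((mem_rootsOfUnity' n _).1 p.2.2) := by
  rintro ⟨u, v⟩ ⟨u', v'⟩ h
  ext
  · simpa using DFunLike.congr_fun h (gen hqb hq σ 0 .h)
  · simpa using DFunLike.congr_fun h (gen hqb hq σ 0 .H)

theorem PairAlgebra.isEmpty_algEquiv_TBicrossed (hn : 2 ≤ n) (hα : α ≠ 0) :
    IsEmpty (PairAlgebra hqb hq σ α ≃ₐ[k] TBicrossed hqb hq σ') := by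
  refine ⟨fun φ => ?_⟩
  have hm := pos_of_mem_primitiveRoots hq
  have : NeZero m := ⟨hm.ne'⟩
  have : NeZero n := ⟨by omega⟩
  let f (p : rootsOfUnity m k × rootsOfUnity n k) : rootsOfUnity m k :=
    rootsOfUnity.mkOfPowEq _ (algHom_h_pow ((TBicrossed.character hqb hq σ'
      ((mem_rootsOfUnity' m _).1 p.1.2) ((mem_rootsOfUnity' n _).1 p.2.2)).comp φ.toAlgHom))
  have hf : Function.Injective f := fun p p' h =>
    TBicrossed.character_injective ((AlgHom.cancel_right φ.surjective).1
      (algHom_apply_h_injective hα (congr_arg (fun u : rootsOfUnity m k => ((u : kˣ) : k)) h)))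
  have hcard := Nat.card_le_card_of_injective f hf
  rw [Nat.card_prod, (isPrimitiveRoot_of_mem_primitiveRoots hq).card_rootsOfUnity,
    (isPrimitiveRoot_of_mem_primitiveRoots hqb).card_rootsOfUnity] at hcard
  nlinarith

end Classification

section Hit

open Coalgebra

variable {k A : Type*} [CommRing k] [Ring A] [Bialgebra k A]

/-- Contraction of the second tensor factor, `a ⊗ b ↦ f(b) a`. -/
def contractRight (f : A →ₗ[k] k) : A ⊗[k] A →ₗ[k] A :=
  (TensorProduct.rid k A).toLinearMap ∘ₗ f.lTensor A

@[simp]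
theorem contractRight_tmul (f : A →ₗ[k] k) (a b : A) : contractRight f (a ⊗ₜ b) = f b • a := by
  simp [contractRight]

theorem contractRight_mul {γ δ : A →ₐ[k] k} {D : A →ₗ[k] k} (hD : IsSkewDerivation γ δ D)
    (s t : A ⊗[k] A) :
    contractRight D (s * t) = contractRight γ.toLinearMap s * contractRight D t +
      contractRight D s * contractRight δ.toLinearMap t := by
  induction s with
  | zero => simp
  | add s s' hs hs' => simp only [add_mul, map_add, hs, hs']; abel
  | tmul u v =>
    induction t with
    | zero => simp
    | add t t' ht ht' => simp only [mul_add, map_add, ht, ht']; abel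
    | tmul u' v' => simp [hD.map_mul, smul_smul, add_smul, mul_comm]

/-- The hit action `a ↦ a₍₁₎ f(a₍₂₎)` of a linear form `f`. -/
def hit (f : A →ₗ[k] k) : A →ₗ[k] A := contractRight f ∘ₗ comul

theorem hit_algHom (γ : A →ₐ[k] k) (a : A) : hit γ.toLinearMap a = rightWinding γ a :=
  rfl

theorem hit_counit (a : A) : hit (Bialgebra.counitAlgHom k A).toLinearMap a = a := by
  simp [hit, contractRight]

theorem hit_mul {γ : A →ₐ[k] k} {D : A →ₗ[k] k}
    (hD : IsSkewDerivation γ (Bialgebra.counitAlgHom k A) D) (a b : A) :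
    hit D (a * b) = rightWinding γ a * hit D b + hit D a * b := by
  calc hit D (a * b) = contractRight D (comul a * comul b) := by simp [hit]
    _ = hit γ.toLinearMap a * hit D b +
        hit D a * hit (Bialgebra.counitAlgHom k A).toLinearMap b := contractRight_mul hD _ _
    _ = _ := by rw [hit_algHom, hit_counit]

end Hit

namespace DualCop

open Coalgebra

variable {k A : Type*} [Field k] [Ring A] [Bialgebra k A]

theorem mul_apply_eq_hit (f g : DualCop k A) (a : A) : (f * g) a = f (hit (toDual k A g) a) := by
  rw [mul_apply f g (ℛ k a), hit, LinearMap.comp_apply, ← (ℛ k a).eq]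
  simp [mul_comm]

theorem mul_algHom_apply (f : DualCop k A) (γ : A →ₐ[k] k) (a : A) :
    (f * (toDual k A).symm γ.toLinearMap) a = f (rightWinding γ a) := by
  rw [mul_apply_eq_hit, LinearEquiv.apply_symm_apply, hit_algHom]

theorem algHom_mul_apply (f : DualCop k A) (γ : A →ₐ[k] k) (a : A) :
    ((toDual k A).symm γ.toLinearMap * f) a = f (leftWinding γ a) := by
  rw [mul_apply _ _ (ℛ k a), leftWinding, AlgHom.comp_apply, Bialgebra.comulAlgHom_apply,
    ← (ℛ k a).eq]
  simp

variable [Module.Finite k A]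

theorem isGroupLikeElem_algHom (γ : A →ₐ[k] k) :
    IsGroupLikeElem k ((toDual k A).symm γ.toLinearMap) := by
  refine ⟨by simp [counit_apply], pairing_ext fun a b => ?_⟩
  rw [pairing_comul, pairing_tmul]
  simp [mul_comm]

end DualCop

theorem IsSkewDerivation.isSkewPrimitive {k A : Type*} [Field k] [Ring A] [Bialgebra k A]
    [Module.Finite k A] {γ : A →ₐ[k] k} {D : A →ₗ[k] k}
    (hD : IsSkewDerivation γ (Bialgebra.counitAlgHom k A) D) :
    IsSkewPrimitive k ((DualCop.toDual k A).symm γ.toLinearMap) ((DualCop.toDual k A).symm D) where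
  comul_eq := by
    refine DualCop.pairing_ext fun a b => ?_
    rw [DualCop.pairing_comul, map_add, LinearMap.add_apply, DualCop.pairing_tmul,
      DualCop.pairing_tmul]
    simp [hD.map_mul, mul_comm]

/-- The `q`-factorial `∏_{r < j} (1 + q + ⋯ + q ^ r)`. -/
def qFactorial {k : Type*} [CommSemiring k] (q : k) (j : ℕ) : k :=
  ∏ r ∈ Finset.range j, ∑ s ∈ Finset.range (r + 1), q ^ s

@[simp]
theorem qFactorial_zero {k : Type*} [CommSemiring k] (q : k) : qFactorial q 0 = 1 := by
  simp [qFactorial]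

theorem qFactorial_succ {k : Type*} [CommSemiring k] (q : k) (j : ℕ) :
    qFactorial q (j + 1) = qFactorial q j * ∑ s ∈ Finset.range (j + 1), q ^ s :=
  Finset.prod_range_succ ..

theorem qFactorial_ne_zero {k : Type*} [CommRing k] [IsDomain k] {q : k} {n j : ℕ}
    (hq : IsPrimitiveRoot q n) (hj : j < n) : qFactorial q j ≠ 0 := by
  refine Finset.prod_ne_zero_iff.2 fun r hr h0 => ?_
  have hrj := Finset.mem_range.1 hr
  refine hq.pow_ne_one_of_pos_of_lt r.succ_ne_zero (by omega) (sub_eq_zero.1 ?_)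
  rw [← mul_geom_sum q (r + 1), h0, mul_zero]

namespace TaftAlgebra

open Coalgebra

variable {k : Type*} [Field k] {n : ℕ} {q : k} (hq : q ∈ primitiveRoots n k)

theorem isGroupLikeElem_h : IsGroupLikeElem k (h hq) :=
  ⟨counit_h hq, comul_h hq⟩

theorem isSkewPrimitive_x : IsSkewPrimitive k (h hq) (x hq) :=
  ⟨comul_x hq⟩

/-- The character `h ↦ q⁻¹`, `x ↦ 0` of the Taft algebra. -/
def character : TaftAlgebra hq →ₐ[k] k :=
  lift hq q⁻¹ 0 (inv_pow_eq_one_of_mem_primitiveRoots hq)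
    (zero_pow (pos_of_mem_primitiveRoots hq).ne') (by simp)

@[simp]
theorem character_h : character hq (h hq) = q⁻¹ := lift_h ..

@[simp]
theorem character_x : character hq (x hq) = 0 := lift_x ..

variable {hq} in
theorem rightWinding_monomial (i b : ℕ) : rightWinding (character hq) (h hq ^ i * x hq ^ b) =
    q⁻¹ ^ (i + b) • (h hq ^ i * x hq ^ b) := by
  rw [map_mul, map_pow, map_pow, rightWinding_of_isGroupLikeElem _ (isGroupLikeElem_h hq),
    rightWinding_of_isSkewPrimitive _ (isSkewPrimitive_x hq) (character_x hq), character_h,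
    smul_pow, smul_pow, smul_mul_smul_comm, pow_add]

variable {hq} in
theorem leftWinding_monomial (i b : ℕ) : leftWinding (character hq) (h hq ^ i * x hq ^ b) =
    q⁻¹ ^ i • (h hq ^ i * x hq ^ b) := by
  rw [map_mul, map_pow, map_pow, leftWinding_of_isGroupLikeElem _ (isGroupLikeElem_h hq),
    leftWinding_of_isSkewPrimitive _ (isSkewPrimitive_x hq) (character_x hq), character_h,
    smul_pow, smul_mul_assoc]

section SkewForm

variable (hn : 2 ≤ n)

/-- The skew derivation of the Taft algebra with `h ↦ 0`, `x ↦ 1`. -/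
def skewForm : TaftAlgebra hq →ₗ[k] k :=
  Matrix.entryLinearMap k k 0 1 ∘ₗ
    (lift hq !![q⁻¹, 0; 0, 1] !![0, 1; 0, 0]
      (by rw [diagonal_one_pow, inv_pow_eq_one_of_mem_primitiveRoots hq, Matrix.one_fin_two])
      (strictlyUpperTriangular_pow 1 hn)
      (by
        ext i j
        fin_cases i <;> fin_cases j <;> simp [ne_zero_of_mem_primitiveRoots hq])).toLinearMap

@[simp]
theorem skewForm_h : skewForm hq hn (h hq) = 0 := by simp [skewForm]

@[simp]
theorem skewForm_x : skewForm hq hn (x hq) = 1 := by simp [skewForm]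

theorem isSkewDerivation_skewForm :
    IsSkewDerivation (character hq) (Bialgebra.counitAlgHom k _) (skewForm hq hn) := by
  refine .of_upperTriangular _ (adjoin_eq_top hq) ?_
  rintro _ (rfl | rfl) <;> simp

theorem skewForm_h_pow (i : ℕ) : skewForm hq hn (h hq ^ i) = 0 := by
  have hD := isSkewDerivation_skewForm hq hn
  induction i with
  | zero => rw [pow_zero, hD.map_one]
  | succ i ih => rw [pow_succ, hD.map_mul, skewForm_h, ih, mul_zero, zero_mul, add_zero]

theorem hit_skewForm_h_pow (i : ℕ) : hit (skewForm hq hn) (h hq ^ i) = 0 := by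
  simp [hit, skewForm_h_pow]

theorem hit_skewForm_x_pow (b : ℕ) :
    hit (skewForm hq hn) (x hq ^ b) = (∑ s ∈ Finset.range b, q⁻¹ ^ s) • x hq ^ (b - 1) := by
  have hx : hit (skewForm hq hn) (x hq) = 1 := by simp [hit]
  induction b with
  | zero => simpa using hit_skewForm_h_pow hq hn 0
  | succ b ih =>
    rw [pow_succ', hit_mul (isSkewDerivation_skewForm hq hn), ih, hx,
      rightWinding_of_isSkewPrimitive _ (isSkewPrimitive_x hq) (character_x hq), character_h,
      smul_mul_smul_comm, one_mul, Nat.add_sub_cancel, Finset.sum_range_succ']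
    cases b with
    | zero => simp
    | succ b =>
      rw [Nat.add_sub_cancel, ← pow_succ', add_smul, pow_zero, one_smul, Finset.mul_sum]
      simp only [pow_succ']

theorem hit_skewForm_monomial (i b : ℕ) : hit (skewForm hq hn) (h hq ^ i * x hq ^ b) =
    (q⁻¹ ^ i * ∑ s ∈ Finset.range b, q⁻¹ ^ s) • (h hq ^ i * x hq ^ (b - 1)) := by
  rw [hit_mul (isSkewDerivation_skewForm hq hn), hit_skewForm_h_pow, hit_skewForm_x_pow, map_pow,
    rightWinding_of_isGroupLikeElem _ (isGroupLikeElem_h hq), character_h, smul_pow,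
    smul_mul_smul_comm, zero_mul, add_zero]

end SkewForm

/-- The group-like generator of the dual of the Taft algebra. -/
def dualH : DualCop k (TaftAlgebra hq) :=
  (DualCop.toDual k _).symm (character hq).toLinearMap

/-- The skew primitive generator of the dual of the Taft algebra. -/
def dualX (hn : 2 ≤ n) : DualCop k (TaftAlgebra hq) :=
  (DualCop.toDual k _).symm (skewForm hq hn)

theorem isGroupLikeElem_dualH : IsGroupLikeElem k (dualH hq) :=
  DualCop.isGroupLikeElem_algHom _

theorem isSkewPrimitive_dualX (hn : 2 ≤ n) : IsSkewPrimitive k (dualH hq) (dualX hq hn) :=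
  (isSkewDerivation_skewForm hq hn).isSkewPrimitive

variable {hq}

theorem dual_ext {f g : DualCop k (TaftAlgebra hq)}
    (hfg : ∀ i b, f (h hq ^ i * x hq ^ b) = g (h hq ^ i * x hq ^ b)) : f = g :=
  (DualCop.toDual k _).injective
    (LinearMap.ext_on_range (span_eq_top hq) fun p => hfg p.1 p.2)

theorem dual_one_apply_monomial (i b : ℕ) :
    (1 : DualCop k (TaftAlgebra hq)) (h hq ^ i * x hq ^ b) = if b = 0 then 1 else 0 := by
  rw [DualCop.one_apply, Bialgebra.counit_mul, Bialgebra.counit_pow, Bialgebra.counit_pow,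
    counit_h, counit_x, one_pow, one_mul, zero_pow_eq]

theorem dualH_mul_apply_monomial (f : DualCop k (TaftAlgebra hq)) (i b : ℕ) :
    (dualH hq * f) (h hq ^ i * x hq ^ b) = q⁻¹ ^ i * f (h hq ^ i * x hq ^ b) := by
  rw [dualH, DualCop.algHom_mul_apply, leftWinding_monomial, map_smul, smul_eq_mul]

theorem mul_dualH_apply_monomial (f : DualCop k (TaftAlgebra hq)) (i b : ℕ) :
    (f * dualH hq) (h hq ^ i * x hq ^ b) = q⁻¹ ^ (i + b) * f (h hq ^ i * x hq ^ b) := by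
  rw [dualH, DualCop.mul_algHom_apply, rightWinding_monomial, map_smul, smul_eq_mul]

theorem dualH_pow_mul_apply_monomial (f : DualCop k (TaftAlgebra hq)) (l i b : ℕ) :
    (dualH hq ^ l * f) (h hq ^ i * x hq ^ b) = (q⁻¹ ^ i) ^ l * f (h hq ^ i * x hq ^ b) := by
  induction l with
  | zero => simp
  | succ l ih => rw [pow_succ', mul_assoc, dualH_mul_apply_monomial, ih, pow_succ', mul_assoc]

variable (hn : 2 ≤ n)

theorem dualX_pow_apply_monomial (j i b : ℕ) : (dualX hq hn ^ j) (h hq ^ i * x hq ^ b) =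
    if b = j then (q⁻¹ ^ i) ^ j * qFactorial q⁻¹ j else 0 := by
  induction j generalizing b with
  | zero => rw [pow_zero, dual_one_apply_monomial]; simp
  | succ j ih =>
    rw [pow_succ, DualCop.mul_apply_eq_hit, dualX, LinearEquiv.apply_symm_apply,
      hit_skewForm_monomial, map_smul, ← dualX, ih]
    cases b with
    | zero => simp
    | succ b =>
      by_cases hb : b = j
      · subst hb
        simp only [Nat.add_sub_cancel, if_true, qFactorial_succ, smul_eq_mul]
        ring
      · simp [hb]

theorem dualH_pow : dualH hq ^ n = 1 := by
  refine dual_ext fun i b => ?_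
  rw [← mul_one (dualH hq ^ n), dualH_pow_mul_apply_monomial, ← pow_mul, mul_comm i, pow_mul,
    inv_pow_eq_one_of_mem_primitiveRoots hq, one_pow, one_mul]

theorem dualX_pow : dualX hq hn ^ n = 0 := by
  refine dual_ext fun i b => ?_
  by_cases hb : b = n
  · rw [hb, x_pow, mul_zero, map_zero, map_zero]
  · rw [dualX_pow_apply_monomial, if_neg hb]
    rfl

theorem dualX_mul_dualH : dualX hq hn * dualH hq = q⁻¹ • (dualH hq * dualX hq hn) := by
  refine dual_ext fun i b => ?_
  rw [mul_dualH_apply_monomial, map_smul, LinearMap.smul_apply, dualH_mul_apply_monomial,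
    ← pow_one (dualX hq hn), dualX_pow_apply_monomial]
  split_ifs with hb
  · rw [hb, smul_eq_mul]
    ring
  · simp

theorem span_monomial_eq_top :
    Submodule.span k (Set.range fun p : Fin n × Fin n => h hq ^ (p.1 : ℕ) * x hq ^ (p.2 : ℕ)) =
      ⊤ := by
  rw [eq_top_iff, ← span_eq_top hq, Submodule.span_le]
  rintro _ ⟨⟨i, b⟩, rfl⟩
  by_cases hb : b < n
  · refine Submodule.subset_span
      ⟨(⟨i % n, Nat.mod_lt _ (pos_of_mem_primitiveRoots hq)⟩, ⟨b, hb⟩), ?_⟩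
    simp [← pow_eq_pow_mod i (h_pow hq)]
  · simp [pow_eq_zero_of_le (not_lt.1 hb) (x_pow hq)]

theorem eq_zero_of_pairing {c : Fin n × Fin n → k}
    (hc : ∀ l j : Fin n, (dualH hq ^ (l : ℕ) * dualX hq hn ^ (j : ℕ))
      (∑ p, c p • (h hq ^ (p.1 : ℕ) * x hq ^ (p.2 : ℕ))) = 0) : c = 0 := by
  have hp : IsPrimitiveRoot q⁻¹ n := (isPrimitiveRoot_of_mem_primitiveRoots hq).inv
  have hinj : Function.Injective fun i : Fin n => q⁻¹ ^ (i : ℕ) :=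
    fun i j h => Fin.ext (hp.pow_inj i.2 j.2 h)
  -- For fixed `j`, the values of `dualH ^ l * dualX ^ j` on the monomials `h ^ i * x ^ j` form, up
  -- to nonzero factors, a Vandermonde matrix in `i` and `l`.
  have key (j : Fin n) :
      (fun i : Fin n => c (i, j) * ((q⁻¹ ^ (i : ℕ)) ^ (j : ℕ) * qFactorial q⁻¹ j)) = 0 := by
    refine Matrix.eq_zero_of_forall_pow_sum_mul_pow_eq_zero hinj fun l => ?_
    rw [← hc l j, map_sum, Fintype.sum_prod_type]
    refine Finset.sum_congr rfl fun i _ => ?_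
    simp only [map_smul, dualH_pow_mul_apply_monomial, dualX_pow_apply_monomial, Fin.val_inj,
      smul_eq_mul, mul_ite, mul_zero, Finset.sum_ite_eq', Finset.mem_univ, if_true]
    ring
  funext ⟨i, j⟩
  have h0 : (q⁻¹ ^ (i : ℕ)) ^ (j : ℕ) ≠ 0 :=
    pow_ne_zero _ (pow_ne_zero _ (inv_ne_zero (ne_zero_of_mem_primitiveRoots hq)))
  exact (mul_eq_zero.1 (congrFun (key j) i)).resolve_right
    (mul_ne_zero h0 (qFactorial_ne_zero hp j.2))

include hn in
theorem linearIndependent_monomial : LinearIndependent k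
    fun p : Fin n × Fin n => h hq ^ (p.1 : ℕ) * x hq ^ (p.2 : ℕ) := by
  refine Fintype.linearIndependent_iff.2 fun c hc => congrFun ?_
  exact eq_zero_of_pairing hn fun l j => by rw [hc, map_zero]

include hn in
theorem finrank_eq : Module.finrank k (TaftAlgebra hq) = n * n := by
  rw [Module.finrank_eq_card_basis
    (Module.Basis.mk (linearIndependent_monomial hn) span_monomial_eq_top.ge), Fintype.card_prod,
    Fintype.card_fin]

theorem eq_zero_of_forall_mem_adjoin_dual {a : TaftAlgebra hq}
    (ha : ∀ f ∈ Algebra.adjoin k {dualH hq, dualX hq hn}, f a = 0) : a = 0 := by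
  have hspan : a ∈ Submodule.span k _ := span_monomial_eq_top.ge Submodule.mem_top
  obtain ⟨c, rfl⟩ := (Submodule.mem_span_range_iff_exists_fun k).1 hspan
  have hc : c = 0 := eq_zero_of_pairing hn fun l j => ha _ <|
    mul_mem (pow_mem (Algebra.subset_adjoin (by simp)) _)
      (pow_mem (Algebra.subset_adjoin (by simp)) _)
  simp [hc]

theorem adjoin_dual_eq_top : Algebra.adjoin k {dualH hq, dualX hq hn} = ⊤ := by
  let W : Submodule k (Module.Dual k (TaftAlgebra hq)) :=
    (Subalgebra.toSubmodule (Algebra.adjoin k {dualH hq, dualX hq hn})).map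
      (DualCop.toDual k _).toLinearMap
  have hW : W.dualCoannihilator = ⊥ := (Submodule.eq_bot_iff _).2 fun a ha =>
    eq_zero_of_forall_mem_adjoin_dual hn fun f hf =>
      (Submodule.mem_dualCoannihilator _).1 ha _ (Submodule.mem_map_of_mem hf)
  have hW' : W = ⊤ := by
    rw [← Subspace.dualCoannihilator_dualAnnihilator_eq (W := W), hW,
      Submodule.dualAnnihilator_bot]
  refine eq_top_iff.2 fun f _ => ?_
  obtain ⟨g, hg, hgf⟩ : DualCop.toDual k _ f ∈ W := hW' ▸ Submodule.mem_top
  rwa [← (DualCop.toDual k _).injective hgf]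

end TaftAlgebra

theorem mul_mem_of_adjoin_eq_top {k A B : Type*} [CommSemiring k] [Semiring A] [Algebra k A]
    [Semiring B] [Algebra k B] {s : Set A} (hs : Algebra.adjoin k s = ⊤) (f : A →ₐ[k] B)
    {V : Submodule k B} (hV : ∀ y ∈ s, ∀ w ∈ V, f y * w ∈ V) (a : A) {w : B} (hw : w ∈ V) :
    f a * w ∈ V := by
  have ha : a ∈ Algebra.adjoin k s := hs ▸ Algebra.mem_top
  induction ha using Algebra.adjoin_induction generalizing w with
  | mem y hy => exact hV y hy w hw
  | algebraMap c =>
    rw [AlgHom.commutes, ← Algebra.smul_def]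
    exact V.smul_mem c hw
  | add y z _ _ hy hz =>
    rw [map_add, add_mul]
    exact V.add_mem (hy hw) (hz hw)
  | mul y z _ _ hy hz =>
    rw [map_mul, mul_assoc]
    exact hy (hz hw)

namespace PairAlgebra

variable {k : Type*} [Field k] {m n : ℕ} {q qb : k}

section PairCore

variable {A : Type*} [Ring A] [Algebra k A] {σ α : k} {h x H X : A}

/-- The elements of a subspace `W` which left multiplication by `h` and by `x` keeps in `W`. -/
def pairCore (h x : A) (W : Submodule k A) : Submodule k A :=
  W ⊓ (W.comap (LinearMap.mulLeft k h) ⊓ W.comap (LinearMap.mulLeft k x))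

theorem mem_pairCore {W : Submodule k A} {w : A} :
    w ∈ pairCore h x W ↔ w ∈ W ∧ h * w ∈ W ∧ x * w ∈ W :=
  Iff.rfl

theorem IsPair.H_mul_mem_pairCore (r : IsPair m n qb q σ α h x H X) {W : Submodule k A}
    (hH : ∀ w ∈ W, H * w ∈ W) {w : A} (hw : w ∈ pairCore h x W) : H * w ∈ pairCore h x W := by
  obtain ⟨hw, hhw, hxw⟩ := mem_pairCore.1 hw
  refine mem_pairCore.2 ⟨hH w hw, ?_, ?_⟩
  · rw [← mul_assoc, r.h_H, mul_assoc]
    exact hH _ hhw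
  · rw [← mul_assoc, r.x_H, smul_mul_assoc, mul_assoc]
    exact W.smul_mem _ (hH _ hxw)

theorem IsPair.X_mul_mem_pairCore (r : IsPair m n qb q σ α h x H X) {W : Submodule k A}
    (hH : ∀ w ∈ W, H * w ∈ W) (hX : ∀ w ∈ W, X * w ∈ W) {w : A} (hw : w ∈ pairCore h x W) :
    X * w ∈ pairCore h x W := by
  obtain ⟨hw, hhw, hxw⟩ := mem_pairCore.1 hw
  refine mem_pairCore.2 ⟨hX w hw, ?_, ?_⟩
  · rw [← mul_assoc, r.h_X, smul_mul_assoc, mul_assoc]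
    exact W.smul_mem _ (hX _ hhw)
  · rw [← mul_assoc, r.x_X, add_mul, smul_mul_assoc, smul_mul_assoc, sub_mul, one_mul, mul_assoc,
      mul_assoc]
    exact W.add_mem (W.smul_mem _ (hX _ hxw)) (W.smul_mem _ (W.sub_mem hw (hH _ hhw)))

end PairCore

section Triangular

variable (hqb : qb ∈ primitiveRoots n k) (hq : q ∈ primitiveRoots m k) (σ α : k)

/-- The homomorphism onto the Taft subalgebra generated by `H` and `X`. -/
def inclLeft : TaftAlgebra hqb →ₐ[k] PairAlgebra hqb hq σ α :=
  TaftAlgebra.lift hqb _ _ (isPair hqb hq σ α).H_pow (isPair hqb hq σ α).X_pow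
    (isPair hqb hq σ α).X_H

/-- The homomorphism onto the Taft subalgebra generated by `h` and `x`. -/
def inclRight : TaftAlgebra hq →ₐ[k] PairAlgebra hqb hq σ α :=
  TaftAlgebra.lift hq _ _ (isPair hqb hq σ α).h_pow (isPair hqb hq σ α).x_pow
    (isPair hqb hq σ α).x_h

@[simp]
theorem inclLeft_h : inclLeft hqb hq σ α (TaftAlgebra.h hqb) = gen hqb hq σ α .H :=
  TaftAlgebra.lift_h ..

@[simp]
theorem inclLeft_x : inclLeft hqb hq σ α (TaftAlgebra.x hqb) = gen hqb hq σ α .X :=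
  TaftAlgebra.lift_x ..

@[simp]
theorem inclRight_h : inclRight hqb hq σ α (TaftAlgebra.h hq) = gen hqb hq σ α .h :=
  TaftAlgebra.lift_h ..

@[simp]
theorem inclRight_x : inclRight hqb hq σ α (TaftAlgebra.x hq) = gen hqb hq σ α .x :=
  TaftAlgebra.lift_x ..

/-- The multiplication map of the triangular decomposition of `PairAlgebra` into its two Taft
subalgebras. -/
def mulMap : TaftAlgebra hqb ⊗[k] TaftAlgebra hq →ₗ[k] PairAlgebra hqb hq σ α :=
  LinearMap.mul' k _ ∘ₗ
    TensorProduct.map (inclLeft hqb hq σ α).toLinearMap (inclRight hqb hq σ α).toLinearMap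

theorem mulMap_tmul (a : TaftAlgebra hqb) (b : TaftAlgebra hq) :
    mulMap hqb hq σ α (a ⊗ₜ b) = inclLeft hqb hq σ α a * inclRight hqb hq σ α b := rfl

variable {hqb hq σ α}

theorem inclRight_mem_range_mulMap (b : TaftAlgebra hq) :
    inclRight hqb hq σ α b ∈ (mulMap hqb hq σ α).range :=
  ⟨1 ⊗ₜ b, by rw [mulMap_tmul, map_one, one_mul]⟩

theorem inclLeft_mul_mem_range_mulMap (c : TaftAlgebra hqb) {w : PairAlgebra hqb hq σ α}
    (hw : w ∈ (mulMap hqb hq σ α).range) :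
    inclLeft hqb hq σ α c * w ∈ (mulMap hqb hq σ α).range := by
  obtain ⟨t, rfl⟩ := hw
  induction t with
  | zero => simp
  | add s t hs ht => rw [map_add, mul_add]; exact Submodule.add_mem _ hs ht
  | tmul a b => exact ⟨(c * a) ⊗ₜ b, by simp only [mulMap_tmul, map_mul, mul_assoc]⟩

theorem H_mul_mem_range_mulMap {w : PairAlgebra hqb hq σ α}
    (hw : w ∈ (mulMap hqb hq σ α).range) : gen hqb hq σ α .H * w ∈ (mulMap hqb hq σ α).range :=
  inclLeft_h hqb hq σ α ▸ inclLeft_mul_mem_range_mulMap _ hw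

theorem X_mul_mem_range_mulMap {w : PairAlgebra hqb hq σ α}
    (hw : w ∈ (mulMap hqb hq σ α).range) : gen hqb hq σ α .X * w ∈ (mulMap hqb hq σ α).range :=
  inclLeft_x hqb hq σ α ▸ inclLeft_mul_mem_range_mulMap _ hw

theorem inclRight_mem_pairCore (b : TaftAlgebra hq) : inclRight hqb hq σ α b ∈
    pairCore (gen hqb hq σ α .h) (gen hqb hq σ α .x) (mulMap hqb hq σ α).range := by
  refine mem_pairCore.2 ⟨inclRight_mem_range_mulMap b, ?_, ?_⟩
  · rw [← inclRight_h, ← map_mul]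
    exact inclRight_mem_range_mulMap _
  · rw [← inclRight_x, ← map_mul]
    exact inclRight_mem_range_mulMap _

theorem range_mulMap_le_pairCore : (mulMap hqb hq σ α).range ≤
    pairCore (gen hqb hq σ α .h) (gen hqb hq σ α .x) (mulMap hqb hq σ α).range := by
  have r := isPair hqb hq σ α
  rintro _ ⟨t, rfl⟩
  induction t with
  | zero => rw [map_zero]; exact Submodule.zero_mem _
  | add s t hs ht => rw [map_add]; exact Submodule.add_mem _ hs ht
  | tmul a b =>
    rw [mulMap_tmul]
    refine mul_mem_of_adjoin_eq_top (TaftAlgebra.adjoin_eq_top hqb) _ ?_ a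
      (inclRight_mem_pairCore b)
    rintro _ (rfl | rfl) w hw
    · rw [inclLeft_h]
      exact r.H_mul_mem_pairCore (fun _ => H_mul_mem_range_mulMap) hw
    · rw [inclLeft_x]
      exact r.X_mul_mem_pairCore (fun _ => H_mul_mem_range_mulMap)
        (fun _ => X_mul_mem_range_mulMap) hw

variable (hqb hq σ α)

theorem mulMap_surjective : Function.Surjective (mulMap hqb hq σ α) := by
  have hgen : ∀ y ∈ Set.range (gen hqb hq σ α), ∀ w ∈ (mulMap hqb hq σ α).range,
      AlgHom.id k _ y * w ∈ (mulMap hqb hq σ α).range := by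
    rintro _ ⟨_ | _ | _ | _, rfl⟩ w hw
    exacts [(mem_pairCore.1 (range_mulMap_le_pairCore hw)).2.1,
      (mem_pairCore.1 (range_mulMap_le_pairCore hw)).2.2, H_mul_mem_range_mulMap hw,
      X_mul_mem_range_mulMap hw]
  have hone : (1 : PairAlgebra hqb hq σ α) ∈ (mulMap hqb hq σ α).range := by
    simpa only [map_one] using inclRight_mem_range_mulMap (hqb := hqb) (σ := σ) (α := α) 1
  intro a
  simpa only [AlgHom.id_apply, mul_one, LinearMap.mem_range] using
    mul_mem_of_adjoin_eq_top (adjoin_eq_top hqb hq σ α) (AlgHom.id k _) hgen a hone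

instance : Module.Finite k (PairAlgebra hqb hq σ α) :=
  .of_surjective _ (mulMap_surjective hqb hq σ α)

theorem finrank_le : Module.finrank k (PairAlgebra hqb hq σ α) ≤
    Module.finrank k (TaftAlgebra hqb) * Module.finrank k (TaftAlgebra hq) := by
  rw [← Module.finrank_tensorProduct]
  exact LinearMap.finrank_le_finrank_of_surjective (mulMap_surjective hqb hq σ α)

end Triangular

end PairAlgebra

namespace DualCop

variable {k A : Type*} [Field k] [Ring A] [HopfAlgebra k A]

theorem rightTranslation_algHom (a : A) (γ : A →ₐ[k] k) :
    rightTranslation k A a ((toDual k A).symm γ.toLinearMap) =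
      γ a • (toDual k A).symm γ.toLinearMap := by
  ext w
  simp [mul_comm]

theorem rightTranslation_isSkewDerivation (a : A) {γ : A →ₐ[k] k} {D : A →ₗ[k] k}
    (hD : IsSkewDerivation γ (Bialgebra.counitAlgHom k A) D) :
    rightTranslation k A a ((toDual k A).symm D) =
      D a • (toDual k A).symm γ.toLinearMap +
        Coalgebra.counit (R := k) a • (toDual k A).symm D := by
  ext w
  simp [hD.map_mul, mul_comm]

variable [HasBijectiveAntipode k A]

theorem leftTranslation_algHom (a : A) (γ : A →ₐ[k] k) :
    leftTranslation k A a ((toDual k A).symm γ.toLinearMap) =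
      γ (antipodeInv k A a) • (toDual k A).symm γ.toLinearMap := by
  ext w
  simp

theorem leftTranslation_isSkewDerivation (a : A) {γ : A →ₐ[k] k} {D : A →ₗ[k] k}
    (hD : IsSkewDerivation γ (Bialgebra.counitAlgHom k A) D) :
    leftTranslation k A a ((toDual k A).symm D) =
      γ (antipodeInv k A a) • (toDual k A).symm D + D (antipodeInv k A a) • 1 := by
  ext w
  simp [hD.map_mul]

end DualCop

namespace DrinfeldDouble

variable {k A : Type*} [Field k] [Ring A] [HopfAlgebra k A] [HasBijectiveAntipode k A]
  [Module.Finite k A] {h x : A}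

theorem incl_mul_inclDual_of_isGroupLikeElem (hh : IsGroupLikeElem k h) (g : DualCop k A) :
    incl k A h * inclDual k A g =
      inclDual k A (rightTranslation k A h (leftTranslation k A h g)) * incl k A h := by
  rw [incl_mul_inclDual, straighten_apply, hh.comul_eq_tmul_self, LinearMap.lTensor_tmul,
    hh.comul_eq_tmul_self, action₃_tmul, mul_one, ← tmul_eq_mul]
  rfl

theorem incl_mul_inclDual_of_isSkewPrimitive (hh : IsGroupLikeElem k h)
    (hx : IsSkewPrimitive k h x) (g : DualCop k A) : incl k A x * inclDual k A g =
      inclDual k A (rightTranslation k A x (leftTranslation k A h g)) * incl k A h +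
        inclDual k A (leftTranslation k A h g) * incl k A x +
          inclDual k A (leftTranslation k A x g) := by
  rw [incl_mul_inclDual, straighten_apply, hx.comul_eq, map_add, LinearMap.lTensor_tmul,
    LinearMap.lTensor_tmul, hh.comul_eq_tmul_self, hx.comul_eq, TensorProduct.tmul_add, map_add,
    map_add, LinearMap.add_apply, LinearMap.add_apply, action₃_tmul, action₃_tmul, action₃_tmul,
    map_one, Module.End.one_apply, Module.End.one_apply, mul_one, mul_one, mul_one,
    ← add_assoc, ← tmul_eq_mul, ← tmul_eq_mul]
  rfl

theorem isGroupLikeElem_incl (hh : IsGroupLikeElem k h) : IsGroupLikeElem k (incl k A h) :=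
  ⟨by rw [counit_incl, hh.counit_eq_one], by simp [comul_incl, hh.comul_eq_tmul_self]⟩

theorem isSkewPrimitive_incl (hx : IsSkewPrimitive k h x) :
    IsSkewPrimitive k (incl k A h) (incl k A x) :=
  ⟨by simp [comul_incl, hx.comul_eq]⟩

variable {f g : DualCop k A}

theorem isGroupLikeElem_inclDual (hf : IsGroupLikeElem k f) :
    IsGroupLikeElem k (inclDual k A f) :=
  ⟨by rw [counit_inclDual, ← DualCop.counit_apply, hf.counit_eq_one],
    by simp [comul_inclDual, hf.comul_eq_tmul_self]⟩

theorem isSkewPrimitive_inclDual (hg : IsSkewPrimitive k f g) :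
    IsSkewPrimitive k (inclDual k A f) (inclDual k A g) :=
  ⟨by simp [comul_inclDual, hg.comul_eq]⟩

theorem eq_top_of_incl_mem_of_inclDual_mem {S : Subalgebra k (DrinfeldDouble k A)}
    (hincl : ∀ a, incl k A a ∈ S) (hdual : ∀ f, inclDual k A f ∈ S) : S = ⊤ := by
  refine Algebra.eq_top_iff.2 fun w => ?_
  refine TensorProduct.induction_on (R := k) (M := DualCop k A) (N := A)
    (motive := fun w => w ∈ S) w S.zero_mem (fun f a => ?_) fun _ _ => S.add_mem
  have htmul : tmul f a ∈ S := tmul_eq_mul f a ▸ S.mul_mem (hdual f) (hincl a)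
  exact htmul

theorem finrank_eq :
    Module.finrank k (DrinfeldDouble k A) = Module.finrank k A * Module.finrank k A := by
  refine (Module.finrank_tensorProduct (R := k) (S := k) (M := DualCop k A) (M' := A)).trans ?_
  rw [LinearEquiv.finrank_eq (DualCop.toDual k A), Subspace.dual_finrank_eq]

end DrinfeldDouble

section Taft

open TaftAlgebra DrinfeldDouble

variable {k : Type*} [Field k] {n : ℕ} {q : k} {hq : q ∈ primitiveRoots n k}

namespace TaftAlgebra

theorem antipodeInv_h : antipodeInv k (TaftAlgebra hq) (h hq) = h hq ^ (n - 1) := by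
  have := antipode_antipodeInv hq (h hq)
  rw [antipodeInvHom_h, MulOpposite.unop_op] at this
  conv_lhs => rw [← this, antipodeInv_antipode]

theorem antipodeInv_x :
    antipodeInv k (TaftAlgebra hq) (x hq) = -(h hq ^ (n - 1) * x hq) := by
  have := antipode_antipodeInv hq (x hq)
  rw [antipodeInvHom_x, MulOpposite.unop_op] at this
  conv_lhs => rw [← this, antipodeInv_antipode]

@[simp]
theorem character_antipodeInv_h : character hq (antipodeInv k _ (h hq)) = q := by
  have h1 := congrArg (character hq) (groupLike_inv (pos_of_mem_primitiveRoots hq) (h_pow hq)).1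
  rw [map_mul, character_h, map_one] at h1
  rw [antipodeInv_h, eq_inv_of_mul_eq_one_right h1, inv_inv]

@[simp]
theorem character_antipodeInv_x : character hq (antipodeInv k _ (x hq)) = 0 := by
  simp [antipodeInv_x]

variable (hn : 2 ≤ n)

@[simp]
theorem skewForm_antipodeInv_h : skewForm hq hn (antipodeInv k _ (h hq)) = 0 := by
  rw [antipodeInv_h, skewForm_h_pow]

@[simp]
theorem skewForm_antipodeInv_x : skewForm hq hn (antipodeInv k _ (x hq)) = -q := by
  rw [antipodeInv_x, ← antipodeInv_h, map_neg, (isSkewDerivation_skewForm hq hn).map_mul]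
  simp

theorem leftTranslation_h_dualH : leftTranslation k _ (h hq) (dualH hq) = q • dualH hq := by
  rw [dualH, DualCop.leftTranslation_algHom, character_antipodeInv_h]

theorem leftTranslation_h_dualX :
    leftTranslation k _ (h hq) (dualX hq hn) = q • dualX hq hn := by
  rw [dualX, DualCop.leftTranslation_isSkewDerivation _ (isSkewDerivation_skewForm hq hn),
    character_antipodeInv_h, skewForm_antipodeInv_h, zero_smul, add_zero]

end TaftAlgebra

namespace DrinfeldDouble

theorem h_mul_dualH : incl k _ (h hq) * inclDual k _ (dualH hq) =
    inclDual k _ (dualH hq) * incl k _ (h hq) := by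
  rw [incl_mul_inclDual_of_isGroupLikeElem (isGroupLikeElem_h hq), leftTranslation_h_dualH, dualH,
    map_smul, DualCop.rightTranslation_algHom, character_h, smul_smul,
    mul_inv_cancel₀ (ne_zero_of_mem_primitiveRoots hq), one_smul]

theorem x_mul_dualH : incl k _ (x hq) * inclDual k _ (dualH hq) =
    q • (inclDual k _ (dualH hq) * incl k _ (x hq)) := by
  rw [incl_mul_inclDual_of_isSkewPrimitive (isGroupLikeElem_h hq) (isSkewPrimitive_x hq),
    leftTranslation_h_dualH, dualH, map_smul, DualCop.rightTranslation_algHom,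
    DualCop.leftTranslation_algHom, character_x, character_antipodeInv_x, zero_smul, smul_zero,
    map_zero, zero_mul, zero_add, add_zero, map_smul, smul_mul_assoc]

variable (hn : 2 ≤ n)

theorem h_mul_dualX : incl k _ (h hq) * inclDual k _ (dualX hq hn) =
    q • (inclDual k _ (dualX hq hn) * incl k _ (h hq)) := by
  rw [incl_mul_inclDual_of_isGroupLikeElem (isGroupLikeElem_h hq), leftTranslation_h_dualX,
    map_smul, dualX, DualCop.rightTranslation_isSkewDerivation _ (isSkewDerivation_skewForm hq hn),
    skewForm_h, counit_h, zero_smul, zero_add, one_smul, map_smul, smul_mul_assoc]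

theorem x_mul_dualX : incl k _ (x hq) * inclDual k _ (dualX hq hn) =
    q • (inclDual k _ (dualX hq hn) * incl k _ (x hq)) +
      (-q) • (1 - inclDual k _ (dualH hq) * incl k _ (h hq)) := by
  have hright : rightTranslation k _ (x hq) (dualX hq hn) = dualH hq := by
    rw [dualX, DualCop.rightTranslation_isSkewDerivation _ (isSkewDerivation_skewForm hq hn),
      skewForm_x, counit_x, one_smul, zero_smul, add_zero, dualH]
  have hleft : leftTranslation k _ (x hq) (dualX hq hn) = (-q) • 1 := by
    rw [dualX, DualCop.leftTranslation_isSkewDerivation _ (isSkewDerivation_skewForm hq hn),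
      character_antipodeInv_x, skewForm_antipodeInv_x, zero_smul, zero_add]
  rw [incl_mul_inclDual_of_isSkewPrimitive (isGroupLikeElem_h hq) (isSkewPrimitive_x hq),
    leftTranslation_h_dualX, map_smul, hright, hleft]
  simp only [map_smul, map_one, smul_mul_assoc]
  module

theorem isPair : PairAlgebra.IsPair n n (q ^ (n - 1)) q q (-q) (incl k _ (h hq))
    (incl k _ (x hq)) (inclDual k _ (dualH hq)) (inclDual k _ (dualX hq hn)) where
  h_pow := by rw [← map_pow, h_pow, map_one]
  x_pow := by rw [← map_pow, x_pow, map_zero]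
  H_pow := by rw [← map_pow, dualH_pow, map_one]
  X_pow := by rw [← map_pow, dualX_pow, map_zero]
  x_h := by rw [← map_mul, x_mul_h, map_smul, map_mul]
  X_H := by
    have hqi : q ^ (n - 1) = q⁻¹ := eq_inv_of_mul_eq_one_left <| by
      rw [← pow_succ, Nat.sub_add_cancel (pos_of_mem_primitiveRoots hq),
        pow_eq_one_of_mem_primitiveRoots hq]
    rw [← map_mul, dualX_mul_dualH, map_smul, map_mul, hqi]
  h_H := h_mul_dualH
  x_H := x_mul_dualH
  h_X := h_mul_dualX hn
  x_X := x_mul_dualX hn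

/-- The homomorphism `h ↦ ε ⊗ h`, `x ↦ ε ⊗ x`, `H ↦ dualH ⊗ 1`, `X ↦ dualX ⊗ 1` to the Drinfeld
double of the Taft algebra. -/
def ofQBicrossed : QBicrossed hq (-q) →ₐc[k] DrinfeldDouble k (TaftAlgebra hq) :=
  PairAlgebra.liftBialgHom (pow_pred_mem_primitiveRoots hq) hq (isPair hn)
    (isGroupLikeElem_incl (isGroupLikeElem_h hq)) (isSkewPrimitive_incl (isSkewPrimitive_x hq))
    (isGroupLikeElem_inclDual (isGroupLikeElem_dualH hq))
    (isSkewPrimitive_inclDual (isSkewPrimitive_dualX hq hn))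

theorem ofQBicrossed_gen (i : PairGen) :
    ofQBicrossed hn (PairAlgebra.gen (pow_pred_mem_primitiveRoots hq) hq q (-q) i) =
      PairAlgebra.genMap (incl k _ (h hq)) (incl k _ (x hq)) (inclDual k _ (dualH hq))
        (inclDual k _ (dualX hq hn)) i :=
  PairAlgebra.liftBialgHom_gen _ _ _ _ _ i

theorem ofQBicrossed_surjective : Function.Surjective (ofQBicrossed (hq := hq) hn) := by
  let S := (ofQBicrossed (hq := hq) hn).toAlgHom.range
  have hincl : S.comap (incl k (TaftAlgebra hq)) = ⊤ := by
    rw [eq_top_iff, ← TaftAlgebra.adjoin_eq_top hq]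
    refine Algebra.adjoin_le ?_
    rintro _ (rfl | rfl)
    exacts [⟨_, ofQBicrossed_gen hn .h⟩, ⟨_, ofQBicrossed_gen hn .x⟩]
  have hdual : S.comap (inclDual k (TaftAlgebra hq)) = ⊤ := by
    rw [eq_top_iff, ← adjoin_dual_eq_top hn]
    refine Algebra.adjoin_le ?_
    rintro _ (rfl | rfl)
    exacts [⟨_, ofQBicrossed_gen hn .H⟩, ⟨_, ofQBicrossed_gen hn .X⟩]
  exact AlgHom.range_eq_top _ |>.1 <| eq_top_of_incl_mem_of_inclDual_mem
    (Algebra.eq_top_iff.1 hincl) (Algebra.eq_top_iff.1 hdual)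

theorem ofQBicrossed_bijective : Function.Bijective (ofQBicrossed (hq := hq) hn) := by
  let f : QBicrossed hq (-q) →ₗ[k] DrinfeldDouble k (TaftAlgebra hq) :=
    (ofQBicrossed hn).toAlgHom.toLinearMap
  have hs : Function.Surjective f := ofQBicrossed_surjective hn
  have hfin : Module.Finite k (DrinfeldDouble k (TaftAlgebra hq)) := .of_surjective f hs
  have hle := PairAlgebra.finrank_le (pow_pred_mem_primitiveRoots hq) hq q (-q)
  rw [TaftAlgebra.finrank_eq hn, ← TaftAlgebra.finrank_eq (hq := hq) hn,
    ← DrinfeldDouble.finrank_eq] at hle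
  have hrank := le_antisymm hle (LinearMap.finrank_le_finrank_of_surjective hs)
  exact ⟨(LinearMap.injective_iff_surjective_of_finrank_eq_finrank hrank).2 hs, hs⟩

end DrinfeldDouble

theorem QBicrossed.nonempty_bialgEquiv_drinfeldDouble (hn : 2 ≤ n)
    (hq : q ∈ primitiveRoots n k) :
    Nonempty (QBicrossed hq 1 ≃ₐc[k] DrinfeldDouble k (TaftAlgebra hq)) := by
  obtain ⟨e⟩ : Nonempty (QBicrossed hq 1 ≃ₐc[k] QBicrossed hq (-q)) :=
    PairAlgebra.nonempty_bialgEquiv_scale one_ne_zero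
      (neg_ne_zero.2 (ne_zero_of_mem_primitiveRoots hq))
  exact ⟨e.trans (.ofBijective _ (ofQBicrossed_bijective hn))⟩

end Taft

end TaftDouble

end

theorem mainTheorem3_general {k : Type*} [Field k] (m n : ℕ) (hm : 2 ≤ m) (hn : 2 ≤ n) :
    (∀ (q qb : k) (hq : q ∈ primitiveRoots m k) (hqb : qb ∈ primitiveRoots n k),
      (n ≠ m ∨ (m = n ∧ qb ≠ q)) →
      ∀ σ σ' : k, σ ^ Nat.gcd m n = 1 →
        (Nonempty (TaftDouble.TBicrossed hqb hq σ ≃ₐc[k] TaftDouble.TBicrossed hqb hq σ') ↔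
          σ = σ')) ∧
    (∀ (q : k) (hq : q ∈ primitiveRoots n k), ∀ σ σ' : k, σ ^ n = 1 →
        (Nonempty (TaftDouble.TBicrossed hq hq σ ≃ₐc[k] TaftDouble.TBicrossed hq hq σ') ↔
          (σ' = σ ∨ σ' = σ⁻¹))) ∧
    (∀ (q : k) (hq : q ∈ primitiveRoots n k),
      (∀ α : k, α ≠ 0 →
        Nonempty (TaftDouble.QBicrossed hq α ≃ₐc[k] TaftDouble.QBicrossed hq 1)) ∧
      Nonempty (TaftDouble.QBicrossed hq 1 ≃ₐc[k]
        TaftDouble.DrinfeldDouble k (TaftDouble.TaftAlgebra hq))) ∧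
    (∀ (q : k) (hq : q ∈ primitiveRoots n k), ∀ σ : k,
      ¬ Nonempty (TaftDouble.QBicrossed hq 1 ≃ₐc[k]
        TaftDouble.TBicrossed (TaftDouble.pow_pred_mem_primitiveRoots hq) hq σ)) := by
  refine ⟨?_, ?_, ?_, ?_⟩
  · intro q qb hq hqb hne σ σ' hσ
    refine TaftDouble.TBicrossed.nonempty_bialgEquiv_iff hm hn ?_ hσ
    rintro rfl
    exact hne.elim (fun hnm => hnm ((isPrimitiveRoot_of_mem_primitiveRoots hqb).unique
      (isPrimitiveRoot_of_mem_primitiveRoots hq))) fun h => h.2 rfl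
  · exact fun q hq σ σ' hσ => TaftDouble.TBicrossed.nonempty_bialgEquiv_self_iff hn hσ
  · exact fun q hq => ⟨fun α hα => TaftDouble.PairAlgebra.nonempty_bialgEquiv_scale hα one_ne_zero,
      TaftDouble.QBicrossed.nonempty_bialgEquiv_drinfeldDouble hn hq⟩
  · rintro q hq σ ⟨φ⟩
    exact (TaftDouble.PairAlgebra.isEmpty_algEquiv_TBicrossed hn one_ne_zero).false
      (AlgEquivClass.toAlgEquiv φ)

theorem mainTheorem3 {k : Type*} [Field k] [CharZero k] (m n : ℕ) (hm : 2 ≤ m) (hn : 2 ≤ n) :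
    (∀ (q qb : k) (hq : q ∈ primitiveRoots m k) (hqb : qb ∈ primitiveRoots n k),
      (n ≠ m ∨ (m = n ∧ qb ≠ q)) →
      ∀ σ σ' : k, σ ^ Nat.gcd m n = 1 → σ' ^ Nat.gcd m n = 1 →
        (Nonempty (TaftDouble.TBicrossed hqb hq σ ≃ₐc[k] TaftDouble.TBicrossed hqb hq σ') ↔
          σ = σ')) ∧
    (∀ (q : k) (hq : q ∈ primitiveRoots n k), ∀ σ σ' : k, σ ^ n = 1 → σ' ^ n = 1 →
        (Nonempty (TaftDouble.TBicrossed hq hq σ ≃ₐc[k] TaftDouble.TBicrossed hq hq σ') ↔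
          (σ' = σ ∨ σ' = σ⁻¹))) ∧
    (∀ (q : k) (hq : q ∈ primitiveRoots n k),
      (∀ α : k, α ≠ 0 →
        Nonempty (TaftDouble.QBicrossed hq α ≃ₐc[k] TaftDouble.QBicrossed hq 1)) ∧
      Nonempty (TaftDouble.QBicrossed hq 1 ≃ₐc[k]
        TaftDouble.DrinfeldDouble k (TaftDouble.TaftAlgebra hq))) ∧
    (∀ (q : k) (hq : q ∈ primitiveRoots n k), ∀ σ : k, σ ^ n = 1 →
      ¬ Nonempty (TaftDouble.QBicrossed hq 1 ≃ₐc[k]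
        TaftDouble.TBicrossed (TaftDouble.pow_pred_mem_primitiveRoots hq) hq σ)) := by
  obtain ⟨hT, hTself, hQ, hQT⟩ := mainTheorem3_general (k := k) m n hm hn
  exact ⟨fun q qb hq hqb hne σ σ' hσ _ => hT q qb hq hqb hne σ σ' hσ,
    fun q hq σ σ' hσ _ => hTself q hq σ σ' hσ, hQ, fun q hq σ _ => hQT q hq σ⟩
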